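/- **Conventions.** $\mathbb R^{r,s}$ is $\mathbb R^{r+s}$ with the flat metric $\eta$ of signature $(r,s)$. A (conformally) isometric embedding of a Riemannian manifold $(M,g)$ is a smooth embedding $\iota:M\to\mathbb R^{r,s}$ with $\iota^*\eta=g$ (respectively $\iota^*\eta=\Omega^2g$ for some $\Omega:M\to(0,\infty)$); the isometric (conformal) embedding class of the $n$-manifold $M$ is the least $k$ such that such an $\iota$ exists for some $r+s=n+k$. On $\mathbb C^2\setminus\{0\}\cong(0,\infty)\times S^3$ let $\sigma_1,\sigma_2,\sigma_3$ be the left-invariant one-forms of $SU(2)=S^3$, $d\sigma_1+\sigma_2\wedge\sigma_3=0$ and cyclically, and let $h:S^3\to S^2\subset\mathbb R^3$ be the Hopf map. For functions $R,Z,F$ of a radial coordinate, the radial map $[R,Z]$ sends $z$ to $\bigl(R\,z/|z|,\;Z\,h(z/|z|)\bigr)\in\mathbb R^4\times\mathbb R^3=\mathbb R^7$, and $[R,Z,F]$ sends $z$ to $([R,Z](z),F)\in\mathbb R^8$. Consider metrics $A\,dr^2+B(\sigma_1^2+\sigma_2^2)+C\sigma_3^2$: * **Fubini–Study** on $\mathbb{CP}^2$: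 in the affine chart $[z_1:z_2:1]$ with $r=|z|$, $A=\frac1{(1+r^2)^2}$, $B=\frac{r^2}{4(1+r^2)}$, $C=\frac{r^2}{4(1+r^2)^2}$, extended smoothly to $\mathbb{CP}^2$. * **Eguchi–Hanson**, parameter $a>0$: $A=(1-a^4/r^4)^{-1}$, $B=\frac{r^2}4$, $C=\frac{r^2}4(1-a^4/r^4)$ on $M_a=\{z\in\mathbb C^2:|z|>a\}$, $r=|z|$ (the double cover of the complement of the bolt in the complete Eguchi–Hanson manifold). * **Anti-self-dual Taub–NUT**, mass $m>0$: $A=\frac{r+m}{4(r-m)}$, $B=\frac{r^2-m^2}4$, $C=m^2\frac{r-m}{r+m}$, with $r=m+|z|^2$, extended smoothly over the nut $z=0$ to all of $\mathbb C^2=\mathbb R^4$. **Theorem.** (1) *Isometric embeddings.* * $\mathbb{CP}^2$ has an isometric embedding in $\mathbb R^{8,0}$ that on $\{[z:1]:z\ne0\}$ is $[R,Z,F]$ with $R=\frac r{1+r^2}$, $Z=\frac{r^2}{2(1+r^2)}$, $F=\frac{\sqrt3}{2(1+r^2)}$. * There is a function $F$ on $(a,\infty)$ with $F'=\frac{\sqrt3a^2}{2r^2}\bigl(\frac{3r^4+a^4}{r^4-a^4}\bigr)^{1/2}$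 such that $[R,Z,F]$, $R=\frac{(r^4-a^4)^{1/2}}r$, $Z=\frac{a^2}{2r}$, is an isometric embedding of the Eguchi–Hanson metric on $M_a$ in $\mathbb R^{7,1}$ ($F$ being the negative direction). * There is a function $F$ on $(m,\infty)$ with $F'=\Bigl(\frac{2mr^3+9m^2r^2+24m^3r+29m^4}{4(r+m)^3(r+3m)}\Bigr)^{1/2}$ and an isometric embedding of the Taub–NUT metric on all of $\mathbb R^4$ in $\mathbb R^{8,0}$ that for $z\neq0$ is $[R,Z,F]$ with $R=2m\bigl(\frac{r-m}{r+m}\bigr)^{1/2}$, $Z=\frac{r-m}2\bigl(\frac{r+3m}{r+m}\bigr)^{1/2}$. (2) *Isometric embedding class.* Every non-empty open subset of $\mathbb{CP}^2$, of $M_a$, and of Taub–NUT space (in particular the whole space) has isometric embedding class at least $3$ and at most $4$. (3) *Radial conformal embeddings in $\mathbb R^7$.* * $\mathbb{CP}^2$ has a conformally isometric embedding in $\mathbb R^7$ which for $z\ne0$ has $\Omega=\frac{r^2+1}{r^2+4}$ and is $\bigl[\frac r{r^2+4},\frac{r^2}{2(r^2+4)}\bigr]$; and $\mathbb{CP}^2\setminus\{[0:0:1]\}$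 has one which for $z\neq 0$ has $\Omega=1+r^{-2}$ and is $\bigl[\frac1r,\frac12\bigr]$. * For either sign there is a positive solution of $\displaystyle\frac{\Omega'}{\Omega}=\frac{3a^4+4r^4\pm2r^4\sqrt{\frac{7a^4-4r^4}{a^4-r^4}}}{r(3a^4-4r^4)}$ on $r>(7/4)^{1/4}a$ such that $[2\Omega\sqrt C,\Omega\sqrt{B-C}]$ is a conformally isometric embedding of the part $\{r>(7/4)^{1/4}a\}$ of $M_a$ in $\mathbb R^7$ with factor $\Omega(r)$. * For either sign there is a positive solution of $\displaystyle\frac{\Omega'}{\Omega}=\frac{(3m+r)(4m^2-mr+r^2)\pm(r+m)^2\sqrt{\frac{55m^3+3m^2r+5mr^2+r^3}{3m+r}}}{(m^2-r^2)(13m^2+2mr+r^2)}$ on $r>m$ such that $[2\Omega\sqrt C,\Omega\sqrt{B-C}]$ is a conformally isometric embedding of Taub–NUT space minus the nut in $\mathbb R^7$ with factor $\Omega(r)$; for the sign $-$ it extends to a conformally isometric embedding of all of Taub–NUT space. (4) *Conformal embedding class.* Every non-empty open subset of $\mathbb{CP}^2$, of the part $\{r>(7/4)^{1/4}a\}$ of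 $M_a$, and of Taub–NUT space has conformal embedding class at most $3$. -/

import Mathlib

open Set Topology
open scoped Manifold ContDiff LinearAlgebra.Projectivization

noncomputable section

namespace GravInst

/-! ## Isometric and conformal embeddings into pseudo-Euclidean spaces -/

/-- The underlying vector space of the pseudo-Euclidean space `ℝ^{r,s}`. -/
abbrev PseudoEuclid (r s : ℕ) : Type := (Fin r → ℝ) × (Fin s → ℝ)

/-- The flat metric of signature `(r, s)`. -/
def eta {r s : ℕ} (x y : PseudoEuclid r s) : ℝ :=
  (∑ i, x.1 i * y.1 i) - ∑ j, x.2 j * y.2 j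

section Embeddings

variable {E : Type*} [NormedAddCommGroup E] [NormedSpace ℝ E]
  {M : Type*} [TopologicalSpace M] [ChartedSpace E M]

/-- `f` restricts to a smooth conformally isometric embedding of the open set `U` of the
manifold `M` with metric `g`: it is smooth on `U`, a homeomorphism from `U` onto its image, and
`f^* η = Ω² g` on `U` with `Ω > 0`. (When `g` is positive definite the last condition forces the
differential to be injective, so the image of `U` is an embedded submanifold diffeomorphic
to `U`.) -/
structure IsConformalEmbeddingOn {r s : ℕ}
    (g : ∀ x : M, TangentSpace 𝓘(ℝ, E) x → TangentSpace 𝓘(ℝ, E) x → ℝ)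
    (Ω : M → ℝ) (U : Set M) (f : M → PseudoEuclid r s) : Prop where
  contMDiffOn : ContMDiffOn 𝓘(ℝ, E) 𝓘(ℝ, PseudoEuclid r s) ∞ f U
  isEmbedding : IsEmbedding (fun x : U => f x)
  factor_pos : ∀ x ∈ U, 0 < Ω x
  pullback : ∀ x ∈ U, ∀ u v : TangentSpace 𝓘(ℝ, E) x,
    eta (r := r) (s := s) (mfderiv 𝓘(ℝ, E) 𝓘(ℝ, PseudoEuclid r s) f x u)
      (mfderiv 𝓘(ℝ, E) 𝓘(ℝ, PseudoEuclid r s) f x v) = Ω x ^ 2 * g x u v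

/-- `f` restricts to a smooth isometric embedding of the open set `U` of `(M, g)`. -/
def IsIsometricEmbeddingOn {r s : ℕ}
    (g : ∀ x : M, TangentSpace 𝓘(ℝ, E) x → TangentSpace 𝓘(ℝ, E) x → ℝ)
    (U : Set M) (f : M → PseudoEuclid r s) : Prop :=
  IsConformalEmbeddingOn g (fun _ => 1) U f

/-- The isometric embedding class of the open set `U` of `(M, g)`: the least `k` such that `U`
embeds isometrically into some `ℝ^{r,s}` with `r + s = dim M + k` (`⊤` if there is none). -/
def isometricClass (g : ∀ x : M, TangentSpace 𝓘(ℝ, E) x → TangentSpace 𝓘(ℝ, E) x → ℝ)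
    (U : Set M) : ℕ∞ :=
  sInf {k : ℕ∞ | ∃ n r s : ℕ, k = n ∧ r + s = Module.finrank ℝ E + n ∧
    ∃ f : M → PseudoEuclid r s, IsIsometricEmbeddingOn g U f}

/-- The conformal embedding class of the open set `U` of `(M, g)`. -/
def conformalClass (g : ∀ x : M, TangentSpace 𝓘(ℝ, E) x → TangentSpace 𝓘(ℝ, E) x → ℝ)
    (U : Set M) : ℕ∞ :=
  sInf {k : ℕ∞ | ∃ n r s : ℕ, k = n ∧ r + s = Module.finrank ℝ E + n ∧
    ∃ (f : M → PseudoEuclid r s) (Ω : M → ℝ), IsConformalEmbeddingOn g Ω U f}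

end Embeddings

/-! ## `ℂ² = ℝ⁴`, the invariant one-forms, and locally rotationally symmetric metrics -/

/-- The Hermitian product of `ℂ²`. -/
def herm (z u : ℂ × ℂ) : ℂ := star z.1 * u.1 + star z.2 * u.2

/-- The squared Euclidean norm of `ℂ²`. -/
def normSq (z : ℂ × ℂ) : ℝ := Complex.normSq z.1 + Complex.normSq z.2

/-- The Euclidean norm of `ℂ²`. -/
def rad (z : ℂ × ℂ) : ℝ := √(normSq z)

/-- The invariant one-forms on `SU(2) = S³`, pulled back to `ℂ² ∖ {0}` by `z ↦ z / |z|`.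
They satisfy `dσ₁ + σ₂ ∧ σ₃ = 0` and its cyclic permutations. -/
def sigma1 (z u : ℂ × ℂ) : ℝ := 2 * (z.2 * u.1 - z.1 * u.2).re / normSq z

/-- The second invariant one-form, see `sigma1`. -/
def sigma2 (z u : ℂ × ℂ) : ℝ := 2 * (z.2 * u.1 - z.1 * u.2).im / normSq z

/-- The third invariant one-form, see `sigma1`. -/
def sigma3 (z u : ℂ × ℂ) : ℝ := -2 * (herm z u).im / normSq z

/-- The metric `A(r) dr² + B(r) (σ₁² + σ₂²) + C(r) σ₃²` on `ℂ² ∖ {0}`, where the radial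
coordinate `r` is a given function on `ℂ²`. -/
def lrsMetric (A B C : ℝ → ℝ) (r : ℂ × ℂ → ℝ) (z u v : ℂ × ℂ) : ℝ :=
  A (r z) * (fderiv ℝ r z u * fderiv ℝ r z v)
    + B (r z) * (sigma1 z u * sigma1 z v + sigma2 z u * sigma2 z v)
    + C (r z) * (sigma3 z u * sigma3 z v)

/-- The quadratic extension `ℂ² → ℝ³` of the Hopf map `S³ → S²`. -/
def hopf (z : ℂ × ℂ) : Fin 3 → ℝ :=
  ![2 * (star z.1 * z.2).re, 2 * (star z.1 * z.2).im, Complex.normSq z.1 - Complex.normSq z.2]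

/-- The point of `ℝ⁷ = ℝ⁴ × ℝ³` at distance `R` in the direction `z / |z|` in `ℝ⁴` and at
(signed) distance `Z` in the direction of the Hopf image of `z / |z|` in `ℝ³`. -/
def radial7 (R Z : ℝ) (z : ℂ × ℂ) : Fin 7 → ℝ :=
  ![R * (z.1.re / rad z), R * (z.1.im / rad z), R * (z.2.re / rad z), R * (z.2.im / rad z),
    Z * (hopf z 0 / normSq z), Z * (hopf z 1 / normSq z), Z * (hopf z 2 / normSq z)]

/-- The point `(radial7 R Z z, F)` of `ℝ⁸ = ℝ⁷ × ℝ`. -/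
def radial8 (R Z F : ℝ) (z : ℂ × ℂ) : Fin 8 → ℝ := Fin.snoc (α := fun _ => ℝ) (radial7 R Z z) F

/-! ## The Eguchi--Hanson metric -/

/-- The coefficient of `dr²`. -/
def ehA (a r : ℝ) : ℝ := (1 - a ^ 4 / r ^ 4)⁻¹
/-- The coefficient of `σ₁² + σ₂²`. -/
def ehB (r : ℝ) : ℝ := r ^ 2 / 4
/-- The coefficient of `σ₃²`. -/
def ehC (a r : ℝ) : ℝ := r ^ 2 / 4 * (1 - a ^ 4 / r ^ 4)

/-- The Eguchi--Hanson metric with parameter `a`, on `{r > a}` with `r = |z|`. -/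
def ehMetric (a : ℝ) (z u v : ℂ × ℂ) : ℝ := lrsMetric (ehA a) ehB (ehC a) rad z u v

/-! ## The (anti-self-dual) Taub--NUT metric -/

/-- The coefficient of `dr²`. -/
def tnA (m r : ℝ) : ℝ := 1 / 4 * ((r + m) / (r - m))
/-- The coefficient of `σ₁² + σ₂²`. -/
def tnB (m r : ℝ) : ℝ := (r ^ 2 - m ^ 2) / 4
/-- The coefficient of `σ₃²`. -/
def tnC (m r : ℝ) : ℝ := m ^ 2 * ((r - m) / (r + m))

/-- The radial coordinate `r = m + |z|²` of Taub--NUT space. -/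
def tnR (m : ℝ) (z : ℂ × ℂ) : ℝ := m + normSq z

/-- The Taub--NUT metric of mass `m` on the whole of `ℝ⁴ = ℂ²`, the nut being the origin:
the smooth extension to the origin of `tnA m r dr² + tnB m r (σ₁² + σ₂²) + tnC m r σ₃²`,
see `tnMetric_eq_lrsMetric`. -/
def tnMetric (m : ℝ) (z u v : ℂ × ℂ) : ℝ :=
  (normSq z + 2 * m) * (herm u v).re
    - (normSq z + 4 * m) / (normSq z + 2 * m) * ((herm z u).im * (herm z v).im)

/-! ## The complex projective plane with the Fubini--Study metric -/

/-- The Fubini--Study metric in an affine chart; in polar coordinates with `r = |z|` it is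
`dr² / (1 + r²)² + r² (σ₁² + σ₂²) / (4 (1 + r²)) + r² σ₃² / (4 (1 + r²)²)`,
see `fsAffine_eq_lrsMetric`. -/
def fsAffine (z u v : ℂ × ℂ) : ℝ :=
  (herm u v).re / (1 + normSq z) - (herm u z * herm z v).re / (1 + normSq z) ^ 2

lemma normSq_pos {z : ℂ × ℂ} (hz : z ≠ 0) : 0 < normSq z := by
  have h1 := Complex.normSq_nonneg z.1
  have h2 := Complex.normSq_nonneg z.2
  rcases eq_or_ne z.1 0 with h | h
  · have : z.2 ≠ 0 := fun h' => hz (Prod.ext h h')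
    have := Complex.normSq_pos.2 this
    unfold normSq; linarith
  · have := Complex.normSq_pos.2 h
    unfold normSq; linarith

lemma hasFDerivAt_normSq (z : ℂ × ℂ) : ∃ L : ℂ × ℂ →L[ℝ] ℝ, HasFDerivAt normSq L z ∧
    ∀ u, L u = 2 * (herm z u).re := by
  have h1 : HasFDerivAt (fun w : ℂ × ℂ => w.1.re) _ z :=
    (Complex.reCLM.comp (ContinuousLinearMap.fst ℝ ℂ ℂ)).hasFDerivAt
  have h2 : HasFDerivAt (fun w : ℂ × ℂ => w.1.im) _ z :=
    (Complex.imCLM.comp (ContinuousLinearMap.fst ℝ ℂ ℂ)).hasFDerivAt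
  have h3 : HasFDerivAt (fun w : ℂ × ℂ => w.2.re) _ z :=
    (Complex.reCLM.comp (ContinuousLinearMap.snd ℝ ℂ ℂ)).hasFDerivAt
  have h4 : HasFDerivAt (fun w : ℂ × ℂ => w.2.im) _ z :=
    (Complex.imCLM.comp (ContinuousLinearMap.snd ℝ ℂ ℂ)).hasFDerivAt
  refine ⟨_, ((h1.mul h1).add (h2.mul h2)).add ((h3.mul h3).add (h4.mul h4)), ?_⟩
  intro u
  simp [herm]
  ring

lemma fderiv_normSq (z u : ℂ × ℂ) : fderiv ℝ normSq z u = 2 * (herm z u).re := by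
  obtain ⟨L, hL, h⟩ := hasFDerivAt_normSq z
  rw [hL.fderiv, h]

lemma fderiv_tnR (m : ℝ) (z u : ℂ × ℂ) : fderiv ℝ (tnR m) z u = 2 * (herm z u).re := by
  obtain ⟨L, hL, h⟩ := hasFDerivAt_normSq z
  have : HasFDerivAt (tnR m) L z := hL.const_add m
  rw [this.fderiv, h]

lemma fderiv_rad {z : ℂ × ℂ} (hz : z ≠ 0) (u : ℂ × ℂ) :
    fderiv ℝ rad z u = (herm z u).re / rad z := by
  obtain ⟨L, hL, h⟩ := hasFDerivAt_normSq z
  have : HasFDerivAt rad _ z := hL.sqrt (normSq_pos hz).ne'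
  rw [this.fderiv]
  simp [h, rad]
  ring

lemma herm_decomp (z u v : ℂ × ℂ) :
    (z.2 * u.1 - z.1 * u.2).re * (z.2 * v.1 - z.1 * v.2).re
      + (z.2 * u.1 - z.1 * u.2).im * (z.2 * v.1 - z.1 * v.2).im
      + ((herm z u).re * (herm z v).re + (herm z u).im * (herm z v).im)
      = normSq z * (herm u v).re := by
  simp [herm, normSq, Complex.normSq_apply]
  ring

lemma tnMetric_eq_lrsMetric {m : ℝ} (hm : 0 < m) {z : ℂ × ℂ} (hz : z ≠ 0) (u v : ℂ × ℂ) :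
    tnMetric m z u v = lrsMetric (tnA m) (tnB m) (tnC m) (tnR m) z u v := by
  have hs := normSq_pos hz
  have hd := herm_decomp z u v
  simp only [tnMetric, lrsMetric, fderiv_tnR, tnA, tnB, tnC, sigma1, sigma2, sigma3, tnR]
  generalize normSq z = s at *
  have h1 : (herm u v).re = ((z.2 * u.1 - z.1 * u.2).re * (z.2 * v.1 - z.1 * v.2).re
      + (z.2 * u.1 - z.1 * u.2).im * (z.2 * v.1 - z.1 * v.2).im
      + ((herm z u).re * (herm z v).re + (herm z u).im * (herm z v).im)) / s := by
    rw [hd]; field_simp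
  rw [h1]
  have h2 : m + s - m = s := by ring
  have h3 : m + s + m = s + 2 * m := by ring
  have h4 : (m + s) ^ 2 - m ^ 2 = s * (s + 2 * m) := by ring
  rw [h2, h3, h4]
  have h5 : s + 2 * m ≠ 0 := by positivity
  field_simp
  ring

lemma fsAffine_eq_lrsMetric {z : ℂ × ℂ} (hz : z ≠ 0) (u v : ℂ × ℂ) :
    fsAffine z u v = lrsMetric (fun r => 1 / (1 + r ^ 2) ^ 2)
      (fun r => 1 / 4 * (r ^ 2 / (1 + r ^ 2))) (fun r => 1 / 4 * (r ^ 2 / (1 + r ^ 2) ^ 2))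
      rad z u v := by
  have hs := normSq_pos hz
  have hd := herm_decomp z u v
  have hr : rad z ^ 2 = normSq z := Real.sq_sqrt hs.le
  have hrr : rad z ≠ 0 := (Real.sqrt_pos.2 hs).ne'
  have h0 : (herm u z * herm z v).re
      = (herm z u).re * (herm z v).re + (herm z u).im * (herm z v).im := by
    simp [herm]; ring
  simp only [fsAffine, lrsMetric, fderiv_rad hz, sigma1, sigma2, sigma3, h0, hr]
  have h6 : (herm z u).re / rad z * ((herm z v).re / rad z)
      = (herm z u).re * (herm z v).re / normSq z := by
    rw [← hr]; field_simp
  rw [h6]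
  generalize normSq z = s at *
  have h1 : (herm u v).re = ((z.2 * u.1 - z.1 * u.2).re * (z.2 * v.1 - z.1 * v.2).re
      + (z.2 * u.1 - z.1 * u.2).im * (z.2 * v.1 - z.1 * v.2).im
      + ((herm z u).re * (herm z v).re + (herm z u).im * (herm z v).im)) / s := by
    rw [hd]; field_simp
  rw [h1]
  have h5 : 1 + s ≠ 0 := by positivity
  field_simp
  ring

/-- The complex projective plane. -/
def CP2 : Type := ℙ ℂ (Fin 3 → ℂ)

namespace CP2

/-- The point with given homogeneous coordinates. -/
def mk (w : {w : Fin 3 → ℂ // w ≠ 0}) : CP2 := Projectivization.mk ℂ w.1 w.2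

/-- The quotient topology. -/
instance : TopologicalSpace CP2 := TopologicalSpace.coinduced mk inferInstance

lemma isQuotientMap_mk : IsQuotientMap mk :=
  ⟨⟨rfl⟩, fun x => ⟨⟨x.rep, x.rep_nonzero⟩, x.mk_rep⟩⟩

/-- The domain of the `i`-th affine chart. -/
def affineSet (i : Fin 3) : Set CP2 := {x | x.rep i ≠ 0}

/-- The `i`-th affine coordinates `[w] ↦ (w j / w i, w k / w i)`, where `j < k` are the two
indices other than `i`. -/
def toAffine (i : Fin 3) (x : CP2) : ℂ × ℂ :=
  (x.rep (i.succAbove 0) / x.rep i, x.rep (i.succAbove 1) / x.rep i)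

/-- Homogeneous coordinates of the point with given `i`-th affine coordinates. -/
def affineVec (i : Fin 3) (z : ℂ × ℂ) : Fin 3 → ℂ := i.insertNth (1 : ℂ) ![z.1, z.2]

@[simp] lemma affineVec_self (i : Fin 3) (z : ℂ × ℂ) : affineVec i z i = 1 := by
  simp [affineVec]

@[simp] lemma affineVec_zero (i : Fin 3) (z : ℂ × ℂ) :
    affineVec i z (i.succAbove 0) = z.1 := by
  simp [affineVec]

@[simp] lemma affineVec_one (i : Fin 3) (z : ℂ × ℂ) :
    affineVec i z (i.succAbove 1) = z.2 := by
  simp [affineVec]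

lemma affineVec_ne (i : Fin 3) (z : ℂ × ℂ) : affineVec i z ≠ 0 := fun h => by
  have := affineVec_self i z
  rw [h] at this
  simp at this

/-- The point with given `i`-th affine coordinates. -/
def ofAffine (i : Fin 3) (z : ℂ × ℂ) : CP2 := mk ⟨affineVec i z, affineVec_ne i z⟩

lemma rep_mk (w : {w : Fin 3 → ℂ // w ≠ 0}) :
    ∃ c : ℂ, c ≠ 0 ∧ ∀ k, (mk w).rep k = c * w.1 k := by
  obtain ⟨c, hc⟩ := Projectivization.exists_smul_eq_mk_rep ℂ w.1 w.2
  refine ⟨c, c.ne_zero, fun k => ?_⟩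
  exact (congrFun hc k).symm

lemma mk_mem_affineSet (i : Fin 3) (w : {w : Fin 3 → ℂ // w ≠ 0}) :
    mk w ∈ affineSet i ↔ w.1 i ≠ 0 := by
  obtain ⟨c, hc, h⟩ := rep_mk w
  simp [affineSet, h, hc]

lemma toAffine_mk (i : Fin 3) (w : {w : Fin 3 → ℂ // w ≠ 0}) :
    toAffine i (mk w) = (w.1 (i.succAbove 0) / w.1 i, w.1 (i.succAbove 1) / w.1 i) := by
  obtain ⟨c, hc, h⟩ := rep_mk w
  simp [toAffine, h, mul_div_mul_left _ _ hc]

lemma ofAffine_mem (i : Fin 3) (z : ℂ × ℂ) : ofAffine i z ∈ affineSet i := by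
  simp [ofAffine, mk_mem_affineSet]

lemma toAffine_ofAffine (i : Fin 3) (z : ℂ × ℂ) : toAffine i (ofAffine i z) = z := by
  simp [ofAffine, toAffine_mk]

lemma ofAffine_toAffine (i : Fin 3) {x : CP2} (hx : x ∈ affineSet i) :
    ofAffine i (toAffine i x) = x := by
  have hx' : x.rep i ≠ 0 := hx
  have h : x = mk ⟨x.rep, x.rep_nonzero⟩ := x.mk_rep.symm
  conv_rhs => rw [h]
  unfold ofAffine mk
  refine (Projectivization.mk_eq_mk_iff' ℂ _ _ _ _).2 ⟨(x.rep i)⁻¹, ?_⟩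
  funext k
  rcases eq_or_ne k i with rfl | hk
  · simp [hx']
  · obtain ⟨l, rfl⟩ := Fin.exists_succAbove_eq hk
    fin_cases l
    · simp [toAffine, div_eq_inv_mul]
    · simp [toAffine, div_eq_inv_mul]

lemma isOpen_affineSet (i : Fin 3) : IsOpen (affineSet i) := by
  rw [← isQuotientMap_mk.isOpen_preimage]
  have : mk ⁻¹' affineSet i = {w | w.1 i ≠ 0} := by
    ext w; exact mk_mem_affineSet i w
  rw [this]
  exact isOpen_ne_fun ((continuous_apply i).comp continuous_subtype_val) continuous_const

lemma continuous_affineVec (i : Fin 3) : Continuous (affineVec i) := by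
  refine continuous_pi fun k => ?_
  rcases eq_or_ne k i with rfl | hk
  · simpa using continuous_const
  · obtain ⟨l, rfl⟩ := Fin.exists_succAbove_eq hk
    fin_cases l
    · simpa using continuous_fst
    · simpa using continuous_snd

/-- The `i`-th affine chart. -/
def affineChart (i : Fin 3) : OpenPartialHomeomorph CP2 (ℂ × ℂ) where
  toFun := toAffine i
  invFun := ofAffine i
  source := affineSet i
  target := univ
  map_source' _ _ := mem_univ _
  map_target' z _ := ofAffine_mem i z
  left_inv' _ hx := ofAffine_toAffine i hx
  right_inv' z _ := toAffine_ofAffine i z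
  open_source := isOpen_affineSet i
  open_target := isOpen_univ
  continuousOn_toFun := by
    rw [isQuotientMap_mk.continuousOn_isOpen_iff (isOpen_affineSet i)]
    have h : toAffine i ∘ mk = fun w : {w : Fin 3 → ℂ // w ≠ 0} =>
        (w.1 (i.succAbove 0) / w.1 i, w.1 (i.succAbove 1) / w.1 i) := by
      funext w; exact toAffine_mk i w
    rw [h]
    have hc : ∀ k : Fin 3, Continuous fun w : {w : Fin 3 → ℂ // w ≠ 0} => w.1 k :=
      fun k => (continuous_apply k).comp continuous_subtype_val
    have hne : ∀ w ∈ mk ⁻¹' affineSet i, w.1 i ≠ 0 := fun w hw => (mk_mem_affineSet i w).1 hw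
    exact ((hc _).continuousOn.div (hc i).continuousOn hne).prodMk
      ((hc _).continuousOn.div (hc i).continuousOn hne)
  continuousOn_invFun :=
    (isQuotientMap_mk.continuous.comp
      ((continuous_affineVec i).subtype_mk (affineVec_ne i))).continuousOn

lemma exists_mem_affineSet (x : CP2) : ∃ i, x ∈ affineSet i := by
  by_contra! h
  exact x.rep_nonzero (funext fun i => by simpa [affineSet] using h i)

instance : ChartedSpace (ℂ × ℂ) CP2 where
  atlas := range affineChart
  chartAt x := affineChart (exists_mem_affineSet x).choose
  mem_chart_source x := (exists_mem_affineSet x).choose_spec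
  chart_mem_atlas _ := mem_range_self _

lemma contDiff_affineVec (i k : Fin 3) : ContDiff ℝ ∞ fun z => affineVec i z k := by
  rcases eq_or_ne k i with rfl | hk
  · simpa using contDiff_const
  · obtain ⟨l, rfl⟩ := Fin.exists_succAbove_eq hk
    fin_cases l
    · simpa using contDiff_fst
    · simpa using contDiff_snd

instance : IsManifold 𝓘(ℝ, ℂ × ℂ) ∞ CP2 := by
  refine isManifold_of_contDiffOn 𝓘(ℝ, ℂ × ℂ) ∞ CP2 ?_
  rintro _ _ ⟨i, rfl⟩ ⟨j, rfl⟩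
  have hf : ∀ z, toAffine j (ofAffine i z) = (affineVec i z (j.succAbove 0) / affineVec i z j,
      affineVec i z (j.succAbove 1) / affineVec i z j) := fun z => toAffine_mk j _
  have key : ContDiffOn ℝ ∞ (fun z => toAffine j (ofAffine i z))
      {z | ofAffine i z ∈ affineSet j} := by
    have hne : ∀ z ∈ {z | ofAffine i z ∈ affineSet j}, affineVec i z j ≠ 0 :=
      fun z hz => (mk_mem_affineSet j _).1 hz
    have hd : ∀ k, ContDiffOn ℝ ∞ (fun z => affineVec i z k / affineVec i z j)
        {z | ofAffine i z ∈ affineSet j} := fun k => by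
      simp only [div_eq_mul_inv]
      exact (contDiff_affineVec i k).contDiffOn.mul ((contDiff_affineVec i j).contDiffOn.inv hne)
    simp only [hf]
    exact (hd _).prodMk (hd _)
  refine key.mono ?_
  intro z hz
  simpa [affineChart] using hz

end CP2

/-- The Fubini--Study metric of `ℂℙ²`: in each affine chart it is given by `fsAffine`. (The
tangent space at `x` is identified with `ℂ²` by the preferred affine chart at `x`.) -/
def fsMetric (x : CP2) (u v : TangentSpace 𝓘(ℝ, ℂ × ℂ) x) : ℝ :=
  fsAffine (chartAt (ℂ × ℂ) x x) u v

/-- The point `[z₁ : z₂ : 1]` of `ℂℙ²`. -/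
def cpPoint (z : ℂ × ℂ) : CP2 := CP2.ofAffine 2 z

end GravInst

end

open GravInst

/-! Lower bounds. An isometric immersion into a space of dimension at most six has, at each point,
two symmetric forms A, B and weights w₁, w₂ for which the curvature operator on bivectors is, up to
sign, x ↦ w₁ A x A + w₂ B x B. The weights may have any sign or vanish, so all signatures are
treated at once. The three metrics are Kähler: for a suitable orientation the curvature operator
kills two self-dual bivectors J, K and has the third one, I, and the anti-self-dual ones as
eigenvectors. `gaussOp_obstruction` shows that this is impossible. The non-zero anti-self-dual
eigenvalues make A, B invertible and w₁, w₂ non-zero. With C = A⁻¹B, the kernel says C J Cᵀ = δ J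
and C K Cᵀ = δ K, so C commutes with JK = -I. Comparing eigenvalues shows that C and C² have scalar
symmetric parts, whence C = c + aI or C = c + n with n anti-self-dual. The former forces α⁴ = β⁴ by
determinants, the latter puts n in the kernel. The curvature is computed in the frame z, jz, ijz,
iz, which has constant structure coefficients and in which the metrics are diagonal with radial
entries (`curvCoeff_lrs`). Everything is pointwise, so any non-empty open set will do.

Upper bounds away from CP². The map z ↦ (p z, q hopf z), with p, q functions of s = |z|², pulls the
flat metric back to a combination of three Hermitian expressions (`core7Deriv_inner`). Two of the
coefficients fix p and q, that is R = 2Ω√C and Z = Ω√(B - C); the third leaves one scalar equation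
in the radial direction (`radialMap_isConformalEmbeddingOn`). With Ω = 1 this equation gives F', and
the sign of F'² decides whether the eighth direction is positive or negative. Without F it is a
quadratic for Ω'/Ω, whose two roots are the two signs in the statement. The map is an embedding
because s is a monotone function of the norms of the two components and z is the first component
divided by p. At the Taub-NUT nut all data are smooth in s, provided that Ω'/Ω is the root without a
pole.

Projective plane. The entries of the rank-one projection w w*/|w|² embed CP² isometrically in a
round seven-sphere in ℝ⁸. Projecting that sphere stereographically from two antipodal points, one
off the image and one equal to the image of [0:0:1], gives the two conformal embeddings in ℝ⁷. All
three maps are members of the family `cpMap t e` (t = 1, 4, 0), and `cpQ_conformal` treats them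
together. -/

noncomputable section

namespace GravInst

/-! ## An algebraic obstruction to curvature operators of rank-two Gauss form -/

section Obstruction

open Matrix

/-- The self-dual bivector `e₀₁ + e₂₃`. -/
def sdJ : Matrix (Fin 4) (Fin 4) ℝ := !![0, 1, 0, 0; -1, 0, 0, 0; 0, 0, 0, 1; 0, 0, -1, 0]
/-- The self-dual bivector `e₀₂ + e₃₁`. -/
def sdK : Matrix (Fin 4) (Fin 4) ℝ := !![0, 0, 1, 0; 0, 0, 0, -1; -1, 0, 0, 0; 0, 1, 0, 0]
/-- The self-dual bivector `e₀₃ + e₁₂`. -/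
def sdI : Matrix (Fin 4) (Fin 4) ℝ := !![0, 0, 0, 1; 0, 0, 1, 0; 0, -1, 0, 0; -1, 0, 0, 0]
/-- The anti-self-dual bivectors `e₀₁ - e₂₃`, `e₀₂ - e₃₁`, `e₀₃ - e₁₂`. -/
def asd : Fin 3 → Matrix (Fin 4) (Fin 4) ℝ :=
  ![!![0, 1, 0, 0; -1, 0, 0, 0; 0, 0, 0, -1; 0, 0, 1, 0],
    !![0, 0, 1, 0; 0, 0, 0, 1; -1, 0, 0, 0; 0, -1, 0, 0],
    !![0, 0, 0, 1; 0, 0, -1, 0; 0, 1, 0, 0; -1, 0, 0, 0]]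

/-- The action on bivectors of the curvature operator determined, through the Gauss equation,
by two second fundamental forms `A`, `B` with weights `w₁`, `w₂`. -/
def gaussOp (w₁ w₂ : ℝ) (A B x : Matrix (Fin 4) (Fin 4) ℝ) : Matrix (Fin 4) (Fin 4) ℝ :=
  w₁ • (A * x * A) + w₂ • (B * x * B)

variable {w₁ w₂ α : ℝ} {β : Fin 3 → ℝ} {A B : Matrix (Fin 4) (Fin 4) ℝ}

lemma gaussOp_comm (x : Matrix (Fin 4) (Fin 4) ℝ) :
    gaussOp w₁ w₂ A B x = gaussOp w₂ w₁ B A x := add_comm _ _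

lemma sdJ_mul_self : sdJ * sdJ = -1 := by
  ext i j; fin_cases i <;> fin_cases j <;> simp [sdJ, Matrix.mul_apply, Fin.sum_univ_four]

lemma sdK_mul_self : sdK * sdK = -1 := by
  ext i j; fin_cases i <;> fin_cases j <;> simp [sdK, Matrix.mul_apply, Fin.sum_univ_four]

lemma sdI_mul_self : sdI * sdI = -1 := by
  ext i j; fin_cases i <;> fin_cases j <;> simp [sdI, Matrix.mul_apply, Fin.sum_univ_four]

lemma sdJ_mul_sdK : sdJ * sdK = -sdI := by
  ext i j; fin_cases i <;> fin_cases j <;>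
    simp [sdI, sdJ, sdK, Matrix.mul_apply, Fin.sum_univ_four]

/-- Euler's four-square decomposition of `y` along the orthogonal frame `x, X₁ x, X₂ x, X₃ x`. -/
lemma four_square_decomp (x y : Fin 4 → ℝ) :
    (x ⬝ᵥ x) • y = (x ⬝ᵥ y) • x + ∑ k, (y ⬝ᵥ (asd k *ᵥ x)) • (asd k *ᵥ x) := by
  ext i
  fin_cases i <;>
    simp [asd, dotProduct, Matrix.mulVec, Fin.sum_univ_four, Fin.sum_univ_three] <;> ring

/-- On v the operator reduces to w₂ B x B v. Hence each anti-self-dual `asd k *ᵥ v` lies in the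
range of B, while J B v lies in its kernel, which is orthogonal to the range by symmetry. So J B v
is parallel to v; then B v = 0 follows, against the non-zero eigenvalues. -/
lemma gaussOp_singular (hB : B.IsSymm) (hJ : gaussOp w₁ w₂ A B sdJ = 0)
    (hX : ∀ k, gaussOp w₁ w₂ A B (asd k) = β k • asd k) (hβ : ∀ k, β k ≠ 0)
    {v : Fin 4 → ℝ} (hv : v ≠ 0) (hAv : w₁ • (A *ᵥ v) = 0) : False := by
  have hR : ∀ x, gaussOp w₁ w₂ A B x *ᵥ v = w₂ • (B *ᵥ (x *ᵥ (B *ᵥ v))) := by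
    intro x
    have : w₁ • ((A * x * A) *ᵥ v) = 0 := by
      rw [← Matrix.mulVec_mulVec, ← Matrix.mulVec_smul, hAv, Matrix.mulVec_zero]
    simp only [gaussOp, Matrix.add_mulVec, Matrix.smul_mulVec, this, zero_add]
    simp [Matrix.mulVec_mulVec, Matrix.mul_assoc]
  have hXv : ∀ k, β k • (asd k *ᵥ v) = w₂ • (B *ᵥ (asd k *ᵥ (B *ᵥ v))) := by
    intro k; rw [← hR, hX, Matrix.smul_mulVec]
  have hvv : v ⬝ᵥ v ≠ 0 := fun h => hv (dotProduct_self_eq_zero.1 h)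
  have hasd : ∀ k, asd k *ᵥ v ≠ 0 := by
    intro k h
    apply hvv
    have h0 := congrFun h 0; have h1 := congrFun h 1
    have h2 := congrFun h 2; have h3 := congrFun h 3
    fin_cases k <;> simp [asd, Matrix.mulVec, dotProduct, Fin.sum_univ_four] at h0 h1 h2 h3 <;>
      simp [dotProduct, Fin.sum_univ_four, h0, h1, h2, h3]
  have hw : w₂ ≠ 0 ∧ B *ᵥ v ≠ 0 := by
    constructor
    · rintro rfl
      have := hXv 0
      rw [zero_smul] at this
      exact (smul_ne_zero (hβ 0) (hasd 0)) this
    · intro h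
      have := hXv 0
      rw [h, Matrix.mulVec_zero, Matrix.mulVec_zero, smul_zero] at this
      exact (smul_ne_zero (hβ 0) (hasd 0)) this
  obtain ⟨hw2, hBv⟩ := hw
  set v' := sdJ *ᵥ (B *ᵥ v) with hv'
  have hBv' : B *ᵥ v' = 0 := by
    have := hR sdJ
    rw [hJ, Matrix.zero_mulVec] at this
    exact (smul_eq_zero.1 this.symm).resolve_left hw2
  have horth : ∀ k, v' ⬝ᵥ (asd k *ᵥ v) = 0 := by
    intro k
    have h1 : β k * (v' ⬝ᵥ (asd k *ᵥ v)) = 0 := by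
      rw [← smul_eq_mul, ← dotProduct_smul, hXv, dotProduct_smul, Matrix.dotProduct_mulVec,
        ← Matrix.mulVec_transpose, hB.eq, hBv', zero_dotProduct, smul_zero]
    exact (mul_eq_zero.1 h1).resolve_left (hβ k)
  -- Orthogonality to the three vectors leaves v' parallel to v. As B kills v' but not v, the factor
  -- must vanish.
  have h4 := four_square_decomp v v'
  simp only [horth, zero_smul, Finset.sum_const_zero, add_zero] at h4
  have h5 : (v ⬝ᵥ v') • (B *ᵥ v) = 0 := by
    rw [← Matrix.mulVec_smul, ← h4, Matrix.mulVec_smul, hBv', smul_zero]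
  have h6 := (smul_eq_zero.1 h5).resolve_right hBv
  rw [h6, zero_smul] at h4
  have h7 : v' = 0 := (smul_eq_zero.1 h4).resolve_left hvv
  apply hBv
  have h8 : sdJ *ᵥ v' = -(B *ᵥ v) := by
    rw [hv', Matrix.mulVec_mulVec, sdJ_mul_self, Matrix.neg_mulVec, Matrix.one_mulVec]
  rw [h7, Matrix.mulVec_zero] at h8
  exact neg_eq_zero.1 h8.symm

/-- A vanishing weight and a singular form both produce a non-zero v with w₁ A v = 0, which is why
`gaussOp_singular` is stated for the product. -/
lemma gaussOp_isUnit (hB : B.IsSymm) (hJ : gaussOp w₁ w₂ A B sdJ = 0)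
    (hX : ∀ k, gaussOp w₁ w₂ A B (asd k) = β k • asd k) (hβ : ∀ k, β k ≠ 0) :
    w₁ ≠ 0 ∧ A.det ≠ 0 := by
  constructor
  · rintro rfl
    refine gaussOp_singular hB hJ hX hβ (v := ![1, 0, 0, 0]) ?_ (zero_smul _ _)
    intro h; simpa using congrFun h 0
  · intro h
    obtain ⟨v, hv, hAv⟩ := Matrix.exists_mulVec_eq_zero_iff.2 h
    exact gaussOp_singular hB hJ hX hβ hv (by rw [hAv, smul_zero])

/-- A skew matrix commuting with `sdI` is a combination of `sdI` and the anti-self-dual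
bivectors. -/
lemma skew_commute_sdI {Y : Matrix (Fin 4) (Fin 4) ℝ} (hY : Yᵀ = -Y)
    (hc : sdI * Y = Y * sdI) : ∃ (a : ℝ) (y : Fin 3 → ℝ), Y = a • sdI + ∑ k, y k • asd k := by
  have s : ∀ i j, Y j i = -Y i j := fun i j => by simpa using congrFun (congrFun hY i) j
  have c := fun i j => congrFun (congrFun hc i) j
  have c1 := c 0 2
  have c2 := c 0 1
  simp [sdI, Matrix.mul_apply, Fin.sum_univ_four] at c1 c2
  refine ⟨(Y 0 3 + Y 1 2) / 2, ![Y 0 1, Y 0 2, (Y 0 3 - Y 1 2) / 2], ?_⟩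
  have d0 := s 0 0; have d1 := s 1 1; have d2 := s 2 2; have d3 := s 3 3
  have e1 := s 0 1; have e2 := s 0 2; have e3 := s 0 3
  have e4 := s 1 2; have e5 := s 1 3; have e6 := s 2 3
  ext i j
  fin_cases i <;> fin_cases j <;> simp [sdI, asd, Fin.sum_univ_three] <;> linarith

lemma asd_indep {a : ℝ} {y : Fin 3 → ℝ} (h : a • sdI + ∑ k, y k • asd k = 0) :
    a = 0 ∧ ∀ k, y k = 0 := by
  have c := fun i j => congrFun (congrFun h i) j
  have c1 := c 0 1; have c2 := c 0 2; have c3 := c 0 3; have c4 := c 1 2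
  simp [sdI, asd, Fin.sum_univ_three] at c1 c2 c3 c4
  refine ⟨by linarith, fun k => ?_⟩
  fin_cases k
  · exact c1
  · exact c2
  · simp; linarith

lemma gaussOp_add (x y : Matrix (Fin 4) (Fin 4) ℝ) :
    gaussOp w₁ w₂ A B (x + y) = gaussOp w₁ w₂ A B x + gaussOp w₁ w₂ A B y := by
  simp only [gaussOp, mul_add, add_mul, smul_add]; abel

lemma gaussOp_smul (c : ℝ) (x : Matrix (Fin 4) (Fin 4) ℝ) :
    gaussOp w₁ w₂ A B (c • x) = c • gaussOp w₁ w₂ A B x := by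
  simp only [gaussOp, Matrix.mul_smul, Matrix.smul_mul, smul_add, smul_comm c]

lemma gaussOp_combo (hI : gaussOp w₁ w₂ A B sdI = α • sdI)
    (hX : ∀ k, gaussOp w₁ w₂ A B (asd k) = β k • asd k) (a : ℝ) (y : Fin 3 → ℝ) :
    gaussOp w₁ w₂ A B (a • sdI + ∑ k, y k • asd k)
      = (a * α) • sdI + ∑ k, (y k * β k) • asd k := by
  simp only [Fin.sum_univ_three, gaussOp_add, gaussOp_smul, hI, hX, smul_smul]

/-- A matrix symmetric with respect to `A` and `B` and commuting with `sdI` has scalar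
symmetric part. -/
lemma gaussOp_scalar (hI : gaussOp w₁ w₂ A B sdI = α • sdI)
    (hX : ∀ k, gaussOp w₁ w₂ A B (asd k) = β k • asd k) (hαβ : ∀ k, β k ≠ α)
    {Z : Matrix (Fin 4) (Fin 4) ℝ} (hZ : sdI * Z = Z * sdI) (hZA : A * Z = Zᵀ * A)
    (hZB : B * Z = Zᵀ * B) : ∃ κ : ℝ, Z + Zᵀ = κ • (1 : Matrix (Fin 4) (Fin 4) ℝ) := by
  have hIt : sdIᵀ = -sdI := by
    ext i j; fin_cases i <;> fin_cases j <;> simp [sdI]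
  have hZt : sdI * Zᵀ = Zᵀ * sdI := by
    have := congrArg Matrix.transpose hZ
    simp only [Matrix.transpose_mul, hIt] at this
    simpa using this.symm
  -- Self-adjointness of Z moves it past A and B, so the operator sends I(Z + Zᵀ) to Zᵀ R(I) + R(I)
  -- Z. This is a skew α-eigenvector commuting with I; since no β equals α, it is a multiple of I.
  have hR : gaussOp w₁ w₂ A B (sdI * (Z + Zᵀ)) = α • (sdI * (Z + Zᵀ)) := by
    have h1 : ∀ D : Matrix (Fin 4) (Fin 4) ℝ, D * Z = Zᵀ * D →
        D * (sdI * (Z + Zᵀ)) * D = Zᵀ * (D * sdI * D) + (D * sdI * D) * Z := by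
      intro D hD
      have e1 : D * Z * sdI * D = Zᵀ * (D * sdI * D) := by rw [hD]; noncomm_ring
      have e2 : D * sdI * (Zᵀ * D) = D * sdI * D * Z := by rw [← hD]; noncomm_ring
      rw [← e1, ← e2, mul_add, hZ]
      noncomm_ring
    have h2 : gaussOp w₁ w₂ A B (sdI * (Z + Zᵀ))
        = Zᵀ * gaussOp w₁ w₂ A B sdI + gaussOp w₁ w₂ A B sdI * Z := by
      unfold gaussOp
      rw [h1 A hZA, h1 B hZB]
      simp only [mul_add, add_mul, smul_add, Matrix.mul_smul, Matrix.smul_mul]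
      abel
    rw [h2, hI, Matrix.mul_smul, Matrix.smul_mul, ← smul_add, mul_add, hZt, hZ, add_comm]
  have hskew : (sdI * (Z + Zᵀ))ᵀ = -(sdI * (Z + Zᵀ)) := by
    rw [Matrix.transpose_mul, Matrix.transpose_add, Matrix.transpose_transpose, hIt, mul_neg,
      add_mul, mul_add, ← hZ, ← hZt, add_comm]
  have hcomm : sdI * (sdI * (Z + Zᵀ)) = (sdI * (Z + Zᵀ)) * sdI := by
    rw [mul_assoc, add_mul, mul_add, ← hZ, ← hZt]
  obtain ⟨a, y, hy⟩ := skew_commute_sdI hskew hcomm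
  rw [hy, gaussOp_combo hI hX] at hR
  have h0 : (a * α - α * a) • sdI + ∑ k, (y k * β k - α * y k) • asd k = 0 := by
    simp only [sub_smul, Finset.sum_sub_distrib]
    have := sub_eq_zero.2 hR
    simp only [smul_add, Finset.smul_sum, smul_smul] at this
    rw [← this]; abel
  have hy0 : ∀ k, y k = 0 := by
    intro k
    have h1 : y k * (β k - α) = 0 := by linarith [(asd_indep h0).2 k]
    exact (mul_eq_zero.1 h1).resolve_right (sub_ne_zero.2 (hαβ k))
  simp only [hy0, zero_smul, Finset.sum_const_zero, add_zero] at hy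
  refine ⟨a, ?_⟩
  have := congrArg (fun M => -(sdI * M)) hy
  simpa [← mul_assoc, sdI_mul_self] using this

lemma asd_mul_comm (k : Fin 3) : sdI * asd k = asd k * sdI ∧ sdJ * asd k = asd k * sdJ := by
  constructor <;> ext i j <;> fin_cases k <;> fin_cases i <;> fin_cases j <;>
    simp [sdI, sdJ, asd, Matrix.mul_apply, Fin.sum_univ_four]

lemma asd_mul_asd (y : Fin 3 → ℝ) :
    (∑ k, y k • asd k) * (∑ k, y k • asd k) = (-∑ k, y k ^ 2) • (1 : Matrix (Fin 4) (Fin 4) ℝ) := by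
  ext i j; fin_cases i <;> fin_cases j <;>
    simp [asd, Matrix.mul_apply, Fin.sum_univ_four, Fin.sum_univ_three] <;> ring

/-- There are no second fundamental forms `A`, `B` whose Gauss curvature operator has `sdJ`
and `sdK` in its kernel and `sdI` and the anti-self-dual bivectors as eigenvectors, the
eigenvalue of `sdI` being different from the others in absolute value. -/
theorem gaussOp_obstruction (hA : A.IsSymm) (hB : B.IsSymm)
    (hJ : gaussOp w₁ w₂ A B sdJ = 0) (hK : gaussOp w₁ w₂ A B sdK = 0)
    (hI : gaussOp w₁ w₂ A B sdI = α • sdI)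
    (hX : ∀ k, gaussOp w₁ w₂ A B (asd k) = β k • asd k) (hβ : ∀ k, β k ≠ 0)
    (hαβ : ∀ k, β k ≠ α) (hα4 : α ^ 4 ≠ β 0 ^ 4) : False := by
  obtain ⟨hw1, hdA⟩ := gaussOp_isUnit hB hJ hX hβ
  obtain ⟨hw2, -⟩ := gaussOp_isUnit (A := B) (B := A) (w₁ := w₂) (w₂ := w₁) hA
    (by rw [gaussOp_comm, hJ]) (fun k => by rw [gaussOp_comm, hX]) hβ
  have hunit : IsUnit A.det := isUnit_iff_ne_zero.2 hdA
  have hAi : A * A⁻¹ = 1 := Matrix.mul_nonsing_inv _ hunit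
  have hiA : A⁻¹ * A = 1 := Matrix.nonsing_inv_mul _ hunit
  -- C is the pencil of the two forms: the operator becomes x ↦ A (w₁ x + w₂ C x Cᵀ) A, and A
  -- cancels.
  obtain ⟨C, hC⟩ : ∃ C, C = A⁻¹ * B := ⟨_, rfl⟩
  have hAC : A * C = B := by rw [hC, ← mul_assoc, hAi, one_mul]
  have hCA : Cᵀ * A = B := by
    have := congrArg Matrix.transpose hAC
    rwa [Matrix.transpose_mul, hA.eq, hB.eq] at this
  have hcancel : ∀ M N : Matrix (Fin 4) (Fin 4) ℝ, A * M * A = A * N * A → M = N := by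
    intro M N h
    have := congrArg (fun X => A⁻¹ * X * A⁻¹) h
    simp only [mul_assoc, hAi, mul_one] at this
    simpa [← mul_assoc, hiA] using this
  have hgauss : ∀ x, gaussOp w₁ w₂ A B x = A * (w₁ • x + w₂ • (C * x * Cᵀ)) * A := by
    intro x
    have : B * x * B = A * (C * x * Cᵀ) * A := by
      conv_lhs => rw [← hAC]
      conv_lhs => arg 2; rw [hAC, ← hCA]
      noncomm_ring
    rw [gaussOp, this, mul_add, add_mul, Matrix.mul_smul, Matrix.smul_mul, Matrix.mul_smul,
      Matrix.smul_mul]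
  set δ := -(w₁ / w₂) with hδ
  have hδ0 : δ ≠ 0 := neg_ne_zero.2 (div_ne_zero hw1 hw2)
  have hker : ∀ x, gaussOp w₁ w₂ A B x = 0 → C * x * Cᵀ = δ • x := by
    intro x hx
    rw [hgauss] at hx
    have h1 : w₁ • x + w₂ • (C * x * Cᵀ) = 0 := hcancel _ _ (by rw [hx]; simp)
    have h2 : C * x * Cᵀ = w₂⁻¹ • (w₂ • (C * x * Cᵀ)) := by
      rw [smul_smul, inv_mul_cancel₀ hw2, one_smul]
    rw [h2, eq_neg_of_add_eq_zero_right h1, smul_neg, smul_smul, hδ, neg_smul, div_eq_inv_mul]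
  have hCJ := hker _ hJ
  have hCK := hker _ hK
  -- Both J and K express C⁻¹ through Cᵀ; equating the two expressions makes Cᵀ commute with JK =
  -- -I.
  have hinv : ∀ x, x * x = -1 → C * x * Cᵀ = δ • x → (-δ⁻¹) • (x * Cᵀ * x) = C⁻¹ := by
    intro x hx h
    refine (Matrix.inv_eq_right_inv ?_).symm
    rw [Matrix.mul_smul, show C * (x * Cᵀ * x) = (C * x * Cᵀ) * x by noncomm_ring, h,
      Matrix.smul_mul, hx, smul_smul, smul_neg, neg_mul, inv_mul_cancel₀ hδ0]
    simp
  have hJK : sdJ * Cᵀ * sdJ = sdK * Cᵀ * sdK := by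
    have h := (hinv _ sdJ_mul_self hCJ).trans (hinv _ sdK_mul_self hCK).symm
    exact smul_right_injective _ (neg_ne_zero.2 (inv_ne_zero hδ0)) h
  have hCtI : sdI * Cᵀ = Cᵀ * sdI := by
    have h := congrArg (fun M => sdJ * M * sdK) hJK
    rw [show sdJ * (sdJ * Cᵀ * sdJ) * sdK = (sdJ * sdJ) * Cᵀ * (sdJ * sdK) by noncomm_ring,
      show sdJ * (sdK * Cᵀ * sdK) * sdK = (sdJ * sdK) * Cᵀ * (sdK * sdK) by noncomm_ring,
      sdJ_mul_self, sdK_mul_self, sdJ_mul_sdK] at h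
    simpa using h.symm
  have hIt : sdIᵀ = -sdI := by
    ext i j; fin_cases i <;> fin_cases j <;> simp [sdI]
  have hCI : sdI * C = C * sdI := by
    have := congrArg Matrix.transpose hCtI
    simp only [Matrix.transpose_mul, hIt, Matrix.transpose_transpose] at this
    simpa using this.symm
  have hBC : B * C = Cᵀ * B := by rw [← hAC, ← mul_assoc, hAC, ← hCA]
  have hAC' : A * C = Cᵀ * A := hAC.trans hCA.symm
  -- C and C² both satisfy the hypotheses. Scalarity for C gives C = c + aI + n, scalarity for C²
  -- couples a and n.
  obtain ⟨κ, hκ⟩ := gaussOp_scalar hI hX hαβ hCI hAC' hBC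
  obtain ⟨κ', hκ'⟩ := gaussOp_scalar (Z := C * C) hI hX hαβ
    (by rw [← mul_assoc, hCI, mul_assoc, hCI, mul_assoc])
    (by rw [← mul_assoc, hAC', mul_assoc, hAC', Matrix.transpose_mul, mul_assoc])
    (by rw [← mul_assoc, hBC, mul_assoc, hBC, Matrix.transpose_mul, mul_assoc])
  set c := κ / 2 with hc
  have hκc : κ = 2 * c := by rw [hc]; ring
  obtain ⟨a, y, hy⟩ := skew_commute_sdI (Y := C - c • 1)
    (by
      have : Cᵀ = κ • (1 : Matrix (Fin 4) (Fin 4) ℝ) - C := by rw [← hκ]; abel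
      rw [Matrix.transpose_sub, this, Matrix.transpose_smul, Matrix.transpose_one, hκc, two_mul,
        add_smul]
      abel)
    (by rw [mul_sub, sub_mul, hCI, Matrix.mul_smul, Matrix.smul_mul, mul_one, one_mul])
  set n := ∑ k, y k • asd k with hn
  have hnI : sdI * n = n * sdI := by
    rw [hn, Finset.mul_sum, Finset.sum_mul]
    exact Finset.sum_congr rfl fun k _ => by
      rw [Matrix.mul_smul, Matrix.smul_mul, (asd_mul_comm k).1]
  have hnJ : sdJ * n = n * sdJ := by
    rw [hn, Finset.mul_sum, Finset.sum_mul]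
    exact Finset.sum_congr rfl fun k _ => by
      rw [Matrix.mul_smul, Matrix.smul_mul, (asd_mul_comm k).2]
  have hCc : C = c • 1 + a • sdI + n := by rw [add_assoc, ← hy]; abel
  have hCt : Cᵀ = c • 1 - a • sdI - n := by
    have : Cᵀ = κ • (1 : Matrix (Fin 4) (Fin 4) ℝ) - C := by rw [← hκ]; abel
    rw [this, hCc, hκc, two_mul, add_smul]; abel
  have hnn : n * n = (-∑ k, y k ^ 2) • (1 : Matrix (Fin 4) (Fin 4) ℝ) := asd_mul_asd y
  set N := ∑ k, y k ^ 2 with hN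
  -- In C² + (C²)ᵀ the only non-scalar term is 4a I n. Multiplying by -I turns its scalarity into a
  -- linear relation among I and the anti-self-dual bivectors, which are independent.
  have hay : ∀ k, a * y k = 0 := by
    have h1 : C * C + (C * C)ᵀ = (2 * (c ^ 2 - a ^ 2 - N)) • (1 : Matrix (Fin 4) (Fin 4) ℝ)
        + (4 * a) • (sdI * n) := by
      rw [Matrix.transpose_mul, hCt, hCc]
      simp only [mul_add, add_mul, mul_sub, sub_mul, Matrix.mul_smul, Matrix.smul_mul, mul_one,
        one_mul, hnn, ← hnI, sdI_mul_self, smul_smul]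
      module
    rw [h1] at hκ'
    have h2 : (4 * a) • (sdI * n)
        = (κ' - 2 * (c ^ 2 - a ^ 2 - N)) • (1 : Matrix (Fin 4) (Fin 4) ℝ) := by
      rw [sub_smul, ← hκ']; abel
    have h3 := congrArg (fun M => -(sdI * M)) h2
    simp only [Matrix.mul_smul, ← mul_assoc, sdI_mul_self, mul_one] at h3
    have h4 : (κ' - 2 * (c ^ 2 - a ^ 2 - N)) • sdI + ∑ k, (4 * a * y k) • asd k = 0 := by
      have : ∑ k, (4 * a * y k) • asd k = (4 * a) • n := by
        rw [hn, Finset.smul_sum]; simp only [smul_smul]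
      rw [this]
      have h5 : (4 * a) • n = -((κ' - 2 * (c ^ 2 - a ^ 2 - N)) • sdI) := by
        rw [← h3]; simp
      rw [h5]; abel
    intro k
    have := (asd_indep h4).2 k
    linarith
  by_cases hy0 : ∀ k, y k = 0
  · have hn0 : n = 0 := by simp [hn, hy0]
    rw [hn0, add_zero] at hCc
    rw [hn0, sub_zero] at hCt
    -- With C = c + aI, conjugation by C is multiplication by c² + a² on the commutant of I. The
    -- operator is then a multiple of x ↦ A x A there, so determinants compare α⁴ with β₀⁴.
    have hμ : ∀ x, sdI * x = x * sdI →
        gaussOp w₁ w₂ A B x = (w₁ + w₂ * (c ^ 2 + a ^ 2)) • (A * x * A) := by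
      intro x hx
      have : C * x * Cᵀ = (c ^ 2 + a ^ 2) • x := by
        rw [hCt, hCc]
        simp only [add_mul, mul_sub, Matrix.mul_smul, Matrix.smul_mul, mul_one,
          one_mul, hx, mul_assoc, sdI_mul_self, smul_smul]
        simp only [mul_neg, mul_one]
        module
      rw [hgauss, this, smul_smul, ← add_smul, Matrix.mul_smul, Matrix.smul_mul]
    have hdet : ∀ (x : Matrix (Fin 4) (Fin 4) ℝ) (t : ℝ), sdI * x = x * sdI → x.det = 1 →
        gaussOp w₁ w₂ A B x = t • x →
        t ^ 4 = (w₁ + w₂ * (c ^ 2 + a ^ 2)) ^ 4 * A.det ^ 2 := by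
      intro x t hx hd h
      rw [hμ x hx] at h
      have := congrArg Matrix.det h
      simp only [Matrix.det_smul, Matrix.det_mul, hd, Fintype.card_fin] at this
      linarith
    apply hα4
    rw [hdet sdI α rfl (by
        simp [sdI, Matrix.det_succ_row_zero, Fin.sum_univ_succ, Fin.succAbove]; norm_num) hI,
      hdet (asd 0) (β 0) (asd_mul_comm 0).1
        (by simp [asd, Matrix.det_succ_row_zero, Fin.sum_univ_succ, Fin.succAbove]) (hX 0)]
  · push Not at hy0
    obtain ⟨k, hk⟩ := hy0
    have ha : a = 0 := (mul_eq_zero.1 (hay k)).resolve_right hk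
    rw [ha, zero_smul, add_zero] at hCc
    rw [ha, zero_smul, sub_zero] at hCt
    have hCC : ∀ x, x * n = n * x → C * x * Cᵀ = (c ^ 2 + N) • x := by
      intro x hx
      rw [hCt, hCc]
      simp only [add_mul, mul_sub, Matrix.mul_smul, Matrix.smul_mul, mul_one,
          one_mul]
      rw [mul_assoc n x n, hx, ← mul_assoc, hnn]
      simp only [Matrix.smul_mul, one_mul]
      module
    -- With C = c + n, J commutes with n, so the kernel equation for J fixes δ. The same computation
    -- applies to n itself and puts n in the kernel.
    have hδN : δ = c ^ 2 + N := by
      have := (hCC sdJ hnJ).symm.trans hCJ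
      have h01 := congrFun (congrFun this 0) 1
      simp [sdJ] at h01
      exact h01.symm
    have hRn : gaussOp w₁ w₂ A B n = 0 := by
      rw [hgauss, hCC n rfl, ← hδN, hδ, smul_smul, ← add_smul]
      have : w₁ + w₂ * -(w₁ / w₂) = 0 := by field_simp; ring
      rw [this, zero_smul, mul_zero, zero_mul]
    have h0 := gaussOp_combo hI hX 0 y
    rw [zero_smul, zero_add, ← hn, hRn] at h0
    have := (asd_indep h0.symm).2 k
    exact (mul_ne_zero hk (hβ k)) this

end Obstruction

/-! ## The Gauss equation in the left-invariant frame -/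

section Gauss

/-- The linear vector fields `z`, `jz`, `ijz`, `iz` on `ℂ² = ℍ`. -/
def frame : Fin 4 → (ℂ × ℂ) →L[ℝ] (ℂ × ℂ) :=
  let j : (ℂ × ℂ) →L[ℝ] (ℂ × ℂ) :=
    (-(Complex.conjCLE.toContinuousLinearMap ∘L ContinuousLinearMap.snd ℝ ℂ ℂ)).prod
      (Complex.conjCLE.toContinuousLinearMap ∘L ContinuousLinearMap.fst ℝ ℂ ℂ)
  ![ContinuousLinearMap.id ℝ (ℂ × ℂ), j, Complex.I • j,
    Complex.I • ContinuousLinearMap.id ℝ (ℂ × ℂ)]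

/-- The structure constants `[X_a, X_b] = ∑ c_{ab}^k X_k` of the frame. -/
def frameConst : Fin 4 → Fin 4 → Fin 4 → ℝ :=
  ![fun _ _ => 0,
    ![fun _ => 0, fun _ => 0, ![0, 0, 0, -2], ![0, 0, 2, 0]],
    ![fun _ => 0, ![0, 0, 0, 2], fun _ => 0, ![0, -2, 0, 0]],
    ![fun _ => 0, ![0, 0, -2, 0], ![0, 2, 0, 0], fun _ => 0]]

/-- For linear vector fields Mz and Nz the Lie bracket is (NM - MN)z, hence the order of the terms.
The structure constants are those of ℍ acting on itself. -/
lemma frame_comm (a b : Fin 4) (z : ℂ × ℂ) :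
    frame b (frame a z) - frame a (frame b z) = ∑ k, frameConst a b k • frame k z := by
  fin_cases a <;> fin_cases b <;>
    simp [frame, frameConst, Fin.sum_univ_four, Prod.ext_iff, Complex.ext_iff] <;>
    (try constructorm* _ ∧ _) <;> ring

variable {W : Type*} [NormedAddCommGroup W] [NormedSpace ℝ W]

/-- The derivative along the frame field `X_a`. -/
def frameDeriv (a : Fin 4) (h : ℂ × ℂ → W) (z : ℂ × ℂ) : W := fderiv ℝ h z (frame a z)

variable {U : Set (ℂ × ℂ)}

lemma contDiffOn_frameDeriv (hU : IsOpen U) {h : ℂ × ℂ → W} (hh : ContDiffOn ℝ ∞ h U)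
    (a : Fin 4) : ContDiffOn ℝ ∞ (frameDeriv a h) U :=
  (hh.fderiv_of_isOpen hU (m := ∞) le_rfl).clm_apply (frame a).contDiff.contDiffOn

lemma frameDeriv_frameDeriv (hU : IsOpen U) {h : ℂ × ℂ → W} (hh : ContDiffOn ℝ ∞ h U)
    {z : ℂ × ℂ} (hz : z ∈ U) (a b : Fin 4) :
    frameDeriv a (frameDeriv b h) z =
      fderiv ℝ (fderiv ℝ h) z (frame a z) (frame b z) + fderiv ℝ h z (frame b (frame a z)) := by
  have h1 : DifferentiableAt ℝ (fderiv ℝ h) z :=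
    ((hh.fderiv_of_isOpen hU (m := ∞) le_rfl).contDiffAt (hU.mem_nhds hz)).differentiableAt
      (by simp)
  have h2 := h1.hasFDerivAt.clm_apply (frame b).hasFDerivAt
  have h3 : fderiv ℝ (frameDeriv b h) z = _ := h2.fderiv
  rw [frameDeriv, h3]
  simp [add_comm]

lemma frameDeriv_comm (hU : IsOpen U) {h : ℂ × ℂ → W} (hh : ContDiffOn ℝ ∞ h U)
    {z : ℂ × ℂ} (hz : z ∈ U) (a b : Fin 4) :
    frameDeriv a (frameDeriv b h) z - frameDeriv b (frameDeriv a h) z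
      = ∑ k, frameConst a b k • frameDeriv k h z := by
  rw [frameDeriv_frameDeriv hU hh hz, frameDeriv_frameDeriv hU hh hz]
  have hs : IsSymmSndFDerivAt ℝ h z :=
    (hh.contDiffAt (hU.mem_nhds hz)).isSymmSndFDerivAt (by
      simpa using WithTop.coe_le_coe.2 (le_top : (2 : ℕ∞) ≤ ⊤))
  rw [hs.eq (frame a z) (frame b z), add_sub_add_left_eq_sub, ← map_sub, frame_comm, map_sum]
  simp [frameDeriv]

lemma herm_frame_re (a : Fin 4) (z : ℂ × ℂ) :
    (herm z (frame a z)).re = if a = 0 then normSq z else 0 := by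
  fin_cases a <;> simp [frame, herm, normSq, Complex.normSq_apply] <;> ring

/-- The fields jz, ijz, iz are tangent to the spheres, so only z differentiates a function of s =
|z|², and it does so as 2 s d/ds. -/
lemma frameDeriv_radial {g : ℝ → ℝ} {g' : ℝ} {z : ℂ × ℂ} (hg : HasDerivAt g g' (normSq z))
    (a : Fin 4) :
    frameDeriv a (fun z => g (normSq z)) z = if a = 0 then 2 * normSq z * g' else 0 := by
  obtain ⟨L, hL, h⟩ := hasFDerivAt_normSq z
  have h1 : HasFDerivAt (fun z => g (normSq z)) _ z := hg.comp_hasFDerivAt z hL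
  rw [frameDeriv, h1.fderiv]
  simp only [FunLike.coe_smul, Pi.smul_apply, h, herm_frame_re, smul_eq_mul]
  split_ifs <;> ring

/-- The diagonal matrix of the metric coefficients. -/
def diagCoeff (g : Fin 4 → ℝ) (a b : Fin 4) : ℝ := if a = b then g a else 0

/-- The connection coefficients of the metric `diag g`, with radial derivatives `g₁`. -/
def connCoeff (g g₁ : Fin 4 → ℝ) (a b c : Fin 4) : ℝ :=
  ((if a = 0 then diagCoeff g₁ b c else 0) + (if b = 0 then diagCoeff g₁ a c else 0)
    - (if c = 0 then diagCoeff g₁ a b else 0)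
    + frameConst a b c * g c - frameConst a c b * g b - frameConst b c a * g a) / 2

/-- The curvature of the metric `diag g`, with first and second radial derivatives `g₁`, `g₂`. -/
def curvCoeff (g g₁ g₂ : Fin 4 → ℝ) (d a b c : Fin 4) : ℝ :=
  (if d = 0 then connCoeff g₁ g₂ a b c else 0) - (if a = 0 then connCoeff g₁ g₂ d b c else 0)
    - ∑ k, frameConst d a k * connCoeff g g₁ k b c
    - ∑ e, (connCoeff g g₁ a b e * connCoeff g g₁ d c e
      - connCoeff g g₁ d b e * connCoeff g g₁ a c e) / g e

lemma hasDerivAt_diagCoeff {g : Fin 4 → ℝ → ℝ} {g' : Fin 4 → ℝ} {s : ℝ}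
    (h : ∀ a, HasDerivAt (g a) (g' a) s) (a b : Fin 4) :
    HasDerivAt (fun s => diagCoeff (fun i => g i s) a b) (diagCoeff g' a b) s := by
  unfold diagCoeff
  split_ifs
  · exact h a
  · exact hasDerivAt_const _ _

/-- `connCoeff` is linear in the pair (g, g₁). Together with `connCoeff_smul` this shows that its
radial derivative is `connCoeff` of the differentiated pair (g₁, g₂). -/
lemma hasDerivAt_connCoeff {g g₁ : Fin 4 → ℝ → ℝ} {g' g₁' : Fin 4 → ℝ} {s : ℝ}
    (h : ∀ a, HasDerivAt (g a) (g' a) s) (h₁ : ∀ a, HasDerivAt (g₁ a) (g₁' a) s)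
    (a b c : Fin 4) :
    HasDerivAt (fun s => connCoeff (fun i => g i s) (fun i => g₁ i s) a b c)
      (connCoeff g' g₁' a b c) s := by
  have hif : ∀ (p : Fin 4) (x y : Fin 4),
      HasDerivAt (fun s => if p = 0 then diagCoeff (fun i => g₁ i s) x y else 0)
        (if p = 0 then diagCoeff g₁' x y else 0) s := by
    intro p x y
    split_ifs
    · exact hasDerivAt_diagCoeff h₁ x y
    · exact hasDerivAt_const _ _
  exact ((((((hif a b c).add (hif b a c)).sub (hif c a b)).add
    ((h c).const_mul _)).sub ((h b).const_mul _)).sub ((h a).const_mul _)).div_const 2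

lemma connCoeff_smul (t : ℝ) (g g₁ : Fin 4 → ℝ) (a b c : Fin 4) :
    connCoeff (fun i => t * g i) (fun i => t * g₁ i) a b c = t * connCoeff g g₁ a b c := by
  simp only [connCoeff, diagCoeff]
  split_ifs <;> ring

variable {V : Type*} [NormedAddCommGroup V] [NormedSpace ℝ V] {B : V →L[ℝ] V →L[ℝ] ℝ}

lemma frameDeriv_bilin {F G : ℂ × ℂ → V} {z : ℂ × ℂ} (hF : DifferentiableAt ℝ F z)
    (hG : DifferentiableAt ℝ G z) (a : Fin 4) :
    frameDeriv a (fun z => B (F z) (G z)) z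
      = B (frameDeriv a F z) (G z) + B (F z) (frameDeriv a G z) := by
  have := B.hasFDerivAt_of_bilinear hF.hasFDerivAt hG.hasFDerivAt
  rw [frameDeriv, this.fderiv]
  simp [frameDeriv, add_comm]

lemma frameDeriv_congr (hU : IsOpen U) {h k : ℂ × ℂ → W} (hk : ∀ z ∈ U, h z = k z)
    {z : ℂ × ℂ} (hz : z ∈ U) (a : Fin 4) : frameDeriv a h z = frameDeriv a k z := by
  have : h =ᶠ[𝓝 z] k := Filter.eventually_of_mem (hU.mem_nhds hz) hk
  rw [frameDeriv, frameDeriv, this.fderiv_eq]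

/-- The radial derivative `2 s d/ds` of the functions `g` is `g₁`. -/
def HasRadialDeriv (g g₁ : Fin 4 → ℝ → ℝ) (s : ℝ) : Prop :=
  ∃ g' : Fin 4 → ℝ, (∀ a, HasDerivAt (g a) (g' a) s) ∧ ∀ a, g₁ a s = 2 * s * g' a

variable {f : ℂ × ℂ → V} {g g₁ g₂ : Fin 4 → ℝ → ℝ}

/-- Koszul's formula: metric compatibility is the product rule for B, torsion-freeness is the
commutator of second derivatives, and the six resulting relations are solved linearly. -/
lemma inner_frameDeriv_frameDeriv (hBs : ∀ x y, B x y = B y x) (hU : IsOpen U)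
    (hf : ContDiffOn ℝ ∞ f U)
    (hg : ∀ z ∈ U, HasRadialDeriv g g₁ (normSq z))
    (hB : ∀ z ∈ U, ∀ a b, B (frameDeriv a f z) (frameDeriv b f z)
      = diagCoeff (fun i => g i (normSq z)) a b)
    {z : ℂ × ℂ} (hz : z ∈ U) (a b c : Fin 4) :
    B (frameDeriv a (frameDeriv b f) z) (frameDeriv c f z)
      = connCoeff (fun i => g i (normSq z)) (fun i => g₁ i (normSq z)) a b c := by
  have hd : ∀ b, DifferentiableAt ℝ (frameDeriv b f) z := fun b =>
    ((contDiffOn_frameDeriv hU hf b).contDiffAt (hU.mem_nhds hz)).differentiableAt (by simp)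
  obtain ⟨g', hg', hg1⟩ := hg z hz
  have hP : ∀ a b c, B (frameDeriv a (frameDeriv b f) z) (frameDeriv c f z)
      + B (frameDeriv a (frameDeriv c f) z) (frameDeriv b f z)
      = if a = 0 then diagCoeff (fun i => g₁ i (normSq z)) b c else 0 := by
    intro a b c
    have h1 := frameDeriv_bilin (B := B) (hd b) (hd c) a
    rw [hBs (frameDeriv b f z)] at h1
    rw [← h1, frameDeriv_congr hU (fun z hz => hB z hz b c) hz,
      frameDeriv_radial (hasDerivAt_diagCoeff hg' b c)]
    simp only [diagCoeff, hg1, mul_ite, mul_zero]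
  have hT : ∀ a b c, B (frameDeriv a (frameDeriv b f) z) (frameDeriv c f z)
      - B (frameDeriv b (frameDeriv a f) z) (frameDeriv c f z)
      = frameConst a b c * g c (normSq z) := by
    intro a b c
    have h1 := congrArg (fun v => B v (frameDeriv c f z)) (frameDeriv_comm hU hf hz a b)
    simp only [map_sub, map_sum, map_smul, FunLike.coe_sub, Pi.sub_apply, FunLike.coe_sum,
      Finset.sum_apply, FunLike.coe_smul, Pi.smul_apply, hB z hz, smul_eq_mul] at h1
    rw [h1]
    simp [diagCoeff]
  have p1 := hP a b c
  have p2 := hP b a c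
  have p3 := hP c a b
  have t1 := hT a b c
  have t2 := hT a c b
  have t3 := hT b c a
  simp only [connCoeff]
  linarith

/-- The Gauss equation before the removal of the tangential components. -/
lemma gauss_frame (hBs : ∀ x y, B x y = B y x) (hU : IsOpen U) (hf : ContDiffOn ℝ ∞ f U)
    (hg : ∀ z ∈ U, HasRadialDeriv g g₁ (normSq z))
    (hg₁ : ∀ z ∈ U, HasRadialDeriv g₁ g₂ (normSq z))
    (hB : ∀ z ∈ U, ∀ a b, B (frameDeriv a f z) (frameDeriv b f z)
      = diagCoeff (fun i => g i (normSq z)) a b)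
    {z : ℂ × ℂ} (hz : z ∈ U) (d a b c : Fin 4) :
    B (frameDeriv a (frameDeriv b f) z) (frameDeriv d (frameDeriv c f) z)
      - B (frameDeriv d (frameDeriv b f) z) (frameDeriv a (frameDeriv c f) z)
      = (if d = 0 then connCoeff (fun i => g₁ i (normSq z)) (fun i => g₂ i (normSq z)) a b c
          else 0)
        - (if a = 0 then connCoeff (fun i => g₁ i (normSq z)) (fun i => g₂ i (normSq z)) d b c
          else 0)
        - ∑ k, frameConst d a k
          * connCoeff (fun i => g i (normSq z)) (fun i => g₁ i (normSq z)) k b c := by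
  have hs1 : ∀ b, ContDiffOn ℝ ∞ (frameDeriv b f) U := contDiffOn_frameDeriv hU hf
  have hd1 : ∀ b, DifferentiableAt ℝ (frameDeriv b f) z := fun b =>
    ((hs1 b).contDiffAt (hU.mem_nhds hz)).differentiableAt (by simp)
  have hd2 : ∀ a b, DifferentiableAt ℝ (frameDeriv a (frameDeriv b f)) z := fun a b =>
    ((contDiffOn_frameDeriv hU (hs1 b) a).contDiffAt (hU.mem_nhds hz)).differentiableAt (by simp)
  obtain ⟨g', hg', hg1⟩ := hg z hz
  obtain ⟨g₁', hg1', hg2⟩ := hg₁ z hz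
  have hT := fun (z) (hz : z ∈ U) (a b c) =>
    inner_frameDeriv_frameDeriv hBs hU hf hg hB hz a b c
  have hP : ∀ d a b c, B (frameDeriv d (frameDeriv a (frameDeriv b f)) z) (frameDeriv c f z)
      + B (frameDeriv a (frameDeriv b f) z) (frameDeriv d (frameDeriv c f) z)
      = if d = 0 then connCoeff (fun i => g₁ i (normSq z)) (fun i => g₂ i (normSq z)) a b c
        else 0 := by
    intro d a b c
    have h1 := frameDeriv_bilin (B := B) (hd2 a b) (hd1 c) d
    rw [← h1, frameDeriv_congr hU (fun z hz => hT z hz a b c) hz,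
      frameDeriv_radial (hasDerivAt_connCoeff hg' hg1' a b c), ← connCoeff_smul]
    simp only [hg1, hg2]
  -- Differentiating the connection coefficients produces third derivatives of f. Antisymmetrising
  -- in d, a leaves only their commutator, which is a combination of second derivatives.
  have h1 := congrArg (fun v => B v (frameDeriv c f z)) (frameDeriv_comm hU (hs1 b) hz d a)
  simp only [map_sub, map_sum, map_smul, FunLike.coe_sub, Pi.sub_apply, FunLike.coe_sum,
    Finset.sum_apply, FunLike.coe_smul, Pi.smul_apply, hT z hz, smul_eq_mul] at h1
  have p1 := hP d a b c
  have p2 := hP a d b c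
  rw [← h1, ← p1, ← p2]
  ring

/-- In a space of dimension at most six, a symmetric form splits, with respect to four
orthogonal positive vectors, into its tangential part and a part given by two weights. -/
lemma exists_normal_form [FiniteDimensional ℝ V] (hV : Module.finrank ℝ V ≤ 6)
    (hBs : ∀ x y, B x y = B y x) {γ : Fin 4 → ℝ} (hγ : ∀ a, 0 < γ a) {F : Fin 4 → V}
    (hF : ∀ a b, B (F a) (F b) = diagCoeff γ a b) :
    ∃ (w : Fin 2 → ℝ) (φ : Fin 2 → V →ₗ[ℝ] ℝ), (∀ i a, φ i (F a) = 0) ∧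
      ∀ x y, ∑ i, w i * (φ i x * φ i y) = B x y - ∑ e, B x (F e) * B y (F e) / γ e := by
  let L : V →ₗ[ℝ] (Fin 4 → ℝ) := LinearMap.pi fun e => (B (F e)).toLinearMap
  have hL : ∀ x e, L x e = B (F e) x := fun x e => rfl
  have hsurj : Function.Surjective L := by
    intro t
    refine ⟨∑ a, (t a / γ a) • F a, ?_⟩
    ext e
    simp only [hL, map_sum, map_smul, hF, diagCoeff, smul_eq_mul, mul_ite, mul_zero,
      Finset.sum_ite_eq, Finset.mem_univ, if_true]
    exact div_mul_cancel₀ _ (hγ e).ne'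
  have hrank : Module.finrank ℝ (LinearMap.ker L) ≤ 2 := by
    have := L.finrank_range_add_finrank_ker
    rw [LinearMap.range_eq_top.2 hsurj, finrank_top, Module.finrank_fin_fun] at this
    omega
  -- The orthogonal projection to the normal space, which is the kernel of L and has dimension at
  -- most two. B may be degenerate or indefinite there; a diagonal basis is all that is used.
  let P0 : V →ₗ[ℝ] V := LinearMap.id - ∑ e, (γ e)⁻¹ • (B (F e)).toLinearMap.smulRight (F e)
  have hP0 : ∀ x, P0 x = x - ∑ e, (B (F e) x / γ e) • F e := by
    intro x
    simp [P0, smul_smul, div_eq_inv_mul]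
  have hP0mem : ∀ x, P0 x ∈ LinearMap.ker L := by
    intro x
    rw [LinearMap.mem_ker]
    ext e
    rw [hL, hP0]
    simp only [map_sub, map_sum, map_smul, hF, diagCoeff, smul_eq_mul, mul_ite, mul_zero,
      Finset.sum_ite_eq, Finset.mem_univ, if_true, Pi.zero_apply]
    rw [div_mul_cancel₀ _ (hγ e).ne', sub_self]
  let P : V →ₗ[ℝ] LinearMap.ker L := P0.codRestrict _ hP0mem
  let β : LinearMap.BilinForm ℝ (LinearMap.ker L) :=
    LinearMap.mk₂ ℝ (fun x y => B (x : V) (y : V)) (by simp) (by simp) (by simp) (by simp)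
  have hβ : ∀ x y, β x y = B (x : V) (y : V) := fun x y => rfl
  have hβs : LinearMap.IsSymm β := ⟨fun x y => by simp [hβ, hBs (x : V)]⟩
  obtain ⟨n, v, hn, hv⟩ : ∃ (n : ℕ) (v : Module.Basis (Fin n) ℝ (LinearMap.ker L)),
      n ≤ 2 ∧ LinearMap.IsOrthoᵢ β v :=
    let ⟨v, hv⟩ := LinearMap.BilinForm.exists_orthogonal_basis hβs
    ⟨_, v, hrank, hv⟩
  have hexp : ∀ x y, β x y = ∑ i, β (v i) (v i) * (v.coord i x * v.coord i y) := by
    intro x y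
    conv_lhs => rw [← v.sum_repr x, ← v.sum_repr y]
    simp only [map_sum, map_smul, LinearMap.sum_apply, LinearMap.smul_apply, smul_eq_mul]
    refine Finset.sum_congr rfl fun i _ => ?_
    rw [Finset.sum_eq_single i]
    · simp; ring
    · intro j _ hj
      rw [show (β (v j)) (v i) = 0 from hv hj]; ring
    · simp
  have hfin : ∀ x y, B x y - ∑ e, B x (F e) * B y (F e) / γ e = β (P x) (P y) := by
    intro x y
    have h1 : ((P x : LinearMap.ker L) : V) = P0 x := rfl
    have h2 : ∀ e, B (P0 x) (F e) = 0 := by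
      intro e
      rw [hBs]
      exact congrFun (LinearMap.mem_ker.1 (hP0mem x)) e
    rw [hβ, h1, show ((P y : LinearMap.ker L) : V) = P0 y from rfl, hP0 y, map_sub, map_sum]
    simp only [map_smul, h2, smul_zero, Finset.sum_const_zero, sub_zero]
    rw [hP0]
    simp only [map_sub, map_sum, map_smul, FunLike.coe_sub, Pi.sub_apply, FunLike.coe_sum,
      Finset.sum_apply, FunLike.coe_smul, Pi.smul_apply, smul_eq_mul]
    congr 1
    refine Finset.sum_congr rfl fun e _ => ?_
    rw [hBs x, hBs y, hBs (F e) y]; ring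
  have hPF : ∀ a, P (F a) = 0 := by
    intro a
    apply Subtype.ext
    change P0 (F a) = 0
    rw [hP0]
    simp only [hF, diagCoeff]
    rw [Finset.sum_eq_single a]
    · simp [(hγ a).ne']
    · intro e _ he
      simp [he]
    · simp
  -- Missing normal directions are filled with weight zero, so that codimensions below two need no
  -- separate case.
  refine ⟨fun i => if h : (i : ℕ) < n then β (v ⟨i, h⟩) (v ⟨i, h⟩) else 0,
    fun i => if h : (i : ℕ) < n then v.coord ⟨i, h⟩ ∘ₗ P else 0, ?_, ?_⟩
  · intro i a
    dsimp only
    split_ifs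
    · simp [hPF]
    · simp
  · intro x y
    rw [hfin, hexp]
    have h2 : n = 0 ∨ n = 1 ∨ n = 2 := by omega
    rcases h2 with rfl | rfl | rfl <;> simp [Fin.sum_univ_two]

/-- A second fundamental form in two normal directions that satisfies the Gauss equation. -/
theorem exists_second_fundamental_form [FiniteDimensional ℝ V] (hV : Module.finrank ℝ V ≤ 6)
    (hBs : ∀ x y, B x y = B y x) (hU : IsOpen U) (hf : ContDiffOn ℝ ∞ f U)
    (hg : ∀ z ∈ U, HasRadialDeriv g g₁ (normSq z))
    (hg₁ : ∀ z ∈ U, HasRadialDeriv g₁ g₂ (normSq z))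
    (hB : ∀ z ∈ U, ∀ a b, B (frameDeriv a f z) (frameDeriv b f z)
      = diagCoeff (fun i => g i (normSq z)) a b)
    {z : ℂ × ℂ} (hz : z ∈ U) (hpos : ∀ a, 0 < g a (normSq z)) :
    ∃ (w : Fin 2 → ℝ) (A : Fin 2 → Fin 4 → Fin 4 → ℝ), (∀ i a b, A i a b = A i b a) ∧
      ∀ d a b c, ∑ i, w i * (A i a b * A i d c - A i d b * A i a c)
        = curvCoeff (fun i => g i (normSq z)) (fun i => g₁ i (normSq z))
          (fun i => g₂ i (normSq z)) d a b c := by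
  obtain ⟨w, φ, hφ, h⟩ := exists_normal_form hV hBs hpos (hB z hz)
  refine ⟨w, fun i a b => φ i (frameDeriv a (frameDeriv b f) z), ?_, ?_⟩
  -- The commutator of two frame derivatives of f is tangential, and the normal functionals vanish
  -- on tangent vectors.
  · intro i a b
    rw [← sub_eq_zero, ← map_sub, frameDeriv_comm hU hf hz a b]
    simp [hφ]
  · intro d a b c
    have h1 := h (frameDeriv a (frameDeriv b f) z) (frameDeriv d (frameDeriv c f) z)
    have h2 := h (frameDeriv d (frameDeriv b f) z) (frameDeriv a (frameDeriv c f) z)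
    have h3 := gauss_frame hBs hU hf hg hg₁ hB hz d a b c
    simp only [mul_sub, Finset.sum_sub_distrib, h1, h2,
      inner_frameDeriv_frameDeriv hBs hU hf hg hB hz]
    simp only [curvCoeff, sub_div, Finset.sum_sub_distrib]
    rw [← h3]
    ring

end Gauss

/-! ## No isometric immersion in codimension two -/

section Codim

open Matrix

/-- The six coordinate planes. -/
def plane : Fin 6 → Fin 4 × Fin 4 := ![(0, 1), (0, 2), (0, 3), (2, 3), (3, 1), (1, 2)]

lemma skew_ext {x y : Matrix (Fin 4) (Fin 4) ℝ} (hx : ∀ a b, x b a = -x a b)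
    (hy : ∀ a b, y b a = -y a b) (h : ∀ P, x (plane P).1 (plane P).2 = y (plane P).1 (plane P).2) :
    x = y := by
  have h0 := h 0; have h1 := h 1; have h2 := h 2
  have h3 := h 3; have h4 := h 4; have h5 := h 5
  simp [plane] at h0 h1 h2 h3 h4 h5
  have hd : ∀ a, x a a = y a a := fun a => by linarith [hx a a, hy a a]
  ext a b
  fin_cases a <;> fin_cases b <;> simp only [hd, h0, h1, h2, h3, h4, h5, Fin.mk_zero,
    Fin.mk_one, Fin.reduceFinMk, Fin.isValue]
  · rw [hx 0 1, hy 0 1, h0]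
  · rw [hx 3 1, hy 3 1, h4]
  · rw [hx 0 2, hy 0 2, h1]
  · rw [hx 1 2, hy 1 2, h5]
  · rw [hx 0 3, hy 0 3, h2]
  · rw [hx 2 3, hy 2 3, h3]

variable {w : Fin 2 → ℝ} {A : Fin 2 → Matrix (Fin 4) (Fin 4) ℝ}

lemma gaussOp_skew (hA : ∀ i a b, A i a b = A i b a) {x : Matrix (Fin 4) (Fin 4) ℝ}
    (hx : ∀ a b, x b a = -x a b) (a b : Fin 4) :
    gaussOp (w 0) (w 1) (A 0) (A 1) x b a = -gaussOp (w 0) (w 1) (A 0) (A 1) x a b := by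
  have hAt : ∀ i, (A i)ᵀ = A i := fun i => by ext a b; exact hA i b a
  have hxt : xᵀ = -x := by ext a b; exact hx a b
  have h : (gaussOp (w 0) (w 1) (A 0) (A 1) x)ᵀ = -gaussOp (w 0) (w 1) (A 0) (A 1) x := by
    simp only [gaussOp, Matrix.transpose_add, Matrix.transpose_smul, Matrix.transpose_mul, hAt,
      hxt]
    simp only [mul_neg, neg_mul, smul_neg, neg_add, mul_assoc]
  exact congrFun (congrFun h a) b

/-- The link between the two languages: for skew x the entries of A x A are contractions of x with 2
× 2 minors of A, which are the terms of the Gauss equation. -/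
lemma gaussOp_apply (hA : ∀ i a b, A i a b = A i b a) {x : Matrix (Fin 4) (Fin 4) ℝ}
    (hx : ∀ a b, x b a = -x a b) (d a : Fin 4) :
    gaussOp (w 0) (w 1) (A 0) (A 1) x d a = -∑ Q, x (plane Q).1 (plane Q).2 *
      ∑ i, w i * (A i a (plane Q).1 * A i d (plane Q).2 - A i d (plane Q).1 * A i a (plane Q).2)
      := by
  have hd : ∀ a, x a a = 0 := fun a => by linarith [hx a a]
  simp only [gaussOp, Matrix.add_apply, Matrix.smul_apply, Matrix.mul_apply, Fin.sum_univ_four,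
    Fin.sum_univ_six, Fin.sum_univ_two, smul_eq_mul, hd, hx 0 1, hx 0 2, hx 0 3, hx 2 3, hx 3 1,
    hx 1 2, hA _ _ a]
  simp [plane]
  ring

/-- The curvature matrix, in the basis `plane` of bivectors, of a locally rotationally
symmetric metric that is a (possibly trivial) multiple of its Weyl tensor of type D on one
half of the bivectors and a multiple of the identity, or zero, on the other. -/
def typeD (p q μ σ : ℝ) : Matrix (Fin 6) (Fin 6) ℝ :=
  !![p, 0, 0, -σ * p, 0, 0;
     0, p, 0, 0, -σ * p, 0;
     0, 0, q, 0, 0, μ;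
     -σ * p, 0, 0, p, 0, 0;
     0, -σ * p, 0, 0, p, 0;
     0, 0, μ, 0, 0, q]

/-- The area factors that turn an orthonormal curvature matrix into one in the frame
with squared lengths `γ₀, γ₁, γ₁, γ₃` and `v² = γ₀ γ₃`. -/
def planeScale (γ : Fin 4 → ℝ) (v : ℝ) (P Q : Fin 6) : ℝ :=
  if P = Q then γ (plane P).1 * γ (plane P).2 else v * γ 1

lemma typeD_self (p q μ μ' σ σ' : ℝ) (P : Fin 6) : typeD p q μ σ P P = typeD p q μ' σ' P P := by
  fin_cases P <;> simp [typeD]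

/-- Off the diagonal only complementary planes interact, so each non-zero entry acquires the product
of all four lengths, and with it the orientation sign σ. -/
lemma typeD_rescale {l : Fin 4 → ℝ} {p q μ σ t : ℝ} (e : l 0 * l 1 * l 2 * l 3 * t = σ)
    (hσ : σ ^ 2 = 1) {P Q : Fin 6} (hPQ : P ≠ Q) :
    l (plane P).1 * l (plane P).2 * l (plane Q).1 * l (plane Q).2 * (typeD p q μ σ P Q * t)
      = typeD p q (σ * μ) 1 P Q := by
  have e1 : l 0 * l 1 * l 2 * l 3 * (-σ * p * t) = -1 * p := by
    linear_combination (-σ * p) * e - p * hσ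
  have e2 : l 0 * l 1 * l 2 * l 3 * (μ * t) = σ * μ := by linear_combination μ * e
  have h : ∀ x y c d k r : ℝ, c * d * x * y * k = r → x * y * c * d * k = r := by
    intro x y c d k r h; rw [← h]; ring
  have e1' : l 0 * l 2 * l 3 * l 1 * (-σ * p * t) = -1 * p := by rw [← e1]; ring
  have e2' : l 0 * l 3 * l 1 * l 2 * (μ * t) = σ * μ := by rw [← e2]; ring
  fin_cases P <;> fin_cases Q <;> first
    | exact absurd rfl hPQ
    | (simp only [typeD, plane, Fin.mk_zero, Fin.mk_one, Fin.reduceFinMk, Matrix.of_apply,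
        Matrix.cons_val, zero_mul, mul_zero]
       first
        | done
        | exact e1
        | exact e1'
        | exact e2
        | exact e2'
        | exact h _ _ _ _ _ _ e1
        | exact h _ _ _ _ _ _ e1'
        | exact h _ _ _ _ _ _ e2')

lemma sd_skew : (∀ a b, sdJ b a = -sdJ a b) ∧ (∀ a b, sdK b a = -sdK a b) ∧
    (∀ a b, sdI b a = -sdI a b) ∧ ∀ k a b, asd k b a = -asd k a b := by
  refine ⟨?_, ?_, ?_, ?_⟩
  · intro a b; fin_cases a <;> fin_cases b <;> simp [sdJ]
  · intro a b; fin_cases a <;> fin_cases b <;> simp [sdK]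
  · intro a b; fin_cases a <;> fin_cases b <;> simp [sdI]
  · intro k a b; fin_cases k <;> fin_cases a <;> fin_cases b <;> simp [asd]

lemma gaussOp_eq_smul (hA : ∀ i a b, A i a b = A i b a) {T : Matrix (Fin 6) (Fin 6) ℝ}
    (h : ∀ P Q, ∑ i, w i * (A i (plane P).2 (plane Q).1 * A i (plane P).1 (plane Q).2
        - A i (plane P).1 (plane Q).1 * A i (plane P).2 (plane Q).2) = T P Q)
    {x : Matrix (Fin 4) (Fin 4) ℝ} {t : ℝ} (hx : ∀ a b, x b a = -x a b)
    (ht : ∀ P, -∑ Q, x (plane Q).1 (plane Q).2 * T P Q = t * x (plane P).1 (plane P).2) :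
    gaussOp (w 0) (w 1) (A 0) (A 1) x = t • x := by
  refine skew_ext (fun a b => gaussOp_skew hA hx a b)
    (fun a b => by rw [Matrix.smul_apply, Matrix.smul_apply, hx, smul_neg]) fun P => ?_
  rw [gaussOp_apply hA hx]
  simp only [h, ht, Matrix.smul_apply, smul_eq_mul]

/-- Sums and differences of complementary planes diagonalise `typeD p q μ 1`: the self-dual
eigenvalues are 0, 0, q + μ, the anti-self-dual ones 2p, 2p, q - μ. The operator carries the
opposite sign. -/
lemma typeD_obstruction_orthonormal (hA : ∀ i a b, A i a b = A i b a) {p q μ : ℝ}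
    (hp : p ≠ 0) (hq : q - μ ≠ 0) (hμ : μ ≠ 0) (hpq : 2 * p ≠ q + μ)
    (hpq4 : (q + μ) ^ 4 ≠ (2 * p) ^ 4)
    (h : ∀ P Q, ∑ i, w i * (A i (plane P).2 (plane Q).1 * A i (plane P).1 (plane Q).2
        - A i (plane P).1 (plane Q).1 * A i (plane P).2 (plane Q).2) = typeD p q μ 1 P Q) :
    False := by
  refine gaussOp_obstruction (A := A 0) (B := A 1) (w₁ := w 0) (w₂ := w 1)
    (α := -(q + μ)) (β := ![-(2 * p), -(2 * p), -(q - μ)])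
    (by ext a b; exact hA 0 b a) (by ext a b; exact hA 1 b a) ?_ ?_ ?_ ?_ ?_ ?_ ?_
  · rw [gaussOp_eq_smul (t := 0) hA h sd_skew.1, zero_smul]
    intro P; fin_cases P <;> simp [Fin.sum_univ_six, typeD, plane, sdJ]
  · rw [gaussOp_eq_smul (t := 0) hA h sd_skew.2.1, zero_smul]
    intro P; fin_cases P <;> simp [Fin.sum_univ_six, typeD, plane, sdK]
  · apply gaussOp_eq_smul hA h sd_skew.2.2.1
    intro P; fin_cases P <;> simp [Fin.sum_univ_six, typeD, plane, sdI] <;> ring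
  · intro k
    apply gaussOp_eq_smul hA h (sd_skew.2.2.2 k)
    intro P; fin_cases k <;> fin_cases P <;> simp [Fin.sum_univ_six, typeD, plane, asd] <;> ring
  · intro k; fin_cases k <;> simp [hp]
    intro h; exact hq (by linarith)
  · intro k; fin_cases k <;> simp
    · intro h; exact hpq (by linarith)
    · intro h; exact hpq (by linarith)
    · intro h; exact hμ (by linarith)
  · intro h
    apply hpq4
    simp only [Matrix.cons_val_zero] at h
    linear_combination h

theorem typeD_obstruction (hA : ∀ i a b, A i a b = A i b a) {p q μ σ v : ℝ} {γ : Fin 4 → ℝ}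
    (hγ : ∀ a, 0 < γ a) (h12 : γ 2 = γ 1) (hv : 0 < v) (hv2 : v ^ 2 = γ 0 * γ 3)
    (hσ : σ ^ 2 = 1) (hp : p ≠ 0) (hq : q - σ * μ ≠ 0) (hμ : σ * μ ≠ 0)
    (hpq : 2 * p ≠ q + σ * μ) (hpq4 : (q + σ * μ) ^ 4 ≠ (2 * p) ^ 4)
    (h : ∀ P Q, ∑ i, w i * (A i (plane P).2 (plane Q).1 * A i (plane P).1 (plane Q).2
        - A i (plane P).1 (plane Q).1 * A i (plane P).2 (plane Q).2)
      = typeD p q μ σ P Q * planeScale γ v P Q) : False := by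
  have hs : ∀ a, √(γ a) ^ 2 = γ a := fun a => Real.sq_sqrt (hγ a).le
  have hs0 : ∀ a, √(γ a) ≠ 0 := fun a => (Real.sqrt_pos.2 (hγ a)).ne'
  have hv' : v = √(γ 0) * √(γ 3) := by
    rw [← Real.sqrt_mul (hγ 0).le, ← hv2, Real.sqrt_sq hv.le]
  -- Normalise the frame, reversing its first vector when σ = -1; this exchanges the two halves of
  -- the bivectors and replaces μ by σμ.
  obtain ⟨l, hl0, hl⟩ : ∃ l : Fin 4 → ℝ, l 0 = σ / √(γ 0) ∧ ∀ a, a ≠ 0 → l a = 1 / √(γ a) :=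
    ⟨fun a => if a = 0 then σ / √(γ 0) else 1 / √(γ a), if_pos rfl, fun a ha => if_neg ha⟩
  have hl2 : ∀ a, l a ^ 2 * γ a = 1 := by
    intro a
    by_cases ha : a = 0
    · rw [ha, hl0, div_pow, hs, hσ]; exact one_div_mul_cancel (hγ 0).ne'
    · rw [hl a ha, div_pow, hs, one_pow]; exact one_div_mul_cancel (hγ a).ne'
  have hl03 : l 0 * l 3 * v = σ := by
    rw [hl0, hl 3 (by decide), hv']
    have := hs0 0; have := hs0 3
    field_simp
  have hl12 : l 1 * l 2 * γ 1 = 1 := by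
    have := hl2 1
    rw [hl 2 (by decide), h12, ← hl 1 (by decide)]
    linarith
  refine typeD_obstruction_orthonormal (w := w)
    (A := fun i => Matrix.of fun a b => l a * l b * A i a b) (p := p) (q := q) (μ := σ * μ)
    (fun i a b => by simp only [Matrix.of_apply, hA i a b]; ring) hp hq hμ hpq hpq4 fun P Q => ?_
  have h1 : ∑ i, w i * ((Matrix.of fun a b => l a * l b * A i a b) (plane P).2 (plane Q).1
          * (Matrix.of fun a b => l a * l b * A i a b) (plane P).1 (plane Q).2
        - (Matrix.of fun a b => l a * l b * A i a b) (plane P).1 (plane Q).1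
          * (Matrix.of fun a b => l a * l b * A i a b) (plane P).2 (plane Q).2)
      = (l (plane P).1 * l (plane P).2 * l (plane Q).1 * l (plane Q).2) *
        (typeD p q μ σ P Q * planeScale γ v P Q) := by
    rw [← h P Q, Finset.mul_sum]
    refine Finset.sum_congr rfl fun i _ => ?_
    simp only [Matrix.of_apply]; ring
  rw [h1]
  by_cases hPQ : P = Q
  · subst hPQ
    have e1 := hl2 (plane P).1
    have e2 := hl2 (plane P).2
    rw [planeScale, if_pos rfl, typeD_self p q (σ * μ) μ 1 σ]
    linear_combination (typeD p q μ σ P P * l (plane P).2 ^ 2 * γ (plane P).2) * e1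
      + typeD p q μ σ P P * e2
  · rw [planeScale, if_neg hPQ]
    refine typeD_rescale ?_ hσ hPQ
    rw [← hl03]; linear_combination (l 0 * l 3 * v) * hl12

end Codim

/-! ### Curvature of the three metrics and their failure to immerse in codimension two -/

section LowerBounds

/-- The curvature of the metric with coefficients `(g₀, g₁, g₁, g₃)` in the frame `X_a`, where
`d`, `e` are the first and second radial derivatives. -/
lemma curvCoeff_lrs {g₀ g₁ g₃ d₀ d₁ d₃ e₀ e₁ e₃ : ℝ} (h₀ : g₀ ≠ 0) (h₁ : g₁ ≠ 0) (h₃ : g₃ ≠ 0)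
    (P Q : Fin 6) :
    curvCoeff ![g₀, g₁, g₁, g₃] ![d₀, d₁, d₁, d₃] ![e₀, e₁, e₁, e₃]
        (plane P).1 (plane P).2 (plane Q).1 (plane Q).2 =
      (!![e₁ / 2 - d₁ ^ 2 / (4 * g₁) - d₀ * d₁ / (4 * g₀), 0, 0,
            -d₃ / 2 + d₁ * g₃ / (2 * g₁), 0, 0;
          0, e₁ / 2 - d₁ ^ 2 / (4 * g₁) - d₀ * d₁ / (4 * g₀), 0, 0,
            -d₃ / 2 + d₁ * g₃ / (2 * g₁), 0;
          0, 0, e₃ / 2 - d₃ ^ 2 / (4 * g₃) - d₀ * d₃ / (4 * g₀), 0, 0, d₃ - d₁ * g₃ / g₁;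
          -d₃ / 2 + d₁ * g₃ / (2 * g₁), 0, 0, -g₃ ^ 2 / g₁ + d₁ * d₃ / (4 * g₀), 0, 0;
          0, -d₃ / 2 + d₁ * g₃ / (2 * g₁), 0, 0, -g₃ ^ 2 / g₁ + d₁ * d₃ / (4 * g₀), 0;
          0, 0, d₃ - d₁ * g₃ / g₁, 0, 0, -4 * g₁ + 3 * g₃ + d₁ ^ 2 / (4 * g₀)] :
        Matrix (Fin 6) (Fin 6) ℝ) P Q := by
  fin_cases P <;> fin_cases Q <;>
    simp [curvCoeff, connCoeff, diagCoeff, plane, frameConst, Fin.sum_univ_four] <;>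
    (try field_simp) <;> (try ring)

/-- The flat metric `eta` as a continuous bilinear form. -/
def etaBilin (r s : ℕ) : PseudoEuclid r s →L[ℝ] PseudoEuclid r s →L[ℝ] ℝ :=
  (LinearMap.mk₂ ℝ (eta (r := r) (s := s))
    (by intro x y z; simp only [eta, Prod.fst_add, Prod.snd_add, Pi.add_apply, add_mul,
          Finset.sum_add_distrib]; ring)
    (by intro c x y; simp only [eta, Prod.smul_fst, Prod.smul_snd, Pi.smul_apply, smul_eq_mul,
          mul_assoc, mul_sub, Finset.mul_sum])
    (by intro x y z; simp only [eta, Prod.fst_add, Prod.snd_add, Pi.add_apply, mul_add,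
          Finset.sum_add_distrib]; ring)
    (by intro c x y; simp only [eta, Prod.smul_fst, Prod.smul_snd, Pi.smul_apply, smul_eq_mul,
          mul_left_comm _ c, mul_sub, Finset.mul_sum])).toContinuousBilinearMap

lemma eta_comm {r s : ℕ} (x y : PseudoEuclid r s) : eta x y = eta y x := by
  simp only [eta, mul_comm]

lemma vec4_apply (g₀ g₁ g₃ : ℝ → ℝ) (s : ℝ) :
    (fun i => (![g₀, g₁, g₁, g₃] : Fin 4 → ℝ → ℝ) i s) = ![g₀ s, g₁ s, g₁ s, g₃ s] := by
  funext i; fin_cases i <;> rfl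

lemma hasRadialDeriv_vec {g₀ g₁ g₃ k₀ k₁ k₃ : ℝ → ℝ} {d₀ d₁ d₃ s : ℝ} (h₀ : HasDerivAt g₀ d₀ s)
    (h₁ : HasDerivAt g₁ d₁ s) (h₃ : HasDerivAt g₃ d₃ s) (e₀ : k₀ s = 2 * s * d₀)
    (e₁ : k₁ s = 2 * s * d₁) (e₃ : k₃ s = 2 * s * d₃) :
    HasRadialDeriv ![g₀, g₁, g₁, g₃] ![k₀, k₁, k₁, k₃] s :=
  ⟨![d₀, d₁, d₁, d₃], fun i => by fin_cases i <;> assumption,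
    fun i => by fin_cases i <;> assumption⟩

/-- A metric `diag(g₀, g₁, g₁, g₃)` with curvature of type D has no isometric immersion in
codimension two. -/
theorem no_immersion {r k : ℕ} (hrk : r + k ≤ 6) {U : Set (ℂ × ℂ)} (hU : IsOpen U)
    {f : ℂ × ℂ → PseudoEuclid r k} (hf : ContDiffOn ℝ ∞ f U) {g₀ g₁ g₃ d₀ d₁ d₃ e₀ e₁ e₃ : ℝ → ℝ}
    (hg : ∀ z ∈ U, HasRadialDeriv ![g₀, g₁, g₁, g₃] ![d₀, d₁, d₁, d₃] (normSq z))
    (hd : ∀ z ∈ U, HasRadialDeriv ![d₀, d₁, d₁, d₃] ![e₀, e₁, e₁, e₃] (normSq z))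
    (hB : ∀ z ∈ U, ∀ a b, eta (fderiv ℝ f z (frame a z)) (fderiv ℝ f z (frame b z))
      = diagCoeff ![g₀ (normSq z), g₁ (normSq z), g₁ (normSq z), g₃ (normSq z)] a b)
    {z : ℂ × ℂ} (hz : z ∈ U) {s : ℝ} (hs : normSq z = s) (h₀ : 0 < g₀ s) (h₁ : 0 < g₁ s)
    (h₃ : 0 < g₃ s) {p q μ σ v : ℝ} (hv : 0 < v) (hv2 : v ^ 2 = g₀ s * g₃ s)
    (hσ : σ ^ 2 = 1) (hp : p ≠ 0) (hq : q - σ * μ ≠ 0) (hμ : σ * μ ≠ 0)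
    (hpq : 2 * p ≠ q + σ * μ) (hpq4 : (q + σ * μ) ^ 4 ≠ (2 * p) ^ 4)
    (c1 : e₁ s / 2 - d₁ s ^ 2 / (4 * g₁ s) - d₀ s * d₁ s / (4 * g₀ s) = p * (g₀ s * g₁ s))
    (c2 : -d₃ s / 2 + d₁ s * g₃ s / (2 * g₁ s) = -σ * p * (v * g₁ s))
    (c3 : e₃ s / 2 - d₃ s ^ 2 / (4 * g₃ s) - d₀ s * d₃ s / (4 * g₀ s) = q * (g₀ s * g₃ s))
    (c4 : d₃ s - d₁ s * g₃ s / g₁ s = μ * (v * g₁ s))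
    (c5 : -g₃ s ^ 2 / g₁ s + d₁ s * d₃ s / (4 * g₀ s) = p * (g₁ s * g₃ s))
    (c6 : -4 * g₁ s + 3 * g₃ s + d₁ s ^ 2 / (4 * g₀ s) = q * (g₁ s * g₁ s)) : False := by
  subst hs
  obtain ⟨w, A, hA, h⟩ := exists_second_fundamental_form (B := etaBilin r k)
    (by simpa using hrk) eta_comm hU hf hg hd
    (fun z hz a b => by rw [vec4_apply]; exact hB z hz a b) hz
    (fun i => by fin_cases i <;> assumption)
  simp only [vec4_apply] at h
  refine typeD_obstruction (w := w) (A := fun i => Matrix.of (A i))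
    (γ := ![g₀ (normSq z), g₁ (normSq z), g₁ (normSq z), g₃ (normSq z)]) hA
    (fun i => by fin_cases i <;> assumption) rfl hv hv2 hσ
    hp hq hμ hpq hpq4 fun P Q => ?_
  refine (h _ _ _ _).trans ((curvCoeff_lrs h₀.ne' h₁.ne' h₃.ne' P Q).trans ?_)
  rw [c1, c2, c3, c4, c5, c6]
  fin_cases P <;> fin_cases Q <;> simp [typeD, planeScale, plane] <;>
    first | ring1 | exact Or.inl (by ring)

lemma herm_frame_im (a : Fin 4) (z : ℂ × ℂ) :
    (herm z (frame a z)).im = if a = 3 then normSq z else 0 := by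
  fin_cases a <;> simp [frame, herm, normSq, Complex.normSq_apply] <;> ring

lemma herm_frame_frame (a b : Fin 4) (z : ℂ × ℂ) :
    (herm (frame a z) (frame b z)).re = if a = b then normSq z else 0 := by
  fin_cases a <;> fin_cases b <;> simp [frame, herm, normSq, Complex.normSq_apply] <;> ring

/-- The coefficients in the frame `X_a` of the metric
`α ⟨u, v⟩ - β Im⟨z, u⟩ Im⟨z, v⟩ + γ Re⟨z, u⟩ Re⟨z, v⟩`. -/
lemma diagCoeff_hermitian (α β γ : ℝ) (a b : Fin 4) (z : ℂ × ℂ) :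
    α * (herm (frame a z) (frame b z)).re - β * ((herm z (frame a z)).im * (herm z (frame b z)).im)
      + γ * ((herm z (frame a z)).re * (herm z (frame b z)).re)
    = diagCoeff ![α * normSq z + γ * normSq z ^ 2, α * normSq z, α * normSq z,
        α * normSq z - β * normSq z ^ 2] a b := by
  rw [herm_frame_frame, herm_frame_im, herm_frame_im, herm_frame_re, herm_frame_re]
  fin_cases a <;> fin_cases b <;> simp [diagCoeff] <;> first | ring1 | exact Or.inl (by ring)

lemma herm_mul_re (z u v : ℂ × ℂ) : (herm u z * herm z v).re
    = (herm z u).re * (herm z v).re + (herm z u).im * (herm z v).im := by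
  simp [herm]; ring

lemma fsAffine_eq (z u v : ℂ × ℂ) : fsAffine z u v =
    1 / (1 + normSq z) * (herm u v).re
      - 1 / (1 + normSq z) ^ 2 * ((herm z u).im * (herm z v).im)
      + -1 / (1 + normSq z) ^ 2 * ((herm z u).re * (herm z v).re) := by
  rw [fsAffine, herm_mul_re]; ring

lemma normSq_nonneg (z : ℂ × ℂ) : 0 ≤ normSq z :=
  add_nonneg (Complex.normSq_nonneg _) (Complex.normSq_nonneg _)

lemma rad_sq (z : ℂ × ℂ) : rad z ^ 2 = normSq z := Real.sq_sqrt (normSq_nonneg z)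

lemma rad_pow_four (z : ℂ × ℂ) : rad z ^ 4 = normSq z ^ 2 := by
  rw [← rad_sq]; ring

/-- Trades the invariant forms for Hermitian products by means of `herm_decomp`; both the frame
coefficients and the pull-back by a radial map are read off in this form. -/
lemma ehMetric_eq {a : ℝ} {z : ℂ × ℂ} (hz : z ≠ 0) (hs : normSq z ^ 2 ≠ a ^ 4) (u v : ℂ × ℂ) :
    ehMetric a z u v = 1 * (herm u v).re
      - a ^ 4 / normSq z ^ 3 * ((herm z u).im * (herm z v).im)
      + a ^ 4 / (normSq z * (normSq z ^ 2 - a ^ 4)) * ((herm z u).re * (herm z v).re) := by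
  have hs0 := normSq_pos hz
  have hd := herm_decomp z u v
  have hr := rad_sq z
  have hr4 := rad_pow_four z
  simp only [ehMetric, lrsMetric, fderiv_rad hz, sigma1, sigma2, sigma3, ehA, ehB, ehC, hr, hr4]
  have hrr : rad z ≠ 0 := (Real.sqrt_pos.2 hs0).ne'
  have h6 : (herm z u).re / rad z * ((herm z v).re / rad z)
      = (herm z u).re * (herm z v).re / normSq z := by
    rw [← hr]; field_simp
  rw [h6]
  generalize normSq z = s at *
  have h1 : (herm u v).re = ((z.2 * u.1 - z.1 * u.2).re * (z.2 * v.1 - z.1 * v.2).re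
      + (z.2 * u.1 - z.1 * u.2).im * (z.2 * v.1 - z.1 * v.2).im
      + ((herm z u).re * (herm z v).re + (herm z u).im * (herm z v).im)) / s := by
    rw [hd]; field_simp
  rw [h1]
  have h2 : s ^ 2 - a ^ 4 ≠ 0 := sub_ne_zero.2 hs
  have h3 : 1 - a ^ 4 / s ^ 2 = (s ^ 2 - a ^ 4) / s ^ 2 := by field_simp
  rw [h3]
  field_simp
  ring

/-- The metric is hyperkähler: q + σμ = 0, so the whole self-dual half is flat, while the other half
has eigenvalues 4a⁴/s³, 4a⁴/s³, -8a⁴/s³. -/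
theorem eh_no_immersion {a : ℝ} (ha : 0 < a) {r k : ℕ} (hrk : r + k ≤ 6) {U : Set (ℂ × ℂ)}
    (hU : IsOpen U) (hne : U.Nonempty) (hUa : ∀ z ∈ U, a ^ 4 < normSq z ^ 2)
    {f : ℂ × ℂ → PseudoEuclid r k} (hf : ContDiffOn ℝ ∞ f U)
    (hB : ∀ z ∈ U, ∀ u v, eta (fderiv ℝ f z u) (fderiv ℝ f z v) = ehMetric a z u v) : False := by
  have hpos : ∀ z ∈ U, 0 < normSq z := by
    intro z hz
    have h1 := hUa z hz
    have h2 := normSq_nonneg z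
    rcases h2.eq_or_lt with h | h
    · rw [← h] at h1; have := pow_pos ha 4; norm_num at h1; linarith
    · exact h
  obtain ⟨z, hz⟩ := hne
  have hs := hpos z hz
  have hq := sub_pos.2 (hUa z hz)
  have ha4 := pow_pos ha 4
  refine no_immersion hrk hU hf (hz := hz) (hs := rfl)
    -- The g are the squared lengths of the frame fields; d and e arise from them by one and two
    -- applications of 2 s d/ds.
    (g₀ := fun s => s ^ 3 / (s ^ 2 - a ^ 4)) (g₁ := fun s => s) (g₃ := fun s => (s ^ 2 - a ^ 4) / s)
    (d₀ := fun s => (2 * s ^ 5 - 6 * a ^ 4 * s ^ 3) / (s ^ 2 - a ^ 4) ^ 2) (d₁ := fun s => 2 * s)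
    (d₃ := fun s => 2 * (s ^ 2 + a ^ 4) / s)
    (e₀ := fun s => (4 * s ^ 7 - 8 * a ^ 4 * s ^ 5 + 36 * a ^ 8 * s ^ 3) / (s ^ 2 - a ^ 4) ^ 3)
    (e₁ := fun s => 4 * s) (e₃ := fun s => 4 * (s ^ 2 - a ^ 4) / s)
    (p := 2 * a ^ 4 / normSq z ^ 3) (q := -4 * a ^ 4 / normSq z ^ 3)
    (μ := 4 * a ^ 4 / normSq z ^ 3) (σ := 1) (v := normSq z)
    ?_ ?_ ?_ (div_pos (pow_pos hs 3) hq) hs (div_pos hq hs) hs ?_ (by norm_num) ?_ ?_ ?_ ?_ ?_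
    ?_ ?_ ?_ ?_ ?_ ?_
  · intro z hz
    have hs := (hpos z hz).ne'
    have hq := (sub_pos.2 (hUa z hz)).ne'
    generalize normSq z = s at hs hq ⊢
    have hD : HasDerivAt (fun s : ℝ => s ^ 2 - a ^ 4) (2 * s) s := by
      simpa using (hasDerivAt_pow 2 s).sub_const (a ^ 4)
    refine hasRadialDeriv_vec ((hasDerivAt_pow 3 s).div hD hq) (hasDerivAt_id s)
      (hD.div (hasDerivAt_id s) hs) ?_ ?_ ?_ <;> simp <;> field_simp <;> ring
  · intro z hz
    have hs := (hpos z hz).ne'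
    have hq := (sub_pos.2 (hUa z hz)).ne'
    generalize normSq z = s at hs hq ⊢
    have hD : HasDerivAt (fun s : ℝ => s ^ 2 - a ^ 4) (2 * s) s := by
      simpa using (hasDerivAt_pow 2 s).sub_const (a ^ 4)
    have hD' : HasDerivAt (fun s : ℝ => s ^ 2 + a ^ 4) (2 * s) s := by
      simpa using (hasDerivAt_pow 2 s).add_const (a ^ 4)
    refine hasRadialDeriv_vec ((((hasDerivAt_pow 5 s).const_mul 2).sub
          ((hasDerivAt_pow 3 s).const_mul (6 * a ^ 4))).div (hD.pow 2) (pow_ne_zero 2 hq))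
      ((hasDerivAt_id s).const_mul (2 : ℝ)) ((hD'.const_mul 2).div (hasDerivAt_id s) hs)
      ?_ ?_ ?_ <;> simp <;> field_simp <;> ring
  · intro w hw i j
    have hs := hpos w hw
    have hq := (sub_pos.2 (hUa w hw)).ne'
    have hw0 : w ≠ 0 := by rintro rfl; simp [normSq] at hs
    rw [hB w hw, ehMetric_eq hw0 (hUa w hw).ne', diagCoeff_hermitian]
    congr 1
    funext i
    fin_cases i <;> simp <;> field_simp <;> ring
  all_goals have h0 : 0 < a ^ 4 / normSq z ^ 3 := by positivity
  all_goals have hq' := hq.ne'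
  · field_simp
  · positivity
  · intro h
    have h' : 8 * (a ^ 4 / normSq z ^ 3) = 0 := by linear_combination -h
    linarith
  · positivity
  · intro h
    have h' : 4 * (a ^ 4 / normSq z ^ 3) = 0 := by linear_combination h
    linarith
  · intro h
    have h' : (4 * (a ^ 4 / normSq z ^ 3)) ^ 4 = 0 := by linear_combination -h
    have := pow_pos (mul_pos four_pos h0) 4
    linarith
  all_goals
    clear h0
    generalize normSq z = s at hs hq' ⊢
    field_simp
    ring

/-- Hyperkähler for the other orientation, hence σ = -1. The nut is excluded because the frame
degenerates there. -/
theorem tn_no_immersion {m : ℝ} (hm : 0 < m) {r k : ℕ} (hrk : r + k ≤ 6) {U : Set (ℂ × ℂ)}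
    (hU : IsOpen U) (hne : U.Nonempty) (hU0 : ∀ z ∈ U, z ≠ 0)
    {f : ℂ × ℂ → PseudoEuclid r k} (hf : ContDiffOn ℝ ∞ f U)
    (hB : ∀ z ∈ U, ∀ u v, eta (fderiv ℝ f z u) (fderiv ℝ f z v) = tnMetric m z u v) : False := by
  have hpos : ∀ z ∈ U, 0 < normSq z := fun z hz => normSq_pos (hU0 z hz)
  obtain ⟨z, hz⟩ := hne
  have hs := hpos z hz
  refine no_immersion hrk hU hf (hz := hz) (hs := rfl)
    (g₀ := fun s => s * (s + 2 * m)) (g₁ := fun s => s * (s + 2 * m))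
    (g₃ := fun s => 4 * m ^ 2 * s / (s + 2 * m))
    (d₀ := fun s => 4 * s ^ 2 + 4 * m * s) (d₁ := fun s => 4 * s ^ 2 + 4 * m * s)
    (d₃ := fun s => 16 * m ^ 3 * s / (s + 2 * m) ^ 2)
    (e₀ := fun s => 16 * s ^ 2 + 8 * m * s) (e₁ := fun s => 16 * s ^ 2 + 8 * m * s)
    (e₃ := fun s => 32 * m ^ 3 * s * (2 * m - s) / (s + 2 * m) ^ 3)
    (p := 4 * m / (normSq z + 2 * m) ^ 3) (q := -8 * m / (normSq z + 2 * m) ^ 3)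
    (μ := -8 * m / (normSq z + 2 * m) ^ 3) (σ := -1) (v := 2 * m * normSq z)
    ?_ ?_ ?_ (by positivity) (by positivity) (by positivity) (by positivity) ?_ (by norm_num)
    ?_ ?_ ?_ ?_ ?_ ?_ ?_ ?_ ?_ ?_ ?_
  · intro z hz
    have hs := hpos z hz
    generalize normSq z = s at hs ⊢
    have hD : HasDerivAt (fun s : ℝ => s + 2 * m) 1 s := (hasDerivAt_id s).add_const _
    have h0 := (hasDerivAt_id s).mul hD
    refine hasRadialDeriv_vec h0 h0
      (((hasDerivAt_id s).const_mul (4 * m ^ 2)).div hD (by positivity)) ?_ ?_ ?_ <;>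
        simp <;> field_simp <;> ring
  · intro z hz
    have hs := hpos z hz
    generalize normSq z = s at hs ⊢
    have hD : HasDerivAt (fun s : ℝ => s + 2 * m) 1 s := (hasDerivAt_id s).add_const _
    have h0 := ((hasDerivAt_pow 2 s).const_mul 4).add ((hasDerivAt_id s).const_mul (4 * m))
    refine hasRadialDeriv_vec h0 h0
      (((hasDerivAt_id s).const_mul (16 * m ^ 3)).div (hD.pow 2) (by positivity)) ?_ ?_ ?_ <;>
        simp <;> field_simp <;> ring
  · intro w hw i j
    have hs := hpos w hw
    have e : ∀ u v, tnMetric m w u v = (normSq w + 2 * m) * (herm u v).re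
        - (normSq w + 4 * m) / (normSq w + 2 * m) * ((herm w u).im * (herm w v).im)
        + 0 * ((herm w u).re * (herm w v).re) := by intro u v; rw [tnMetric]; ring
    rw [hB w hw, e, diagCoeff_hermitian]
    congr 1
    funext i
    fin_cases i <;> simp <;> field_simp <;> ring
  all_goals have h0 : 0 < m / (normSq z + 2 * m) ^ 3 := by positivity
  · field_simp; ring
  · positivity
  · intro h
    have h' : 16 * (m / (normSq z + 2 * m) ^ 3) = 0 := by linear_combination -h
    linarith
  · intro h
    have h' : 8 * (m / (normSq z + 2 * m) ^ 3) = 0 := by linear_combination h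
    linarith
  · intro h
    have h' : 8 * (m / (normSq z + 2 * m) ^ 3) = 0 := by linear_combination h
    linarith
  · intro h
    have h' : (8 * (m / (normSq z + 2 * m) ^ 3)) ^ 4 = 0 := by linear_combination -h
    have := pow_pos (mul_pos (by norm_num : (0 : ℝ) < 8) h0) 4
    linarith
  all_goals
    clear h0
    generalize normSq z = s at hs ⊢
    field_simp
    ring

/-- Here the Kähler form has eigenvalue of absolute value 6 and the anti-self-dual bivectors all
have 2. -/
theorem fs_no_immersion {r k : ℕ} (hrk : r + k ≤ 6) {U : Set (ℂ × ℂ)}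
    (hU : IsOpen U) (hne : U.Nonempty) (hU0 : ∀ z ∈ U, z ≠ 0)
    {f : ℂ × ℂ → PseudoEuclid r k} (hf : ContDiffOn ℝ ∞ f U)
    (hB : ∀ z ∈ U, ∀ u v, eta (fderiv ℝ f z u) (fderiv ℝ f z v) = fsAffine z u v) : False := by
  have hpos : ∀ z ∈ U, 0 < normSq z := fun z hz => normSq_pos (hU0 z hz)
  obtain ⟨z, hz⟩ := hne
  have hs := hpos z hz
  refine no_immersion hrk hU hf (hz := hz) (hs := rfl)
    (g₀ := fun s => s / (1 + s) ^ 2) (g₁ := fun s => s / (1 + s))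
    (g₃ := fun s => s / (1 + s) ^ 2)
    (d₀ := fun s => 2 * s * (1 - s) / (1 + s) ^ 3) (d₁ := fun s => 2 * s / (1 + s) ^ 2)
    (d₃ := fun s => 2 * s * (1 - s) / (1 + s) ^ 3)
    (e₀ := fun s => 4 * s * (1 - 4 * s + s ^ 2) / (1 + s) ^ 4)
    (e₁ := fun s => 4 * s * (1 - s) / (1 + s) ^ 3)
    (e₃ := fun s => 4 * s * (1 - 4 * s + s ^ 2) / (1 + s) ^ 4)
    (p := -1) (q := -4) (μ := -2) (σ := 1) (v := normSq z / (1 + normSq z) ^ 2)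
    ?_ ?_ ?_ (by positivity) (by positivity) (by positivity) (by positivity) ?_ (by norm_num)
    (by norm_num) (by norm_num) (by norm_num) (by norm_num) (by norm_num) ?_ ?_ ?_ ?_ ?_ ?_
  · intro z hz
    have hs := hpos z hz
    generalize normSq z = s at hs ⊢
    have hD : HasDerivAt (fun s : ℝ => 1 + s) 1 s := (hasDerivAt_id s).const_add _
    have h0 := (hasDerivAt_id s).div (hD.pow 2) (by simp; positivity)
    refine hasRadialDeriv_vec h0 ((hasDerivAt_id s).div hD (by positivity)) h0 ?_ ?_ ?_ <;>
      simp <;> field_simp <;> ring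
  · intro z hz
    have hs := hpos z hz
    generalize normSq z = s at hs ⊢
    have hD : HasDerivAt (fun s : ℝ => 1 + s) 1 s := (hasDerivAt_id s).const_add _
    have hD' : HasDerivAt (fun s : ℝ => 1 - s) (-1) s := (hasDerivAt_id s).const_sub _
    have h0 := (((hasDerivAt_id s).const_mul 2).mul hD').div (hD.pow 3) (by simp; positivity)
    refine hasRadialDeriv_vec h0 (((hasDerivAt_id s).const_mul 2).div (hD.pow 2)
      (by simp; positivity)) h0 ?_ ?_ ?_ <;> simp <;> field_simp <;> ring
  · intro w hw i j
    have hs := hpos w hw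
    rw [hB w hw, fsAffine_eq, diagCoeff_hermitian]
    congr 1
    funext i
    fin_cases i <;> simp <;> field_simp <;> ring
  all_goals
    generalize normSq z = s at hs ⊢
    field_simp
    try ring

end LowerBounds

/-! ## Radial maps -/

section Radial

/-- The map `z ↦ (p z, q hopf z)`. -/
def core7 (p q : ℝ) (z : ℂ × ℂ) : Fin 7 → ℝ :=
  ![p * z.1.re, p * z.1.im, p * z.2.re, p * z.2.im, q * hopf z 0, q * hopf z 1, q * hopf z 2]

/-- Unlike the polar expression, `core7` is polynomial in z, so it is smooth at the origin as soon
as its two coefficients are. -/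
lemma radial7_eq_core7 (R Z : ℝ) (z : ℂ × ℂ) :
    radial7 R Z z = core7 (R / rad z) (Z / normSq z) z := by
  funext i
  fin_cases i <;> simp [radial7, core7] <;> ring

/-- The derivative of `hopf`. -/
def hopfDeriv (z u : ℂ × ℂ) : Fin 3 → ℝ :=
  ![2 * (u.1.re * z.2.re + z.1.re * u.2.re + u.1.im * z.2.im + z.1.im * u.2.im),
    2 * (u.1.re * z.2.im + z.1.re * u.2.im - u.1.im * z.2.re - z.1.im * u.2.re),
    2 * (z.1.re * u.1.re + z.1.im * u.1.im - z.2.re * u.2.re - z.2.im * u.2.im)]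

/-- A function with directional derivatives `D u`. -/
def HasDirDeriv (f : ℂ × ℂ → ℝ) (D : ℂ × ℂ → ℝ) (z : ℂ × ℂ) : Prop :=
  ∃ L : ℂ × ℂ →L[ℝ] ℝ, HasFDerivAt f L z ∧ ∀ u, L u = D u

lemma HasDirDeriv.mul {f g D E : _} {z : ℂ × ℂ} (hf : HasDirDeriv f D z)
    (hg : HasDirDeriv g E z) : HasDirDeriv (fun w => f w * g w) (fun u => D u * g z + f z * E u) z := by
  obtain ⟨L, hL, h⟩ := hf
  obtain ⟨M, hM, h'⟩ := hg
  exact ⟨_, hL.mul hM, fun u => by simp [h, h']; ring⟩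

lemma HasDirDeriv.add {f g D E : _} {z : ℂ × ℂ} (hf : HasDirDeriv f D z)
    (hg : HasDirDeriv g E z) : HasDirDeriv (fun w => f w + g w) (fun u => D u + E u) z := by
  obtain ⟨L, hL, h⟩ := hf
  obtain ⟨M, hM, h'⟩ := hg
  exact ⟨_, hL.add hM, fun u => by simp [h, h']⟩

lemma HasDirDeriv.const_mul {f D : _} {z : ℂ × ℂ} (hf : HasDirDeriv f D z) (c : ℝ) :
    HasDirDeriv (fun w => c * f w) (fun u => c * D u) z := by
  obtain ⟨L, hL, h⟩ := hf
  exact ⟨_, hL.const_mul c, fun u => by simp [h]⟩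

lemma HasDirDeriv.congr {f D f' D' : _} {z : ℂ × ℂ} (hf : HasDirDeriv f D z)
    (h : ∀ w, f' w = f w) (h' : ∀ u, D' u = D u) : HasDirDeriv f' D' z := by
  rwa [show f' = f from funext h, show D' = D from funext h']

lemma HasDirDeriv.radial {p : ℝ → ℝ} {p' : ℝ} {z : ℂ × ℂ} (hp : HasDerivAt p p' (normSq z)) :
    HasDirDeriv (fun w => p (normSq w)) (fun u => p' * (2 * (herm z u).re)) z := by
  obtain ⟨L, hL, h⟩ := hasFDerivAt_normSq z
  exact ⟨_, hp.comp_hasFDerivAt z hL, fun u => by simp [h]⟩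

lemma hasDirDeriv_re_fst (z : ℂ × ℂ) : HasDirDeriv (fun w => w.1.re) (fun u => u.1.re) z :=
  ⟨_, (Complex.reCLM.comp (ContinuousLinearMap.fst ℝ ℂ ℂ)).hasFDerivAt, fun u => by simp⟩

lemma hasDirDeriv_im_fst (z : ℂ × ℂ) : HasDirDeriv (fun w => w.1.im) (fun u => u.1.im) z :=
  ⟨_, (Complex.imCLM.comp (ContinuousLinearMap.fst ℝ ℂ ℂ)).hasFDerivAt, fun u => by simp⟩

lemma hasDirDeriv_re_snd (z : ℂ × ℂ) : HasDirDeriv (fun w => w.2.re) (fun u => u.2.re) z :=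
  ⟨_, (Complex.reCLM.comp (ContinuousLinearMap.snd ℝ ℂ ℂ)).hasFDerivAt, fun u => by simp⟩

lemma hasDirDeriv_im_snd (z : ℂ × ℂ) : HasDirDeriv (fun w => w.2.im) (fun u => u.2.im) z :=
  ⟨_, (Complex.imCLM.comp (ContinuousLinearMap.snd ℝ ℂ ℂ)).hasFDerivAt, fun u => by simp⟩

lemma hasDirDeriv_hopf (z : ℂ × ℂ) (i : Fin 3) :
    HasDirDeriv (fun w => hopf w i) (fun u => hopfDeriv z u i) z := by
  have h1 := hasDirDeriv_re_fst z
  have h2 := hasDirDeriv_im_fst z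
  have h3 := hasDirDeriv_re_snd z
  have h4 := hasDirDeriv_im_snd z
  fin_cases i
  · refine (((h1.mul h3).add (h2.mul h4)).const_mul 2).congr (fun w => ?_) (fun u => ?_) <;>
      simp [hopf, hopfDeriv] <;> ring
  · refine (((h1.mul h4).add ((h2.mul h3).const_mul (-1))).const_mul 2).congr
      (fun w => ?_) (fun u => ?_) <;> simp [hopf, hopfDeriv] <;> ring
  · refine (((h1.mul h1).add (h2.mul h2)).add
      (((h3.mul h3).add (h4.mul h4)).const_mul (-1))).congr (fun w => ?_) (fun u => ?_) <;>
      simp [hopf, hopfDeriv, Complex.normSq_apply] <;> ring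

/-- The derivative of `core7 (p |z|²) (q |z|²) z`. -/
def core7Deriv (p p' q q' : ℝ) (z u : ℂ × ℂ) : Fin 7 → ℝ :=
  ![p' * (2 * (herm z u).re) * z.1.re + p * u.1.re, p' * (2 * (herm z u).re) * z.1.im + p * u.1.im,
    p' * (2 * (herm z u).re) * z.2.re + p * u.2.re, p' * (2 * (herm z u).re) * z.2.im + p * u.2.im,
    q' * (2 * (herm z u).re) * hopf z 0 + q * hopfDeriv z u 0,
    q' * (2 * (herm z u).re) * hopf z 1 + q * hopfDeriv z u 1,
    q' * (2 * (herm z u).re) * hopf z 2 + q * hopfDeriv z u 2]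

lemma hasFDerivAt_core7 {p q : ℝ → ℝ} {p' q' : ℝ} {z : ℂ × ℂ}
    (hp : HasDerivAt p p' (normSq z)) (hq : HasDerivAt q q' (normSq z)) :
    ∃ L : ℂ × ℂ →L[ℝ] (Fin 7 → ℝ),
      HasFDerivAt (fun w => core7 (p (normSq w)) (q (normSq w)) w) L z ∧
      ∀ u, L u = core7Deriv (p (normSq z)) p' (q (normSq z)) q' z u := by
  have h : ∀ i, HasDirDeriv (fun w => core7 (p (normSq w)) (q (normSq w)) w i)
      (fun u => core7Deriv (p (normSq z)) p' (q (normSq z)) q' z u i) z := by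
    intro i
    have hP := HasDirDeriv.radial hp
    have hQ := HasDirDeriv.radial hq
    fin_cases i
    · exact hP.mul (hasDirDeriv_re_fst z)
    · exact hP.mul (hasDirDeriv_im_fst z)
    · exact hP.mul (hasDirDeriv_re_snd z)
    · exact hP.mul (hasDirDeriv_im_snd z)
    · exact hQ.mul (hasDirDeriv_hopf z 0)
    · exact hQ.mul (hasDirDeriv_hopf z 1)
    · exact hQ.mul (hasDirDeriv_hopf z 2)
  choose L hL hLu using h
  exact ⟨ContinuousLinearMap.pi L, hasFDerivAt_pi.2 hL, fun u => funext fun i => hLu i u⟩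

/-- The Hopf map satisfies |hopf z|² = |z|⁴, and its differential pulls the metric of ℝ³ back to
4(|z|² Re⟨u,v⟩ - Im⟨z,u⟩ Im⟨z,v⟩). Hence three Hermitian expressions suffice, and p', q' enter only
the last one. -/
lemma core7Deriv_inner (p p' q q' : ℝ) (z u v : ℂ × ℂ) :
    ∑ i, core7Deriv p p' q q' z u i * core7Deriv p p' q q' z v i
      = (p ^ 2 + 4 * normSq z * q ^ 2) * (herm u v).re
        - 4 * q ^ 2 * ((herm z u).im * (herm z v).im)
        + (4 * p * p' + 4 * normSq z * p' ^ 2 + 8 * normSq z * (q * q')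
          + 4 * normSq z ^ 2 * q' ^ 2) * ((herm z u).re * (herm z v).re) := by
  have h1 : ∑ i, hopf z i * hopf z i = normSq z ^ 2 := by
    simp [hopf, Fin.sum_univ_three, normSq, Complex.normSq_apply]; ring
  have h2 : ∀ u, ∑ i, hopf z i * hopfDeriv z u i = 2 * normSq z * (herm z u).re := by
    intro u
    simp [hopf, hopfDeriv, herm, Fin.sum_univ_three, normSq, Complex.normSq_apply]; ring
  have h3 : ∑ i, hopfDeriv z u i * hopfDeriv z v i
      = 4 * (normSq z * (herm u v).re - (herm z u).im * (herm z v).im) := by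
    simp [hopfDeriv, herm, Fin.sum_univ_three, normSq, Complex.normSq_apply]; ring
  have h4 : z.1.re * z.1.re + z.1.im * z.1.im + z.2.re * z.2.re + z.2.im * z.2.im
      = normSq z := by
    simp [normSq, Complex.normSq_apply]; ring
  have h5 : ∀ u, z.1.re * u.1.re + z.1.im * u.1.im + z.2.re * u.2.re + z.2.im * u.2.im
      = (herm z u).re := by
    intro u; simp [herm]; ring
  have h6 : u.1.re * v.1.re + u.1.im * v.1.im + u.2.re * v.2.re + u.2.im * v.2.im
      = (herm u v).re := by
    simp [herm]; ring
  have h2u := h2 u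
  have h2v := h2 v
  have h5u := h5 u
  have h5v := h5 v
  rw [Fin.sum_univ_three] at h1 h2u h2v h3
  simp only [core7Deriv, Fin.sum_univ_seven, Matrix.cons_val]
  linear_combination (4 * q' ^ 2 * (herm z u).re * (herm z v).re) * h1
    + (2 * q * q' * (herm z v).re) * h2u + (2 * q * q' * (herm z u).re) * h2v + q ^ 2 * h3
    + (4 * p' ^ 2 * (herm z u).re * (herm z v).re) * h4
    + (2 * p * p' * (herm z v).re) * h5u + (2 * p * p' * (herm z u).re) * h5v + p ^ 2 * h6

lemma contDiff_normSq : ContDiff ℝ ∞ normSq := by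
  have : normSq = fun z : ℂ × ℂ => (z.1.re * z.1.re + z.1.im * z.1.im)
      + (z.2.re * z.2.re + z.2.im * z.2.im) := by
    funext z; simp [normSq, Complex.normSq_apply]
  rw [this]
  have h1 : ContDiff ℝ ∞ fun z : ℂ × ℂ => z.1.re := Complex.reCLM.contDiff.comp contDiff_fst
  have h2 : ContDiff ℝ ∞ fun z : ℂ × ℂ => z.1.im := Complex.imCLM.contDiff.comp contDiff_fst
  have h3 : ContDiff ℝ ∞ fun z : ℂ × ℂ => z.2.re := Complex.reCLM.contDiff.comp contDiff_snd
  have h4 : ContDiff ℝ ∞ fun z : ℂ × ℂ => z.2.im := Complex.imCLM.contDiff.comp contDiff_snd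
  exact ((h1.mul h1).add (h2.mul h2)).add ((h3.mul h3).add (h4.mul h4))

lemma contDiff_hopf (i : Fin 3) : ContDiff ℝ ∞ fun z => hopf z i := by
  have h1 : ContDiff ℝ ∞ fun z : ℂ × ℂ => z.1.re := Complex.reCLM.contDiff.comp contDiff_fst
  have h2 : ContDiff ℝ ∞ fun z : ℂ × ℂ => z.1.im := Complex.imCLM.contDiff.comp contDiff_fst
  have h3 : ContDiff ℝ ∞ fun z : ℂ × ℂ => z.2.re := Complex.reCLM.contDiff.comp contDiff_snd
  have h4 : ContDiff ℝ ∞ fun z : ℂ × ℂ => z.2.im := Complex.imCLM.contDiff.comp contDiff_snd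
  fin_cases i
  · simpa [hopf] using contDiff_const.mul ((h1.mul h3).add (h2.mul h4))
  · have h : (fun z : ℂ × ℂ => hopf z 1) = fun z => 2 * (z.1.re * z.2.im - z.1.im * z.2.re) := by
      funext z; simp [hopf]; ring
    exact h ▸ contDiff_const.mul ((h1.mul h4).sub (h2.mul h3))
  · simpa [hopf, Complex.normSq_apply] using
      ((h1.mul h1).add (h2.mul h2)).sub ((h3.mul h3).add (h4.mul h4))

lemma contDiffOn_core7 {p q : ℝ → ℝ} {I : Set ℝ} (hp : ContDiffOn ℝ ∞ p I)
    (hq : ContDiffOn ℝ ∞ q I) {U : Set (ℂ × ℂ)} (hU : ∀ z ∈ U, normSq z ∈ I) :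
    ContDiffOn ℝ ∞ (fun w => core7 (p (normSq w)) (q (normSq w)) w) U := by
  have hP : ContDiffOn ℝ ∞ (fun w => p (normSq w)) U := hp.comp contDiff_normSq.contDiffOn hU
  have hQ : ContDiffOn ℝ ∞ (fun w => q (normSq w)) U := hq.comp contDiff_normSq.contDiffOn hU
  have h1 : ContDiff ℝ ∞ fun z : ℂ × ℂ => z.1.re := Complex.reCLM.contDiff.comp contDiff_fst
  have h2 : ContDiff ℝ ∞ fun z : ℂ × ℂ => z.1.im := Complex.imCLM.contDiff.comp contDiff_fst
  have h3 : ContDiff ℝ ∞ fun z : ℂ × ℂ => z.2.re := Complex.reCLM.contDiff.comp contDiff_snd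
  have h4 : ContDiff ℝ ∞ fun z : ℂ × ℂ => z.2.im := Complex.imCLM.contDiff.comp contDiff_snd
  refine contDiffOn_pi.2 fun i => ?_
  fin_cases i
  · exact hP.mul h1.contDiffOn
  · exact hP.mul h2.contDiffOn
  · exact hP.mul h3.contDiffOn
  · exact hP.mul h4.contDiffOn
  · exact hQ.mul (contDiff_hopf 0).contDiffOn
  · exact hQ.mul (contDiff_hopf 1).contDiffOn
  · exact hQ.mul (contDiff_hopf 2).contDiffOn

/-- The squared norms of the two components of `ℝ⁷ = ℝ⁴ × ℝ³`. -/
def sqNorm4 (x : Fin 7 → ℝ) : ℝ := x 0 ^ 2 + x 1 ^ 2 + x 2 ^ 2 + x 3 ^ 2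
/-- See `sqNorm4`. -/
def sqNorm3 (x : Fin 7 → ℝ) : ℝ := x 4 ^ 2 + x 5 ^ 2 + x 6 ^ 2

lemma sqNorm4_core7 (p q : ℝ) (z : ℂ × ℂ) : sqNorm4 (core7 p q z) = p ^ 2 * normSq z := by
  simp [sqNorm4, core7, normSq, Complex.normSq_apply]; ring

lemma sqNorm3_core7 (p q : ℝ) (z : ℂ × ℂ) : sqNorm3 (core7 p q z) = q ^ 2 * normSq z ^ 2 := by
  simp [sqNorm3, core7, hopf, normSq, Complex.normSq_apply]; ring

lemma continuous_sqNorm4 : Continuous sqNorm4 := by unfold sqNorm4; fun_prop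
lemma continuous_sqNorm3 : Continuous sqNorm3 := by unfold sqNorm3; fun_prop

/-- The inverse of a strictly monotone function on an interval is continuous, whether or not the
function is. -/
lemma tendsto_of_strictMonoOn {ι : Type*} {l : Filter ι} {N : Set ℝ} (hN : N.OrdConnected)
    {χ : ℝ → ℝ} (hχ : StrictMonoOn χ N) {t : ι → ℝ} {t₀ : ℝ} (ht₀ : t₀ ∈ N)
    (ht : ∀ᶠ i in l, t i ∈ N) (h : Filter.Tendsto (fun i => χ (t i)) l (𝓝 (χ t₀))) :
    Filter.Tendsto t l (𝓝 t₀) := by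
  refine tendsto_order.2 ⟨fun a ha => ?_, fun a ha => ?_⟩
  · by_cases haN : a ∈ N
    · filter_upwards [ht, (tendsto_order.1 h).1 _ (hχ haN ht₀ ha)] with i hi hi'
      exact (hχ.lt_iff_lt haN hi).1 hi'
    · filter_upwards [ht] with i hi
      by_contra hle
      exact haN (hN.out hi ht₀ ⟨not_lt.1 hle, ha.le⟩)
  · by_cases haN : a ∈ N
    · filter_upwards [ht, (tendsto_order.1 h).2 _ (hχ ht₀ haN ha)] with i hi hi'
      exact (hχ.lt_iff_lt hi haN).1 hi'
    · filter_upwards [ht] with i hi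
      by_contra hle
      exact haN (hN.out ht₀ hi ⟨ha.le, not_lt.1 hle⟩)

/-- Φ recovers χ(s) from the image, hence s depends continuously on the image point; dividing the
first four coordinates by p(s) then recovers z. -/
lemma isEmbedding_core7 {p q : ℝ → ℝ} {U : Set (ℂ × ℂ)}
    (hcont : ContinuousOn (fun w => core7 (p (normSq w)) (q (normSq w)) w) U)
    (hp : ∀ z ∈ U, ContinuousAt p (normSq z) ∧ p (normSq z) ≠ 0)
    {N : Set ℝ} (hN : N.OrdConnected) (hUN : ∀ z ∈ U, normSq z ∈ N) {χ : ℝ → ℝ}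
    (hχ : StrictMonoOn χ N) {Φ : (Fin 7 → ℝ) → ℝ}
    (hΦ : ∀ z ∈ U, ContinuousAt Φ (core7 (p (normSq z)) (q (normSq z)) z) ∧
      Φ (core7 (p (normSq z)) (q (normSq z)) z) = χ (normSq z)) :
    IsEmbedding (fun z : U => core7 (p (normSq z.1)) (q (normSq z.1)) z.1) := by
  set f := fun z : U => core7 (p (normSq z.1)) (q (normSq z.1)) z.1 with hf
  have hfc : Continuous f := continuousOn_iff_continuous_domRestrict.1 hcont
  have hind : IsInducing f := by
    refine isInducing_iff_nhds.2 fun z => le_antisymm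
      (Filter.map_le_iff_le_comap.1 hfc.continuousAt) ?_
    set l := Filter.comap f (𝓝 (f z)) with hl
    have hfl : Filter.Tendsto f l (𝓝 (f z)) := Filter.tendsto_comap
    have hs : Filter.Tendsto (fun w : U => normSq w.1) l (𝓝 (normSq z.1)) := by
      refine tendsto_of_strictMonoOn hN hχ (hUN z z.2)
        (Filter.Eventually.of_forall fun w => hUN w w.2) ?_
      have h1 : Filter.Tendsto (fun w => Φ (f w)) l (𝓝 (Φ (f z))) := (hΦ z z.2).1.tendsto.comp hfl
      simpa only [hf, (hΦ _ (Subtype.coe_prop _)).2] using h1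
    have hps : Filter.Tendsto (fun w : U => p (normSq w.1)) l (𝓝 (p (normSq z.1))) :=
      (hp z z.2).1.tendsto.comp hs
    have hc : ∀ i, Filter.Tendsto (fun w => f w i / p (normSq w.1)) l
        (𝓝 (f z i / p (normSq z.1))) := fun i =>
      (((continuous_apply i).tendsto _).comp hfl).div hps (hp z z.2).2
    have hdiv : ∀ (w : U) (x : ℝ), p (normSq w.1) * x / p (normSq w.1) = x := fun w x =>
      mul_div_cancel_left₀ x (hp w w.2).2
    have c0 := hc 0
    have c1 := hc 1
    have c2 := hc 2
    have c3 := hc 3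
    simp only [hf, core7, Matrix.cons_val, hdiv] at c0 c1 c2 c3
    have hlim : Filter.Tendsto (fun w : U => w.1) l (𝓝 z.1) := by
      have ha : Filter.Tendsto (fun w : U => (⟨w.1.1.re, w.1.1.im⟩ : ℂ)) l
          (𝓝 ⟨z.1.1.re, z.1.1.im⟩) :=
        (Complex.equivRealProdCLM.symm.continuous.tendsto _).comp (c0.prodMk_nhds c1)
      have hb : Filter.Tendsto (fun w : U => (⟨w.1.2.re, w.1.2.im⟩ : ℂ)) l
          (𝓝 ⟨z.1.2.re, z.1.2.im⟩) :=
        (Complex.equivRealProdCLM.symm.continuous.tendsto _).comp (c2.prodMk_nhds c3)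
      exact ha.prodMk_nhds hb
    exact tendsto_subtype_rng.2 hlim
  -- The source is T₀, so an inducing map is automatically injective.
  exact hind.isEmbedding

end Radial

/-! ### The radial criterion: one scalar equation besides the choice of the two profile functions -/

section RadialEmbedding

/-- `ℝ⁷ × ℝ → ℝ^{7,0}`, forgetting the last coordinate. -/
def toR70 : (Fin 7 → ℝ) × ℝ →L[ℝ] PseudoEuclid 7 0 := (ContinuousLinearMap.fst ℝ _ _).prod 0
/-- `ℝ⁷ × ℝ ≅ ℝ^{7,1}`. -/
def toR71 : (Fin 7 → ℝ) × ℝ →L[ℝ] PseudoEuclid 7 1 :=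
  (ContinuousLinearMap.fst ℝ _ _).prod
    (ContinuousLinearMap.pi fun _ => ContinuousLinearMap.snd ℝ (Fin 7 → ℝ) ℝ)
/-- `ℝ⁷ × ℝ ≅ ℝ^{8,0}`. -/
def toR80 : (Fin 7 → ℝ) × ℝ →L[ℝ] PseudoEuclid 8 0 :=
  (ContinuousLinearMap.pi fun i : Fin 8 => Fin.lastCases (ContinuousLinearMap.snd ℝ (Fin 7 → ℝ) ℝ)
    (fun j => (ContinuousLinearMap.proj (R := ℝ) (φ := fun _ : Fin 7 => ℝ) j).comp
      (ContinuousLinearMap.fst ℝ (Fin 7 → ℝ) ℝ)) i).prod 0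
/-- The projection `ℝ^{8,0} → ℝ⁷`. -/
def fromR80 : PseudoEuclid 8 0 →L[ℝ] (Fin 7 → ℝ) :=
  (ContinuousLinearMap.pi fun j : Fin 7 =>
    (ContinuousLinearMap.proj (R := ℝ) (φ := fun _ : Fin 8 => ℝ) j.castSucc).comp
      (ContinuousLinearMap.fst ℝ (Fin 8 → ℝ) (Fin 0 → ℝ)))

lemma toR70_apply (x : Fin 7 → ℝ) (a : ℝ) : toR70 (x, a) = (x, ![]) := by
  simp only [toR70, ContinuousLinearMap.prod_apply, ContinuousLinearMap.coe_fst']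
  exact Prod.ext rfl (Subsingleton.elim _ _)

lemma toR71_apply (x : Fin 7 → ℝ) (a : ℝ) : toR71 (x, a) = (x, ![a]) := by
  refine Prod.ext rfl (funext fun i => ?_)
  fin_cases i; rfl

lemma toR80_apply (x : Fin 7 → ℝ) (a : ℝ) :
    toR80 (x, a) = (Fin.snoc (α := fun _ => ℝ) x a, ![]) := by
  refine Prod.ext (funext fun i => ?_) (Subsingleton.elim _ _)
  refine Fin.lastCases ?_ (fun j => ?_) i
  · simp only [toR80, ContinuousLinearMap.prod_apply, ContinuousLinearMap.coe_pi',
      Fin.lastCases_last, ContinuousLinearMap.coe_snd', Fin.snoc_last]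
  · simp [toR80]

lemma eta_toR70 (x y : (Fin 7 → ℝ) × ℝ) :
    eta (toR70 x) (toR70 y) = ∑ i, x.1 i * y.1 i + 0 * (x.2 * y.2) := by
  obtain ⟨x, a⟩ := x
  obtain ⟨y, b⟩ := y
  simp [toR70_apply, eta]

lemma eta_toR71 (x y : (Fin 7 → ℝ) × ℝ) :
    eta (toR71 x) (toR71 y) = ∑ i, x.1 i * y.1 i + -1 * (x.2 * y.2) := by
  obtain ⟨x, a⟩ := x
  obtain ⟨y, b⟩ := y
  simp [toR71_apply, eta]; ring

lemma eta_toR80 (x y : (Fin 7 → ℝ) × ℝ) :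
    eta (toR80 x) (toR80 y) = ∑ i, x.1 i * y.1 i + 1 * (x.2 * y.2) := by
  obtain ⟨x, a⟩ := x
  obtain ⟨y, b⟩ := y
  rw [toR80_apply, toR80_apply, eta, Fin.sum_univ_castSucc]
  simp only [Fin.snoc_castSucc, Fin.snoc_last]
  simp

lemma fromR80_toR80 (x : (Fin 7 → ℝ) × ℝ) : fromR80 (toR80 x) = x.1 := by
  obtain ⟨x, a⟩ := x
  rw [toR80_apply]
  funext j
  simp [fromR80]

/-- The radial map with conformal factor `Ω` of the metric
`(c + 4 s b) ⟨u, v⟩ - 4 b Im⟨z, u⟩ Im⟨z, v⟩ + γ Re⟨z, u⟩ Re⟨z, v⟩`, where `s = |z|²`. -/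
def radialMap {r k : ℕ} (T : (Fin 7 → ℝ) × ℝ →L[ℝ] PseudoEuclid r k) (Ω c b F : ℝ → ℝ)
    (z : ℂ × ℂ) : PseudoEuclid r k :=
  T (core7 (Ω (normSq z) * √(c (normSq z))) (Ω (normSq z) * √(b (normSq z))) z, F (normSq z))

/-- With p = Ω√c and q = Ω√b the first two coefficients of `core7Deriv_inner` are automatically Ω²
times those of g. Here l is the logarithmic derivative of Ω, and 2pp' = Ω²(2lc + c'), 2qq' = Ω²(2lb
+ b') turn the third coefficient into `hγ`. The map π forgets the coordinate F, which plays no part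
in separating points. -/
theorem radialMap_isConformalEmbeddingOn {r k : ℕ} {T : (Fin 7 → ℝ) × ℝ →L[ℝ] PseudoEuclid r k}
    {π : PseudoEuclid r k →L[ℝ] (Fin 7 → ℝ)} {ε : ℝ} (hπ : ∀ x, π (T x) = x.1)
    (hT : ∀ x y, eta (T x) (T y) = ∑ i, x.1 i * y.1 i + ε * (x.2 * y.2))
    {I : Set ℝ} (hI : IsOpen I) {Ω c b F : ℝ → ℝ} (hΩ : ContDiffOn ℝ ∞ Ω I)
    (hc : ContDiffOn ℝ ∞ c I) (hb : ContDiffOn ℝ ∞ b I) (hF : ContDiffOn ℝ ∞ F I)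
    (hΩ0 : ∀ s ∈ I, 0 < Ω s) (hc0 : ∀ s ∈ I, 0 < c s) (hb0 : ∀ s ∈ I, 0 < b s)
    {U : Set (ℂ × ℂ)} (hUI : ∀ z ∈ U, normSq z ∈ I)
    {l c' b' F' γ : ℝ → ℝ} (hΩ' : ∀ s ∈ I, HasDerivAt Ω (Ω s * l s) s)
    (hc' : ∀ s ∈ I, HasDerivAt c (c' s) s) (hb' : ∀ s ∈ I, HasDerivAt b (b' s) s)
    (hF' : ∀ s ∈ I, HasDerivAt F (F' s) s)
    (hγ : ∀ s ∈ I, 2 * (2 * l s * c s + c' s) + s * (2 * l s * c s + c' s) ^ 2 / c s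
      + 4 * s * (2 * l s * b s + b' s) + s ^ 2 * (2 * l s * b s + b' s) ^ 2 / b s
      + 4 * ε * F' s ^ 2 / Ω s ^ 2 = γ s)
    {g : ∀ x : ℂ × ℂ, TangentSpace 𝓘(ℝ, ℂ × ℂ) x → TangentSpace 𝓘(ℝ, ℂ × ℂ) x → ℝ}
    (hg : ∀ z ∈ U, ∀ u v : ℂ × ℂ, g z u v
      = (c (normSq z) + 4 * normSq z * b (normSq z)) * (herm u v).re
        - 4 * b (normSq z) * ((herm z u).im * (herm z v).im)
        + γ (normSq z) * ((herm z u).re * (herm z v).re))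
    {N : Set ℝ} (hN : N.OrdConnected) (hUN : ∀ z ∈ U, normSq z ∈ N) {χ : ℝ → ℝ}
    (hχ : StrictMonoOn χ N) {Φ : (Fin 7 → ℝ) → ℝ}
    (hΦ : ∀ z ∈ U, ∀ x, x = core7 (Ω (normSq z) * √(c (normSq z)))
      (Ω (normSq z) * √(b (normSq z))) z → ContinuousAt Φ x ∧ Φ x = χ (normSq z)) :
    IsConformalEmbeddingOn (r := r) (s := k) g (fun z => Ω (normSq z)) U
      (radialMap T Ω c b F) := by
  set p : ℝ → ℝ := fun s => Ω s * √(c s) with hp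
  set q : ℝ → ℝ := fun s => Ω s * √(b s) with hq
  have hps : ContDiffOn ℝ ∞ p I := hΩ.mul (hc.sqrt fun s hs => (hc0 s hs).ne')
  have hqs : ContDiffOn ℝ ∞ q I := hΩ.mul (hb.sqrt fun s hs => (hb0 s hs).ne')
  have hcore : ContDiffOn ℝ ∞ (fun w => core7 (p (normSq w)) (q (normSq w)) w) U :=
    contDiffOn_core7 hps hqs hUI
  have hFs : ContDiffOn ℝ ∞ (fun w => F (normSq w)) U := hF.comp contDiff_normSq.contDiffOn hUI
  have hsmooth : ContDiffOn ℝ ∞ (radialMap T Ω c b F) U :=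
    T.contDiff.comp_contDiffOn (hcore.prodMk hFs)
  refine ⟨contMDiffOn_iff_contDiffOn.2 hsmooth, ?_, fun z hz => hΩ0 _ (hUI z hz), ?_⟩
  · have hemb := isEmbedding_core7 hcore.continuousOn (fun z hz =>
      ⟨(hps.contDiffAt (hI.mem_nhds (hUI z hz))).continuousAt,
        (mul_pos (hΩ0 _ (hUI z hz)) (Real.sqrt_pos.2 (hc0 _ (hUI z hz)))).ne'⟩) hN hUN hχ
      (Φ := Φ) (fun z hz => hΦ z hz _ rfl)
    refine IsEmbedding.of_comp
      (continuousOn_iff_continuous_domRestrict.1 hsmooth.continuousOn) π.continuous ?_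
    convert hemb using 1
    funext z
    exact hπ _
  · intro z hz u v
    have hs := hUI z hz
    rw [mfderiv_eq_fderiv]
    have hcp := hc0 _ hs
    have hbp := hb0 _ hs
    have hp' := (hΩ' _ hs).mul ((hc' _ hs).sqrt hcp.ne')
    have hq' := (hΩ' _ hs).mul ((hb' _ hs).sqrt hbp.ne')
    obtain ⟨L, hL, hLu⟩ := hasFDerivAt_core7 hp' hq'
    obtain ⟨M, hM, hMu⟩ := HasDirDeriv.radial (hF' _ hs)
    have hd : HasFDerivAt (radialMap T Ω c b F) (T.comp (L.prod M)) z :=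
      T.hasFDerivAt.comp z (hL.prodMk hM)
    have key : ∀ u v : ℂ × ℂ, eta (T ((L.prod M) u)) (T ((L.prod M) v))
        = Ω (normSq z) ^ 2 * g z u v := by
      intro u v
      rw [hT]
      simp only [ContinuousLinearMap.prod_apply, hLu, hMu, core7Deriv_inner, hg z hz]
      have h := hγ _ hs
      have hΩz := (hΩ0 _ hs).ne'
      have e1 := Real.sq_sqrt hcp.le
      have e2 := Real.sq_sqrt hbp.le
      have f1 := (Real.sqrt_pos.2 hcp).ne'
      have f2 := (Real.sqrt_pos.2 hbp).ne'
      simp only [Pi.mul_apply]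
      rw [← h]
      generalize √(c (normSq z)) = y at *
      generalize √(b (normSq z)) = x at *
      rw [← e1, ← e2]
      field_simp
      ring
    rw [hd.fderiv]
    exact key u v

end RadialEmbedding

/-! ## The Eguchi--Hanson metric: explicit embeddings -/

section EH

lemma exists_antideriv {φ : ℝ → ℝ} {c : ℝ} (hφ : ContDiffOn ℝ ∞ φ (Ioi c)) :
    ∃ F : ℝ → ℝ, (∀ r, c < r → HasDerivAt F (φ r) r) ∧ ContDiffOn ℝ ∞ F (Ioi c) := by
  -- The base point c + 1 is interior, since φ may be singular at c.
  have hd : ∀ r, c < r → HasDerivAt (fun r => ∫ t in (c + 1)..r, φ t) (φ r) r := by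
    intro r hr
    refine intervalIntegral.integral_hasDerivAt_right ?_ ?_ ?_
    · refine (hφ.continuousOn.mono ?_).intervalIntegrable
      intro t ht
      exact lt_of_lt_of_le (lt_min (by linarith) hr) ht.1
    · exact hφ.continuousOn.stronglyMeasurableAtFilter isOpen_Ioi r hr
    · exact hφ.continuousOn.continuousAt (isOpen_Ioi.mem_nhds hr)
  refine ⟨_, hd, ?_⟩
  rw [contDiffOn_infty_iff_deriv_of_isOpen isOpen_Ioi]
  exact ⟨fun r hr => (hd r hr).differentiableAt.differentiableWithinAt,
    hφ.congr fun r hr => (hd r hr).deriv⟩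

lemma exists_log_antideriv {φ : ℝ → ℝ} {c : ℝ} (hφ : ContDiffOn ℝ ∞ φ (Ioi c)) :
    ∃ Ω : ℝ → ℝ, (∀ r, 0 < Ω r) ∧ (∀ r, c < r → HasDerivAt Ω (Ω r * φ r) r) ∧
      ContDiffOn ℝ ∞ Ω (Ioi c) := by
  obtain ⟨F, hF, hFs⟩ := exists_antideriv hφ
  exact ⟨fun r => Real.exp (F r), fun r => Real.exp_pos _, fun r hr => (hF r hr).exp, hFs.exp⟩

lemma eq_sqrt_of_sq {x y : ℝ} (hx : 0 ≤ x) (h : x ^ 2 = y) : x = √y := by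
  rw [← h, Real.sqrt_sq hx]

lemma IsConformalEmbeddingOn.congr {E : Type*} [NormedAddCommGroup E] [NormedSpace ℝ E]
    {M : Type*} [TopologicalSpace M] [ChartedSpace E M] {r s : ℕ}
    {g : ∀ x : M, TangentSpace 𝓘(ℝ, E) x → TangentSpace 𝓘(ℝ, E) x → ℝ} {Ω Ω' : M → ℝ} {U : Set M}
    {f f' : M → PseudoEuclid r s} (h : IsConformalEmbeddingOn g Ω U f) (hU : IsOpen U)
    (hf : ∀ x ∈ U, f' x = f x) (hΩ : ∀ x ∈ U, Ω' x = Ω x) :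
    IsConformalEmbeddingOn g Ω' U f' := by
  refine ⟨h.contMDiffOn.congr hf, ?_, fun x hx => by rw [hΩ x hx]; exact h.factor_pos x hx, ?_⟩
  · rw [show (fun x : U => f' x) = fun x : U => f x from funext fun x => hf x x.2]
    exact h.isEmbedding
  · intro x hx u v
    have he : f' =ᶠ[𝓝 x] f := Filter.eventually_of_mem (hU.mem_nhds hx) hf
    rw [he.mfderiv_eq, hΩ x hx]
    exact h.pullback x hx u v

lemma IsConformalEmbeddingOn.mono {E : Type*} [NormedAddCommGroup E] [NormedSpace ℝ E]
    {M : Type*} [TopologicalSpace M] [ChartedSpace E M] {r s : ℕ}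
    {g : ∀ x : M, TangentSpace 𝓘(ℝ, E) x → TangentSpace 𝓘(ℝ, E) x → ℝ} {Ω : M → ℝ} {U V : Set M}
    {f : M → PseudoEuclid r s} (h : IsConformalEmbeddingOn g Ω U f) (hV : V ⊆ U) :
    IsConformalEmbeddingOn g Ω V f :=
  ⟨h.contMDiffOn.mono hV, h.isEmbedding.comp (IsEmbedding.inclusion hV),
    fun x hx => h.factor_pos x (hV hx), fun x hx => h.pullback x (hV hx)⟩

lemma mul_sqrt_sq {Ω c : ℝ} (hc : 0 ≤ c) : (Ω * √c) ^ 2 = Ω ^ 2 * c := by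
  rw [mul_pow, Real.sq_sqrt hc]

/-- The ratio of the two components recovers the radius. -/
lemma continuousAt_ratio43 {Ω c b : ℝ} (hΩ : 0 < Ω) (hc : 0 < c) (hb : 0 < b) {z : ℂ × ℂ}
    (hz : 0 < normSq z) {x : Fin 7 → ℝ} (hx : x = core7 (Ω * √c) (Ω * √b) z) :
    ContinuousAt (fun x => sqNorm4 x / sqNorm3 x) x ∧
      sqNorm4 x / sqNorm3 x = c / (b * normSq z) := by
  have h3 : sqNorm3 x = Ω ^ 2 * b * normSq z ^ 2 := by
    rw [hx, sqNorm3_core7, mul_sqrt_sq hb.le]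
  have h4 : sqNorm4 x = Ω ^ 2 * c * normSq z := by
    rw [hx, sqNorm4_core7, mul_sqrt_sq hc.le]
  refine ⟨continuous_sqNorm4.continuousAt.div continuous_sqNorm3.continuousAt ?_, ?_⟩
  · rw [h3]; positivity
  · rw [h3, h4]; field_simp

lemma continuousAt_ratio34 {Ω c b : ℝ} (hΩ : 0 < Ω) (hc : 0 < c) (hb : 0 < b) {z : ℂ × ℂ}
    (hz : 0 < normSq z) {x : Fin 7 → ℝ} (hx : x = core7 (Ω * √c) (Ω * √b) z) :
    ContinuousAt (fun x => sqNorm3 x / sqNorm4 x) x ∧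
      sqNorm3 x / sqNorm4 x = b * normSq z / c := by
  have h3 : sqNorm3 x = Ω ^ 2 * b * normSq z ^ 2 := by
    rw [hx, sqNorm3_core7, mul_sqrt_sq hb.le]
  have h4 : sqNorm4 x = Ω ^ 2 * c * normSq z := by
    rw [hx, sqNorm4_core7, mul_sqrt_sq hc.le]
  refine ⟨continuous_sqNorm3.continuousAt.div continuous_sqNorm4.continuousAt ?_, ?_⟩
  · rw [h4]; positivity
  · rw [h3, h4]; field_simp

/-- The function `4 C / s` of the Eguchi--Hanson metric. -/
def ehc (a s : ℝ) : ℝ := (s ^ 2 - a ^ 4) / s ^ 2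
/-- The function `(B - C) / s²` of the Eguchi--Hanson metric. -/
def ehb (a s : ℝ) : ℝ := a ^ 4 / (4 * s ^ 3)

variable {a : ℝ}

lemma sq_pos_of_sq_lt (ha : 0 < a) {s : ℝ} (h : a ^ 2 < s) : 0 < s ∧ 0 < s ^ 2 - a ^ 4 := by
  have h2 := pow_pos ha 2
  refine ⟨by linarith, ?_⟩
  have : s ^ 2 - a ^ 4 = (s - a ^ 2) * (s + a ^ 2) := by ring
  rw [this]
  exact mul_pos (by linarith) (by linarith)

lemma hasDerivAt_ehc {s : ℝ} (hs : s ≠ 0) : HasDerivAt (ehc a) (2 * a ^ 4 / s ^ 3) s := by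
  have h : HasDerivAt (ehc a) _ s :=
    ((hasDerivAt_pow 2 s).sub_const (a ^ 4)).div (hasDerivAt_pow 2 s) (pow_ne_zero 2 hs)
  convert h using 1
  field_simp
  ring

lemma hasDerivAt_ehb {s : ℝ} (hs : s ≠ 0) : HasDerivAt (ehb a) (-3 * a ^ 4 / (4 * s ^ 4)) s := by
  have h : HasDerivAt (ehb a) _ s :=
    (hasDerivAt_const s (a ^ 4)).div ((hasDerivAt_pow 3 s).const_mul 4)
      (mul_ne_zero four_ne_zero (pow_ne_zero 3 hs))
  convert h using 1
  field_simp
  ring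

lemma ehMetric_radial_form (ha : 0 < a) {z : ℂ × ℂ} (hz : a ^ 2 < normSq z) (u v : ℂ × ℂ) :
    ehMetric a z u v = (ehc a (normSq z) + 4 * normSq z * ehb a (normSq z)) * (herm u v).re
      - 4 * ehb a (normSq z) * ((herm z u).im * (herm z v).im)
      + a ^ 4 / (normSq z * (normSq z ^ 2 - a ^ 4)) * ((herm z u).re * (herm z v).re) := by
  obtain ⟨hs, hq⟩ := sq_pos_of_sq_lt ha hz
  have hz0 : z ≠ 0 := by rintro rfl; simp [normSq] at hs
  rw [ehMetric_eq hz0 (sub_pos.1 hq).ne']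
  have e1 : ehc a (normSq z) + 4 * normSq z * ehb a (normSq z) = 1 := by
    rw [ehc, ehb]; field_simp; ring
  have e2 : 4 * ehb a (normSq z) = a ^ 4 / normSq z ^ 3 := by rw [ehb]; field_simp
  rw [e1, e2]

/-- Radial conformally isometric embeddings of the Eguchi--Hanson metric. -/
lemma eh_radialMap (ha : 0 < a) {r k : ℕ} {T : (Fin 7 → ℝ) × ℝ →L[ℝ] PseudoEuclid r k}
    {π : PseudoEuclid r k →L[ℝ] (Fin 7 → ℝ)} {ε : ℝ} (hπ : ∀ x, π (T x) = x.1)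
    (hT : ∀ x y, eta (T x) (T y) = ∑ i, x.1 i * y.1 i + ε * (x.2 * y.2))
    {I : Set ℝ} (hI : IsOpen I) (hIa : ∀ s ∈ I, a ^ 2 < s) {Ω F l F' : ℝ → ℝ}
    (hΩ : ContDiffOn ℝ ∞ Ω I) (hF : ContDiffOn ℝ ∞ F I) (hΩ0 : ∀ s ∈ I, 0 < Ω s)
    (hΩ' : ∀ s ∈ I, HasDerivAt Ω (Ω s * l s) s) (hF' : ∀ s ∈ I, HasDerivAt F (F' s) s)
    (hγ : ∀ s ∈ I, 4 * (s ^ 2 - a ^ 4) * s ^ 2 * (4 * s ^ 2 - 3 * a ^ 4) * l s ^ 2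
      + 4 * s * (4 * s ^ 2 + 3 * a ^ 4) * (s ^ 2 - a ^ 4) * l s
      + 16 * ε * F' s ^ 2 / Ω s ^ 2 * s ^ 3 * (s ^ 2 - a ^ 4)
      + 9 * a ^ 4 * s ^ 2 + 3 * a ^ 8 = 0) :
    IsConformalEmbeddingOn (r := r) (s := k) (ehMetric a) (fun z => Ω (normSq z))
      {z | normSq z ∈ I} (radialMap T Ω (ehc a) (ehb a) F) := by
  have ha4 := pow_pos ha 4
  refine radialMap_isConformalEmbeddingOn hπ hT hI hΩ ?_ ?_ hF hΩ0 ?_ ?_ (fun z hz => hz) hΩ'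
    (fun s hs => hasDerivAt_ehc (sq_pos_of_sq_lt ha (hIa s hs)).1.ne')
    (fun s hs => hasDerivAt_ehb (sq_pos_of_sq_lt ha (hIa s hs)).1.ne') hF'
    (γ := fun s => a ^ 4 / (s * (s ^ 2 - a ^ 4))) ?_
    (fun z hz u v => ehMetric_radial_form ha (hIa _ hz) u v)
    (N := Ioi (a ^ 2)) ordConnected_Ioi (fun z hz => hIa _ hz)
    -- This is R²/Z² = 4C/(B - C); Ω drops out of the ratio, so no monotonicity of Ω is required.
    (χ := fun s => 4 * (s ^ 2 - a ^ 4) / a ^ 4) ?_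
    (Φ := fun x => sqNorm4 x / sqNorm3 x) ?_
  · refine ContDiffOn.div (by fun_prop) (by fun_prop) fun s hs => ?_
    have := (sq_pos_of_sq_lt ha (hIa s hs)).1; positivity
  · refine ContDiffOn.div (by fun_prop) (by fun_prop) fun s hs => ?_
    have := (sq_pos_of_sq_lt ha (hIa s hs)).1; positivity
  · intro s hs
    obtain ⟨h1, h2⟩ := sq_pos_of_sq_lt ha (hIa s hs)
    unfold ehc; positivity
  · intro s hs
    obtain ⟨h1, h2⟩ := sq_pos_of_sq_lt ha (hIa s hs)
    unfold ehb; positivity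
  · intro s hs
    obtain ⟨h1, h2⟩ := sq_pos_of_sq_lt ha (hIa s hs)
    have h := hγ s hs
    have hΩs := (hΩ0 s hs).ne'
    have h2' := h2.ne'
    simp only [ehc, ehb]
    field_simp at h ⊢
    linear_combination h
  · intro s hs t ht hst
    have hs' := (sq_pos_of_sq_lt ha hs).1
    simp only
    gcongr
  · intro z hz x hx
    obtain ⟨h1, h2⟩ := sq_pos_of_sq_lt ha (hIa _ hz)
    obtain ⟨k1, k2⟩ := continuousAt_ratio43 (hΩ0 _ hz)
      (show 0 < ehc a (normSq z) by unfold ehc; positivity)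
      (show 0 < ehb a (normSq z) by unfold ehb; positivity) h1 hx
    refine ⟨k1, k2.trans ?_⟩
    unfold ehc ehb
    field_simp

end EH

/-! ### The Eguchi-Hanson embeddings in ℝ^{7,1} and ℝ⁷ -/

section EHExplicit

variable {a : ℝ}

lemma hasDerivAt_comp_sqrt {F : ℝ → ℝ} {F' s : ℝ} (hs : 0 < s) (h : HasDerivAt F F' (√s)) :
    HasDerivAt (fun s => F √s) (F' / (2 * √s)) s := by
  have := h.comp s (Real.hasDerivAt_sqrt hs.ne')
  rwa [mul_one_div] at this

lemma contDiffOn_comp_sqrt {F : ℝ → ℝ} {c : ℝ} (hF : ContDiffOn ℝ ∞ F (Ioi c)) {I : Set ℝ}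
    (hI : ∀ s ∈ I, 0 < s ∧ c < √s) : ContDiffOn ℝ ∞ (fun s => F √s) I :=
  hF.comp (contDiffOn_id.sqrt fun s hs => (hI s hs).1.ne') fun s hs => (hI s hs).2

/-- For Ω = 1 the radial equation determines F'² up to the sign ε of the last direction, and
positivity of F'² forces ε = -1. -/
lemma eh_isometric (ha : 0 < a) : ∃ F : ℝ → ℝ,
    (∀ r, a < r → HasDerivAt F
      (√3 * a ^ 2 / (2 * r ^ 2) * √((3 * r ^ 4 + a ^ 4) / (r ^ 4 - a ^ 4))) r) ∧
    IsIsometricEmbeddingOn (r := 7) (s := 1) (ehMetric a) {z : ℂ × ℂ | a < rad z}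
      (fun z => (radial7 (√(rad z ^ 4 - a ^ 4) / rad z) (a ^ 2 / (2 * rad z)) z,
        ![F (rad z)])) := by
  have hq : ∀ r, a < r → 0 < r ∧ 0 < r ^ 4 - a ^ 4 := fun r hr =>
    ⟨by linarith, sub_pos.2 (pow_lt_pow_left₀ hr ha.le (by norm_num))⟩
  obtain ⟨F, hF, hFs⟩ := exists_antideriv (c := a)
    (φ := fun r => √3 * a ^ 2 / (2 * r ^ 2) * √((3 * r ^ 4 + a ^ 4) / (r ^ 4 - a ^ 4))) (by
      refine ContDiffOn.mul (ContDiffOn.div (by fun_prop) (by fun_prop) fun r hr => ?_)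
        (ContDiffOn.sqrt (ContDiffOn.div (by fun_prop) (by fun_prop) fun r hr => ?_) fun r hr => ?_)
      · have := (hq r hr).1; positivity
      · exact (hq r hr).2.ne'
      · obtain ⟨h1, h2⟩ := hq r hr
        positivity)
  refine ⟨F, hF, ?_⟩
  have hI : ∀ s ∈ Ioi (a ^ 2), 0 < s ∧ a < √s := fun s hs =>
    ⟨(sq_pos_of_sq_lt ha hs).1, (Real.lt_sqrt ha.le).2 hs⟩
  have key := eh_radialMap ha (T := toR71) (π := ContinuousLinearMap.fst ℝ _ _) (ε := -1)
    (fun x => by rw [← Prod.mk.eta (p := x), toR71_apply]; rfl) eta_toR71 (I := Ioi (a ^ 2))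
    isOpen_Ioi (fun s hs => hs) (Ω := fun _ => 1) (F := fun s => F √s) (l := fun _ => 0)
    contDiffOn_const (contDiffOn_comp_sqrt hFs hI) (fun _ _ => one_pos)
    (fun s _ => by simpa using hasDerivAt_const s (1 : ℝ))
    (fun s hs => hasDerivAt_comp_sqrt (hI s hs).1 (hF _ (hI s hs).2)) (fun s hs => by
      obtain ⟨h1, h2⟩ := sq_pos_of_sq_lt ha hs
      have e4 : √s ^ 4 = s ^ 2 := by
        rw [show √s ^ 4 = (√s ^ 2) ^ 2 by ring, Real.sq_sqrt h1.le]
      simp only [e4, div_pow, mul_pow, Real.sq_sqrt h1.le, Real.sq_sqrt (zero_le_three (α := ℝ))]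
      rw [Real.sq_sqrt (by positivity)]
      field_simp
      ring)
  have hU : {z : ℂ × ℂ | a < rad z} = {z | normSq z ∈ Ioi (a ^ 2)} := by
    ext z; exact Real.lt_sqrt ha.le
  unfold IsIsometricEmbeddingOn
  rw [hU]
  refine key.congr (isOpen_Ioi.preimage contDiff_normSq.continuous) (fun z hz => ?_)
    fun _ _ => rfl
  obtain ⟨h1, h2⟩ := sq_pos_of_sq_lt ha hz
  have hr : 0 < rad z := Real.sqrt_pos.2 h1
  rw [radialMap, toR71_apply, radial7_eq_core7]
  have e1 : √(rad z ^ 4 - a ^ 4) / rad z / rad z = 1 * √(ehc a (normSq z)) := by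
    rw [one_mul, ehc, rad_pow_four, div_div, ← pow_two, rad_sq]
    refine eq_sqrt_of_sq (by positivity) ?_
    rw [div_pow, Real.sq_sqrt h2.le]
  have e2 : a ^ 2 / (2 * rad z) / normSq z = 1 * √(ehb a (normSq z)) := by
    rw [one_mul, ehb]
    refine eq_sqrt_of_sq (by positivity) ?_
    rw [div_pow, div_pow, mul_pow, rad_sq]
    field_simp
    ring
  rw [e1, e2]
  rfl

/-- Without F the radial equation is a quadratic for Ω'/Ω. For r > a its discriminant is
non-negative exactly when 4r⁴ ≥ 7a⁴, which accounts for the restricted domain. -/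
lemma eh_conformal (ha : 0 < a) (ε : ℝ) (hε : ε = 1 ∨ ε = -1) : ∃ Ω : ℝ → ℝ,
    (∀ r, 0 < r → 7 * a ^ 4 < 4 * r ^ 4 → HasDerivAt Ω
      (Ω r * ((3 * a ^ 4 + 4 * r ^ 4
          + ε * (2 * r ^ 4 * √((7 * a ^ 4 - 4 * r ^ 4) / (a ^ 4 - r ^ 4))))
        / (r * (3 * a ^ 4 - 4 * r ^ 4)))) r) ∧
    IsConformalEmbeddingOn (r := 7) (s := 0) (ehMetric a) (fun z => Ω (rad z))
      {z : ℂ × ℂ | 7 * a ^ 4 < 4 * rad z ^ 4}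
      (fun z => (radial7 (2 * Ω (rad z) * √(ehC a (rad z)))
        (Ω (rad z) * √(ehB (rad z) - ehC a (rad z))) z, ![])) := by
  have ha4 := pow_pos ha 4
  obtain ⟨r₀, hr0, hr4⟩ : ∃ r₀ : ℝ, 0 < r₀ ∧ 4 * r₀ ^ 4 = 7 * a ^ 4 := by
    refine ⟨√√(7 * a ^ 4 / 4), by positivity, ?_⟩
    rw [show √√(7 * a ^ 4 / 4) ^ 4 = (√√(7 * a ^ 4 / 4) ^ 2) ^ 2 by ring,
      Real.sq_sqrt (by positivity), Real.sq_sqrt (by positivity)]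
    ring
  have hlt : ∀ r, 0 < r → 7 * a ^ 4 < 4 * r ^ 4 → r₀ < r := fun r hr h =>
    lt_of_pow_lt_pow_left₀ 4 hr.le (by linarith)
  have hgt : ∀ r ∈ Ioi r₀, 0 < r ∧ 7 * a ^ 4 < 4 * r ^ 4 := fun r hr =>
    ⟨hr0.trans hr, by have := pow_lt_pow_left₀ hr hr0.le (show 4 ≠ 0 by norm_num); linarith⟩
  obtain ⟨Ω, hΩ0, hΩ, hΩs⟩ := exists_log_antideriv (c := r₀)
    (φ := fun r => (3 * a ^ 4 + 4 * r ^ 4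
          + ε * (2 * r ^ 4 * √((7 * a ^ 4 - 4 * r ^ 4) / (a ^ 4 - r ^ 4))))
        / (r * (3 * a ^ 4 - 4 * r ^ 4))) (by
      refine ContDiffOn.div (ContDiffOn.add (by fun_prop) (contDiffOn_const.mul (ContDiffOn.mul
        (by fun_prop) (ContDiffOn.sqrt (ContDiffOn.div (by fun_prop) (by fun_prop)
          fun r hr => ?_) fun r hr => ?_)))) (by fun_prop) fun r hr => ?_
      · have := (hgt r hr).2
        exact ne_of_lt (by linarith)
      · have := (hgt r hr).2
        exact (div_pos_of_neg_of_neg (by linarith) (by linarith)).ne'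
      · obtain ⟨h1, h2⟩ := hgt r hr
        exact mul_ne_zero h1.ne' (ne_of_lt (by linarith)))
  refine ⟨Ω, fun r h1 h2 => hΩ r (hlt r h1 h2), ?_⟩
  set I : Set ℝ := {s | 0 < s ∧ 7 * a ^ 4 < 4 * s ^ 2} with hIdef
  have e4 : ∀ s : ℝ, 0 < s → √s ^ 4 = s ^ 2 := fun s h1 => by
    rw [show √s ^ 4 = (√s ^ 2) ^ 2 by ring, Real.sq_sqrt h1.le]
  have hI : ∀ s ∈ I, 0 < s ∧ r₀ < √s := fun s hs =>
    ⟨hs.1, hlt _ (Real.sqrt_pos.2 hs.1) (by rw [e4 s hs.1]; exact hs.2)⟩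
  have hIo : IsOpen I := (isOpen_lt continuous_const continuous_id).inter
    (isOpen_lt continuous_const (continuous_const.mul (continuous_pow 2)))
  have hIa : ∀ s ∈ I, a ^ 2 < s := fun s hs =>
    lt_of_pow_lt_pow_left₀ 2 hs.1.le (by have := hs.2; nlinarith)
  have key := eh_radialMap ha (T := toR70) (π := ContinuousLinearMap.fst ℝ _ _) (ε := 0)
    (fun x => by rw [← Prod.mk.eta (p := x), toR70_apply]; rfl) eta_toR70
    hIo hIa (Ω := fun s => Ω √s) (F := fun _ => 0) (F' := fun _ => 0)
    (l := fun s => (3 * a ^ 4 + 4 * s ^ 2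
          + ε * (2 * s ^ 2 * √((7 * a ^ 4 - 4 * s ^ 2) / (a ^ 4 - s ^ 2))))
        / (2 * s * (3 * a ^ 4 - 4 * s ^ 2)))
    (contDiffOn_comp_sqrt hΩs hI) contDiffOn_const (fun s _ => hΩ0 _)
    -- The equation is posed in s = r², so the rate in r is divided by 2√s.
    (fun s hs => by
      convert hasDerivAt_comp_sqrt (hI s hs).1 (hΩ _ (hI s hs).2) using 1
      rw [e4 s hs.1]
      have h1 := Real.sqrt_pos.2 hs.1
      conv_lhs => rw [← Real.sq_sqrt hs.1.le]
      rw [Real.sqrt_sq h1.le]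
      have h2 : 3 * a ^ 4 - 4 * s ^ 2 ≠ 0 := ne_of_lt (by linarith [hs.2])
      rw [show (√s ^ 2) ^ 2 = s ^ 2 by rw [Real.sq_sqrt hs.1.le]]
      field_simp)
    (fun s _ => hasDerivAt_const s (0 : ℝ)) (fun s hs => by
      obtain ⟨h1, h2⟩ := hs
      have h3 : 3 * a ^ 4 - 4 * s ^ 2 ≠ 0 := ne_of_lt (by linarith)
      have h4 : a ^ 4 - s ^ 2 ≠ 0 := ne_of_lt (by linarith)
      have ht := Real.sq_sqrt (show 0 ≤ (7 * a ^ 4 - 4 * s ^ 2) / (a ^ 4 - s ^ 2) from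
        (div_pos_of_neg_of_neg (by linarith) (by linarith)).le)
      have hε2 : ε ^ 2 = 1 := by rcases hε with rfl | rfl <;> norm_num
      generalize √((7 * a ^ 4 - 4 * s ^ 2) / (a ^ 4 - s ^ 2)) = t at *
      have ht' : t ^ 2 * (a ^ 4 - s ^ 2) = 7 * a ^ 4 - 4 * s ^ 2 := by rw [ht]; field_simp
      have hl : (3 * a ^ 4 + 4 * s ^ 2 + ε * (2 * s ^ 2 * t)) / (2 * s * (3 * a ^ 4 - 4 * s ^ 2))
          * (2 * s * (3 * a ^ 4 - 4 * s ^ 2)) = 3 * a ^ 4 + 4 * s ^ 2 + ε * (2 * s ^ 2 * t) :=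
        div_mul_cancel₀ _ (mul_ne_zero (by positivity) h3)
      generalize (3 * a ^ 4 + 4 * s ^ 2 + ε * (2 * s ^ 2 * t))
        / (2 * s * (3 * a ^ 4 - 4 * s ^ 2)) = l at *
      -- The quadratic in l has 3a⁴ - 4s² as a factor of its leading coefficient; multiplying by it
      -- once more makes l occur only through 2s(3a⁴ - 4s²)l and completes the square.
      refine mul_left_cancel₀ h3 ?_
      rw [mul_zero, zero_mul, zero_div]
      linear_combination ((s ^ 2 - a ^ 4) * (2 * (4 * s ^ 2 + 3 * a ^ 4)
        - l * (2 * s * (3 * a ^ 4 - 4 * s ^ 2)) - (3 * a ^ 4 + 4 * s ^ 2 + ε * (2 * s ^ 2 * t)))) * hl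
        - 4 * (s ^ 2 - a ^ 4) * t ^ 2 * s ^ 4 * hε2 + 4 * s ^ 4 * ht')
  have hU : {z : ℂ × ℂ | 7 * a ^ 4 < 4 * rad z ^ 4} = {z | normSq z ∈ I} := by
    ext z
    simp only [mem_ofPred_eq, hIdef, rad_pow_four]
    refine ⟨fun h => ⟨(normSq_nonneg z).lt_of_ne fun h0 => ?_, h⟩, fun h => h.2⟩
    rw [← h0] at h
    linarith
  rw [hU]
  refine key.congr (hIo.preimage contDiff_normSq.continuous) (fun z hz => ?_)
    fun _ _ => rfl
  obtain ⟨h1, h2⟩ := sq_pos_of_sq_lt ha (hIa _ hz)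
  have hr : 0 < rad z := Real.sqrt_pos.2 h1
  rw [radialMap, toR70_apply, radial7_eq_core7]
  have e1 : 2 * Ω (rad z) * √(ehC a (rad z)) / rad z
      = Ω √(normSq z) * √(ehc a (normSq z)) := by
    have : 2 * √(ehC a (rad z)) / rad z = √(ehc a (normSq z)) := by
      refine eq_sqrt_of_sq (by positivity) ?_
      have h0 : 0 ≤ ehC a (rad z) := by
        rw [show ehC a (rad z) = (normSq z ^ 2 - a ^ 4) / (4 * normSq z) by
          rw [ehC, rad_pow_four, rad_sq]; field_simp]
        positivity
      rw [div_pow, mul_pow, Real.sq_sqrt h0, ehC, ehc, rad_pow_four, rad_sq]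
      field_simp
      ring
    rw [← this, rad]; ring
  have e2 : Ω (rad z) * √(ehB (rad z) - ehC a (rad z)) / normSq z
      = Ω √(normSq z) * √(ehb a (normSq z)) := by
    have : √(ehB (rad z) - ehC a (rad z)) / normSq z = √(ehb a (normSq z)) := by
      have h0 : ehB (rad z) - ehC a (rad z) = a ^ 4 / (4 * normSq z) := by
        rw [ehB, ehC, rad_pow_four, rad_sq]; field_simp; ring
      refine eq_sqrt_of_sq (by positivity) ?_
      rw [h0, div_pow, Real.sq_sqrt (by positivity), ehb]
      field_simp
    rw [← this, rad]; ring
  rw [e1, e2]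

end EHExplicit

/-! ### Embedding classes from embeddings and from non-existence -/

section Classes

variable {E : Type*} [NormedAddCommGroup E] [NormedSpace ℝ E]
  {M : Type*} [TopologicalSpace M] [ChartedSpace E M]
  {g : ∀ x : M, TangentSpace 𝓘(ℝ, E) x → TangentSpace 𝓘(ℝ, E) x → ℝ} {U : Set M}

lemma finrank_complex_prod : Module.finrank ℝ (ℂ × ℂ) = 4 := by
  rw [Module.finrank_prod, Complex.finrank_real_complex]

lemma isometricClass_le {r s n : ℕ} {f : M → PseudoEuclid r s}
    (hrs : r + s = Module.finrank ℝ E + n) (h : IsIsometricEmbeddingOn g U f) :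
    isometricClass g U ≤ n :=
  sInf_le ⟨n, r, s, rfl, hrs, f, h⟩

lemma conformalClass_le {r s n : ℕ} {f : M → PseudoEuclid r s} {Ω : M → ℝ}
    (hrs : r + s = Module.finrank ℝ E + n) (h : IsConformalEmbeddingOn g Ω U f) :
    conformalClass g U ≤ n :=
  sInf_le ⟨n, r, s, rfl, hrs, f, Ω, h⟩

lemma three_le_isometricClass (hE : Module.finrank ℝ E = 4)
    (h : ∀ r s : ℕ, r + s ≤ 6 → ∀ f : M → PseudoEuclid r s, ¬ IsIsometricEmbeddingOn g U f) :
    3 ≤ isometricClass g U := by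
  refine le_sInf ?_
  rintro _ ⟨n, r, s, rfl, hrs, f, hf⟩
  by_contra! hn
  have hn' : n < 3 := by exact_mod_cast hn
  exact h r s (by omega) f hf

end Classes

/-! ### The lower bound for the Eguchi-Hanson class -/

section EHClasses

variable {a : ℝ}

lemma eh_three_le_isometricClass (ha : 0 < a) {U : Set (ℂ × ℂ)} (hU : IsOpen U)
    (hne : U.Nonempty) (hUa : U ⊆ {z | a < rad z}) : 3 ≤ isometricClass (ehMetric a) U := by
  refine three_le_isometricClass finrank_complex_prod fun r s hrs f hf => ?_
  refine eh_no_immersion ha hrs hU hne (fun z hz => ?_) (contMDiffOn_iff_contDiffOn.1 hf.1)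
    fun z hz u v => ?_
  · rw [← rad_pow_four]
    exact pow_lt_pow_left₀ (hUa hz) ha.le (by norm_num)
  · have := hf.4 z hz u v
    rw [mfderiv_eq_fderiv, one_pow, one_mul] at this
    exact this

end EHClasses

/-! ## The Taub--NUT metric: explicit embeddings -/

section TN

variable {m : ℝ}

/-- The function `4 C / s` of the Taub--NUT metric. -/
def tnc (m s : ℝ) : ℝ := 4 * m ^ 2 / (s + 2 * m)
/-- The function `(B - C) / s²` of the Taub--NUT metric. -/
def tnb (m s : ℝ) : ℝ := (s + 4 * m) / (4 * (s + 2 * m))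

lemma hasDerivAt_tnc {s : ℝ} (hs : s + 2 * m ≠ 0) :
    HasDerivAt (tnc m) (-4 * m ^ 2 / (s + 2 * m) ^ 2) s := by
  have h : HasDerivAt (tnc m) _ s :=
    (hasDerivAt_const s (4 * m ^ 2)).div ((hasDerivAt_id s).add_const (2 * m)) hs
  convert h using 1
  simp

lemma hasDerivAt_tnb {s : ℝ} (hs : s + 2 * m ≠ 0) :
    HasDerivAt (tnb m) (-m / (2 * (s + 2 * m) ^ 2)) s := by
  have h : HasDerivAt (tnb m) _ s :=
    ((hasDerivAt_id s).add_const (4 * m)).div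
      (((hasDerivAt_id s).add_const (2 * m)).const_mul 4) (mul_ne_zero four_ne_zero hs)
  convert h using 1
  simp only [id]
  field_simp
  ring

lemma tnMetric_radial_form (hm : 0 < m) (z u v : ℂ × ℂ) :
    tnMetric m z u v = (tnc m (normSq z) + 4 * normSq z * tnb m (normSq z)) * (herm u v).re
      - 4 * tnb m (normSq z) * ((herm z u).im * (herm z v).im)
      + 0 * ((herm z u).re * (herm z v).re) := by
  have := normSq_nonneg z
  have hD : normSq z + 2 * m ≠ 0 := by positivity
  simp only [tnMetric, tnc, tnb]
  field_simp
  ring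

/-- Radial conformally isometric embeddings of the Taub--NUT metric. -/
lemma tn_radialMap (hm : 0 < m) {r k : ℕ} {T : (Fin 7 → ℝ) × ℝ →L[ℝ] PseudoEuclid r k}
    {π : PseudoEuclid r k →L[ℝ] (Fin 7 → ℝ)} {ε : ℝ} (hπ : ∀ x, π (T x) = x.1)
    (hT : ∀ x y, eta (T x) (T y) = ∑ i, x.1 i * y.1 i + ε * (x.2 * y.2))
    {I : Set ℝ} (hI : IsOpen I) (hIa : ∀ s ∈ I, -m < s) {Ω F l F' : ℝ → ℝ}
    (hΩ : ContDiffOn ℝ ∞ Ω I) (hF : ContDiffOn ℝ ∞ F I) (hΩ0 : ∀ s ∈ I, 0 < Ω s)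
    (hΩ' : ∀ s ∈ I, HasDerivAt Ω (Ω s * l s) s) (hF' : ∀ s ∈ I, HasDerivAt F (F' s) s)
    (hγ : ∀ s ∈ I, 8 * m ^ 2 * (2 * l s * (s + 2 * m) - 1) * (s + 2 * m) * (s + 4 * m)
      + 4 * m ^ 2 * s * (2 * l s * (s + 2 * m) - 1) ^ 2 * (s + 4 * m)
      + 2 * s * (l s * (s + 4 * m) * (s + 2 * m) - m) * (s + 2 * m) * (s + 4 * m)
      + s ^ 2 * (l s * (s + 4 * m) * (s + 2 * m) - m) ^ 2
      + 4 * ε * F' s ^ 2 / Ω s ^ 2 * ((s + 2 * m) ^ 3 * (s + 4 * m)) = 0)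
    {U : Set (ℂ × ℂ)} (hUI : ∀ z ∈ U, normSq z ∈ I)
    {N : Set ℝ} (hN : N.OrdConnected) (hUN : ∀ z ∈ U, normSq z ∈ N) {χ : ℝ → ℝ}
    (hχ : StrictMonoOn χ N) {Φ : (Fin 7 → ℝ) → ℝ}
    (hΦ : ∀ z ∈ U, ∀ x, x = core7 (Ω (normSq z) * √(tnc m (normSq z)))
      (Ω (normSq z) * √(tnb m (normSq z))) z → ContinuousAt Φ x ∧ Φ x = χ (normSq z)) :
    IsConformalEmbeddingOn (r := r) (s := k) (tnMetric m) (fun z => Ω (normSq z)) U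
      (radialMap T Ω (tnc m) (tnb m) F) := by
  have hD : ∀ s ∈ I, 0 < s + 2 * m := fun s hs => by linarith [hIa s hs]
  have he : ∀ s ∈ I, 0 < s + 4 * m := fun s hs => by linarith [hIa s hs]
  refine radialMap_isConformalEmbeddingOn hπ hT hI hΩ ?_ ?_ hF hΩ0 ?_ ?_ hUI hΩ'
    (fun s hs => hasDerivAt_tnc (hD s hs).ne') (fun s hs => hasDerivAt_tnb (hD s hs).ne') hF'
    (γ := fun s => 0) ?_ (fun z _ u v => tnMetric_radial_form hm z u v) hN hUN hχ hΦ
  · exact ContDiffOn.div (by fun_prop) (by fun_prop) fun s hs => (hD s hs).ne'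
  · refine ContDiffOn.div (by fun_prop) (by fun_prop) fun s hs => ?_
    have := hD s hs; positivity
  · intro s hs
    have := hD s hs
    unfold tnc; positivity
  · intro s hs
    have := hD s hs
    have := he s hs
    unfold tnb; positivity
  · intro s hs
    have h1 := hD s hs
    have h2 := he s hs
    have h3 := hΩ0 s hs
    have h := hγ s hs
    refine (mul_eq_zero_iff_left (show (s + 2 * m) ^ 3 * (s + 4 * m) ≠ 0 by positivity)).1 ?_
    rw [← h]
    simp only [tnc, tnb]
    generalize s + 2 * m = D at *
    generalize s + 4 * m = e at *
    field_simp
    ring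

/-- Identifies the profiles √C and √(B - C) of the statement with `tnc` and `tnb`, which stay smooth
and positive across s = 0. -/
lemma tn_sqrt_core (hm : 0 < m) {z : ℂ × ℂ} (hz : z ≠ 0) :
    2 * √(tnC m (tnR m z)) / rad z = √(tnc m (normSq z)) ∧
      √(tnB m (tnR m z) - tnC m (tnR m z)) / normSq z = √(tnb m (normSq z)) := by
  have hs := normSq_pos hz
  have hr : 0 < rad z := Real.sqrt_pos.2 hs
  have e1 : tnC m (tnR m z) = m ^ 2 * (normSq z / (normSq z + 2 * m)) := by
    rw [tnC, tnR]; ring_nf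
  have e2 : tnB m (tnR m z) - tnC m (tnR m z)
      = normSq z ^ 2 * ((normSq z + 4 * m) / (4 * (normSq z + 2 * m))) := by
    rw [e1, tnB, tnR]; field_simp; ring
  constructor
  · refine eq_sqrt_of_sq (by positivity) ?_
    rw [e1, div_pow, mul_pow, Real.sq_sqrt (by positivity), rad_sq, tnc]
    field_simp
    ring
  · refine eq_sqrt_of_sq (by positivity) ?_
    rw [e2, div_pow, Real.sq_sqrt (by positivity), tnb]
    field_simp

/-- The function is R². It replaces the ratio Z²/R² as the quantity recovering s when the nut is
included, for there R and Z both vanish; the price is that Ω must not decrease. -/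
lemma tn_monotone (hm : 0 < m) {Ω : ℝ → ℝ} (hΩ0 : ∀ s, 0 < Ω s) (hΩ : MonotoneOn Ω (Ici 0)) :
    StrictMonoOn (fun s => Ω s ^ 2 * (4 * m ^ 2 - 8 * m ^ 3 / (s + 2 * m))) (Ici 0) := by
  intro s hs t ht hst
  have hs' : 0 ≤ s := hs
  have h1 : Ω s ^ 2 ≤ Ω t ^ 2 := pow_le_pow_left₀ (hΩ0 s).le (hΩ hs ht hst.le) 2
  have h2 : 8 * m ^ 3 / (t + 2 * m) < 8 * m ^ 3 / (s + 2 * m) := by gcongr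
  have h3 : 0 ≤ 4 * m ^ 2 - 8 * m ^ 3 / (s + 2 * m) := by
    rw [sub_nonneg, div_le_iff₀ (by positivity)]
    nlinarith [mul_nonneg hs' (sq_nonneg m)]
  have h4 := hΩ0 t
  exact mul_lt_mul_of_le_of_lt_of_nonneg_of_pos h1 (by linarith) h3 (by positivity)

lemma sqNorm4_tn (hm : 0 < m) {Ω : ℝ → ℝ} {q : ℝ} (z : ℂ × ℂ) :
    sqNorm4 (core7 (Ω (normSq z) * √(tnc m (normSq z))) q z)
      = Ω (normSq z) ^ 2 * (4 * m ^ 2 - 8 * m ^ 3 / (normSq z + 2 * m)) := by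
  have := normSq_nonneg z
  rw [sqNorm4_core7, mul_sqrt_sq (by unfold tnc; positivity), tnc]
  field_simp
  ring

/-- For Ω = 1 the radial equation gives F'² > 0 with a positive eighth direction, and F' is smooth
on all of r > 0. -/
lemma tn_isometric (hm : 0 < m) : ∃ (F : ℝ → ℝ) (f : ℂ × ℂ → PseudoEuclid 8 0),
    (∀ r, m < r → HasDerivAt F
      (√((2 * m * r ^ 3 + 9 * m ^ 2 * r ^ 2 + 24 * m ^ 3 * r + 29 * m ^ 4)
        / (4 * (r + m) ^ 3 * (r + 3 * m)))) r) ∧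
    IsIsometricEmbeddingOn (tnMetric m) univ f ∧
    ∀ z : ℂ × ℂ, z ≠ 0 → f z =
      (radial8 (2 * m * √((tnR m z - m) / (tnR m z + m)))
        ((tnR m z - m) / 2 * √((tnR m z + 3 * m) / (tnR m z + m))) (F (tnR m z)) z, ![]) := by
  have hq : ∀ r, 0 < r → 0 < (2 * m * r ^ 3 + 9 * m ^ 2 * r ^ 2 + 24 * m ^ 3 * r + 29 * m ^ 4)
        / (4 * (r + m) ^ 3 * (r + 3 * m)) := fun r hr => by positivity
  -- Integrating on r > 0 rather than r > m makes F smooth in a neighbourhood of the nut r = m.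
  obtain ⟨F, hF, hFs⟩ := exists_antideriv (c := 0)
    (φ := fun r => √((2 * m * r ^ 3 + 9 * m ^ 2 * r ^ 2 + 24 * m ^ 3 * r + 29 * m ^ 4)
        / (4 * (r + m) ^ 3 * (r + 3 * m)))) (by
      refine ContDiffOn.sqrt (ContDiffOn.div (by fun_prop) (by fun_prop) fun r hr => ?_)
        fun r hr => (hq r hr).ne'
      have hr' : 0 < r := hr
      positivity)
  have hI : ∀ s ∈ Ioi (-m), 0 < m + s := fun s hs => by linarith [show -m < s from hs]
  refine ⟨F, radialMap toR80 (fun _ => 1) (tnc m) (tnb m) (fun s => F (m + s)),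
    fun r hr => hF r (hm.trans hr), ?_, ?_⟩
  · refine tn_radialMap hm (π := fromR80) fromR80_toR80 eta_toR80 (I := Ioi (-m)) isOpen_Ioi
      (fun s hs => hs) (l := fun _ => 0) contDiffOn_const (hFs.comp (by fun_prop) hI)
      (fun _ _ => one_pos) (fun s _ => by simpa using hasDerivAt_const s (1 : ℝ))
      (fun s hs => (hF _ (hI s hs)).comp_const_add m s) (fun s hs => ?_)
      (fun z _ => by have := normSq_nonneg z; exact lt_of_lt_of_le (by linarith) this)
      ordConnected_Ici (fun z _ => normSq_nonneg z)
      (tn_monotone hm (Ω := fun _ => 1) (fun _ => one_pos) monotoneOn_const) (Φ := sqNorm4) ?_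
    · have h1 := hI s hs
      rw [Real.sq_sqrt (hq _ h1).le]
      have e1 : m + s + m = s + 2 * m := by ring
      have e2 : m + s + 3 * m = s + 4 * m := by ring
      have h2 : 0 < s + 2 * m := by linarith
      have h3 : 0 < s + 4 * m := by linarith
      rw [e1, e2]
      have h4 := div_mul_cancel₀ (2 * m * (m + s) ^ 3 + 9 * m ^ 2 * (m + s) ^ 2
        + 24 * m ^ 3 * (m + s) + 29 * m ^ 4)
        (show 4 * (s + 2 * m) ^ 3 * (s + 4 * m) ≠ 0 by positivity)
      generalize (2 * m * (m + s) ^ 3 + 9 * m ^ 2 * (m + s) ^ 2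
        + 24 * m ^ 3 * (m + s) + 29 * m ^ 4) / (4 * (s + 2 * m) ^ 3 * (s + 4 * m)) = y at *
      rw [one_pow, div_one]
      linear_combination h4
    · rintro z - x rfl
      exact ⟨continuous_sqNorm4.continuousAt, sqNorm4_tn hm (Ω := fun _ => 1) z⟩
  · intro z hz
    have hs := normSq_pos hz
    have hr : 0 < rad z := Real.sqrt_pos.2 hs
    rw [radialMap, toR80_apply, radial8, radial7_eq_core7]
    have e1 : 2 * m * √((tnR m z - m) / (tnR m z + m)) / rad z = 1 * √(tnc m (normSq z)) := by
      rw [one_mul, tnR, tnc]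
      refine eq_sqrt_of_sq (by positivity) ?_
      rw [show (m + normSq z - m) / (m + normSq z + m) = normSq z / (normSq z + 2 * m) by ring_nf,
        div_pow, mul_pow, Real.sq_sqrt (by positivity), rad_sq]
      field_simp
      ring
    have e2 : (tnR m z - m) / 2 * √((tnR m z + 3 * m) / (tnR m z + m)) / normSq z
        = 1 * √(tnb m (normSq z)) := by
      rw [one_mul, tnR, tnb]
      rw [show (m + normSq z + 3 * m) / (m + normSq z + m)
        = (normSq z + 4 * m) / (normSq z + 2 * m) by ring_nf, add_sub_cancel_left]
      refine eq_sqrt_of_sq (by positivity) ?_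
      rw [div_pow, mul_pow, Real.sq_sqrt (by positivity)]
      field_simp
      ring
    rw [e1, e2]
    rfl

/-- The sign + selects the root of the radial quadratic that has a pole at r = m. Away from the nut
the ratio of the norms recovers s. -/
lemma tn_conformal_of_ne (hm : 0 < m) : ∃ (Ω : ℝ → ℝ) (f : ℂ × ℂ → PseudoEuclid 7 0),
    (∀ r, m < r → HasDerivAt Ω
      (Ω r * (((3 * m + r) * (4 * m ^ 2 - m * r + r ^ 2)
          + 1 * ((r + m) ^ 2 * √((55 * m ^ 3 + 3 * m ^ 2 * r + 5 * m * r ^ 2 + r ^ 3)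
            / (3 * m + r))))
        / ((m ^ 2 - r ^ 2) * (13 * m ^ 2 + 2 * m * r + r ^ 2)))) r) ∧
    IsConformalEmbeddingOn (tnMetric m) (fun z => Ω (tnR m z)) {z : ℂ × ℂ | z ≠ 0} f ∧
    ∀ z : ℂ × ℂ, z ≠ 0 → f z =
      (radial7 (2 * Ω (tnR m z) * √(tnC m (tnR m z)))
        (Ω (tnR m z) * √(tnB m (tnR m z) - tnC m (tnR m z))) z, ![]) := by
  have hq : ∀ r, m < r → 0 < (55 * m ^ 3 + 3 * m ^ 2 * r + 5 * m * r ^ 2 + r ^ 3)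
      / (3 * m + r) := fun r hr => by have := hm.trans hr; positivity
  have hk : ∀ r, m < r → (m ^ 2 - r ^ 2) * (13 * m ^ 2 + 2 * m * r + r ^ 2) ≠ 0 := fun r hr => by
    have := hm.trans hr
    refine mul_ne_zero (ne_of_lt ?_) (by positivity)
    have := pow_lt_pow_left₀ hr hm.le two_ne_zero
    linarith
  obtain ⟨Ω, hΩ0, hΩ, hΩs⟩ := exists_log_antideriv (c := m)
    (φ := fun r => (((3 * m + r) * (4 * m ^ 2 - m * r + r ^ 2)
          + 1 * ((r + m) ^ 2 * √((55 * m ^ 3 + 3 * m ^ 2 * r + 5 * m * r ^ 2 + r ^ 3)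
            / (3 * m + r))))
        / ((m ^ 2 - r ^ 2) * (13 * m ^ 2 + 2 * m * r + r ^ 2)))) (by
      refine ContDiffOn.div (ContDiffOn.add (by fun_prop) (contDiffOn_const.mul (ContDiffOn.mul
        (by fun_prop) (ContDiffOn.sqrt (ContDiffOn.div (by fun_prop) (by fun_prop)
          fun r hr => ?_) fun r hr => (hq r hr).ne')))) (by fun_prop) fun r hr => hk r hr
      have : m < r := hr
      have := hm.trans this
      positivity)
  have hI : ∀ s ∈ Ioi (0 : ℝ), m < m + s := fun s hs => by linarith [show 0 < s from hs]
  refine ⟨Ω, radialMap toR70 (fun s => Ω (m + s)) (tnc m) (tnb m) (fun _ => 0), hΩ, ?_, ?_⟩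
  · refine tn_radialMap hm (ε := 0) (π := ContinuousLinearMap.fst ℝ _ _)
      (fun x => by rw [← Prod.mk.eta (p := x), toR70_apply]; rfl) eta_toR70 (I := Ioi 0) isOpen_Ioi
      (fun s hs => (neg_lt_zero.2 hm).trans hs) (Ω := fun s => Ω (m + s)) (F' := fun _ => 0)
      (hΩs.comp (by fun_prop) hI) contDiffOn_const (fun _ _ => hΩ0 _)
      (fun s hs => (hΩ _ (hI s hs)).comp_const_add m s) (fun s _ => hasDerivAt_const s (0 : ℝ))
      (fun s hs => ?_)
      (fun z hz => normSq_pos hz) ordConnected_Ioi (fun z hz => normSq_pos hz)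
      (χ := fun s => s * (s + 4 * m) / (16 * m ^ 2)) (Φ := fun x => sqNorm3 x / sqNorm4 x) ?_ ?_
    · have h1 := hI s hs
      have hs' : 0 < s := hs
      have ht := Real.sq_sqrt (hq _ h1).le
      have hl := div_mul_cancel₀ ((3 * m + (m + s)) * (4 * m ^ 2 - m * (m + s) + (m + s) ^ 2)
          + 1 * ((m + s + m) ^ 2 * √((55 * m ^ 3 + 3 * m ^ 2 * (m + s) + 5 * m * (m + s) ^ 2
            + (m + s) ^ 3) / (3 * m + (m + s))))) (hk _ h1)
      generalize √((55 * m ^ 3 + 3 * m ^ 2 * (m + s) + 5 * m * (m + s) ^ 2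
            + (m + s) ^ 3) / (3 * m + (m + s))) = t at *
      generalize ((3 * m + (m + s)) * (4 * m ^ 2 - m * (m + s) + (m + s) ^ 2)
          + 1 * ((m + s + m) ^ 2 * t))
          / ((m ^ 2 - (m + s) ^ 2) * (13 * m ^ 2 + 2 * m * (m + s) + (m + s) ^ 2)) = l at *
      rw [eq_div_iff (by positivity)] at ht
      -- The leading coefficient of the quadratic is s(s + 2m)²(s + 4m)(s² + 4ms + 16m²), so this
      -- factor completes the square.
      refine mul_left_cancel₀ (show s * (s ^ 2 + 4 * m * s + 16 * m ^ 2) ≠ 0 by positivity) ?_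
      rw [mul_zero (4 : ℝ), zero_mul, zero_div]
      linear_combination ((s + 4 * m) * (l * (s * (s + 2 * m) * (s ^ 2 + 4 * m * s + 16 * m ^ 2))
          + (s + 4 * m) * (4 * m ^ 2 + m * s + s ^ 2) - (s + 2 * m) ^ 2 * t)) * (-hl)
        + (s + 2 * m) ^ 4 * ht
    · intro s hs t ht hst
      have hs' : 0 < s := hs
      simp only
      gcongr
    · intro z hz x hx
      have h1 := normSq_pos hz
      obtain ⟨k1, k2⟩ := continuousAt_ratio34 (hΩ0 _)
        (show 0 < tnc m (normSq z) by unfold tnc; positivity)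
        (show 0 < tnb m (normSq z) by unfold tnb; positivity) h1 hx
      refine ⟨k1, k2.trans ?_⟩
      unfold tnc tnb
      field_simp
      ring
  · intro z hz
    obtain ⟨e1, e2⟩ := tn_sqrt_core hm hz
    rw [radialMap, toR70_apply, radial7_eq_core7, ← e1, ← e2]
    simp only [tnR]
    congr 2 <;> ring

/-- The derivative of the logarithm of the conformal factor which extends over the nut. -/
def tnNutRate (m r : ℝ) : ℝ :=
  m * (2 * r ^ 3 + 9 * m * r ^ 2 + 24 * m ^ 2 * r + 29 * m ^ 3)
    / ((r + m) * (3 * m + r) * ((3 * m + r) * (4 * m ^ 2 - m * r + r ^ 2)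
      + (r + m) ^ 2 * √((55 * m ^ 3 + 3 * m ^ 2 * r + 5 * m * r ^ 2 + r ^ 3) / (3 * m + r))))

lemma tnNutRate_denom_pos (hm : 0 < m) {r : ℝ} (hr : 0 < r) :
    0 < (3 * m + r) * (4 * m ^ 2 - m * r + r ^ 2)
      + (r + m) ^ 2 * √((55 * m ^ 3 + 3 * m ^ 2 * r + 5 * m * r ^ 2 + r ^ 3) / (3 * m + r)) := by
  have h : 0 < 4 * m ^ 2 - m * r + r ^ 2 := by nlinarith [sq_nonneg (m - r), mul_pos hm hr]
  positivity

/-- Multiplying by the conjugate of the numerator cancels the factor vanishing at r = m: the root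
with sign - is regular at the nut, and positive. -/
lemma tnNutRate_eq (hm : 0 < m) {r : ℝ} (hr : m < r) : tnNutRate m r
    = ((3 * m + r) * (4 * m ^ 2 - m * r + r ^ 2)
          + -1 * ((r + m) ^ 2 * √((55 * m ^ 3 + 3 * m ^ 2 * r + 5 * m * r ^ 2 + r ^ 3)
            / (3 * m + r))))
        / ((m ^ 2 - r ^ 2) * (13 * m ^ 2 + 2 * m * r + r ^ 2)) := by
  have h0 := hm.trans hr
  have h1 := tnNutRate_denom_pos hm h0
  have h2 : m ^ 2 - r ^ 2 ≠ 0 :=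
    ne_of_lt (sub_neg.2 (pow_lt_pow_left₀ hr hm.le two_ne_zero))
  have ht := Real.sq_sqrt (show 0 ≤ (55 * m ^ 3 + 3 * m ^ 2 * r + 5 * m * r ^ 2 + r ^ 3)
    / (3 * m + r) by positivity)
  rw [tnNutRate]
  generalize √((55 * m ^ 3 + 3 * m ^ 2 * r + 5 * m * r ^ 2 + r ^ 3) / (3 * m + r)) = t at *
  rw [eq_div_iff (by positivity)] at ht
  rw [div_eq_div_iff (by positivity) (mul_ne_zero h2 (by positivity))]
  linear_combination ((r + m) ^ 5) * ht

lemma tn_conformal_nut (hm : 0 < m) : ∃ (Ω : ℝ → ℝ) (f : ℂ × ℂ → PseudoEuclid 7 0),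
    (∀ r, m < r → HasDerivAt Ω
      (Ω r * (((3 * m + r) * (4 * m ^ 2 - m * r + r ^ 2)
          + -1 * ((r + m) ^ 2 * √((55 * m ^ 3 + 3 * m ^ 2 * r + 5 * m * r ^ 2 + r ^ 3)
            / (3 * m + r))))
        / ((m ^ 2 - r ^ 2) * (13 * m ^ 2 + 2 * m * r + r ^ 2)))) r) ∧
    IsConformalEmbeddingOn (tnMetric m) (fun z => Ω (tnR m z)) univ f ∧
    ∀ z : ℂ × ℂ, z ≠ 0 → f z =
      (radial7 (2 * Ω (tnR m z) * √(tnC m (tnR m z)))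
        (Ω (tnR m z) * √(tnB m (tnR m z) - tnC m (tnR m z))) z, ![]) := by
  have hq : ∀ r, 0 < r → 0 < (55 * m ^ 3 + 3 * m ^ 2 * r + 5 * m * r ^ 2 + r ^ 3)
      / (3 * m + r) := fun r hr => by positivity
  obtain ⟨Ω, hΩ0, hΩ, hΩs⟩ := exists_log_antideriv (c := 0) (φ := tnNutRate m) (by
      refine ContDiffOn.div (by fun_prop) (ContDiffOn.mul (by fun_prop) (ContDiffOn.add
        (by fun_prop) (ContDiffOn.mul (by fun_prop) (ContDiffOn.sqrt (ContDiffOn.div (by fun_prop)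
          (by fun_prop) fun r hr => ?_) fun r hr => (hq r hr).ne')))) fun r hr => ?_
      · have hr' : 0 < r := hr
        positivity
      · have hr' : 0 < r := hr
        have := tnNutRate_denom_pos hm hr'
        positivity)
  have hI : ∀ s ∈ Ioi (-m), 0 < m + s := fun s hs => by linarith [show -m < s from hs]
  -- Positivity of the rationalised rate makes Ω increase, as `tn_monotone` requires.
  have hmono : MonotoneOn (fun s => Ω (m + s)) (Ici 0) := by
    have hpos : ∀ s, 0 ≤ s → 0 < m + s := fun s hs => by linarith
    refine monotoneOn_of_deriv_nonneg (convex_Ici 0) (fun s hs =>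
      (((hΩ _ (hpos s hs)).comp_const_add m s).continuousAt).continuousWithinAt) (fun s hs =>
      ((hΩ _ (hpos s (interior_subset hs))).comp_const_add m
        s).differentiableAt.differentiableWithinAt) fun s hs => ?_
    have h := hpos s (interior_subset hs)
    rw [((hΩ _ h).comp_const_add m s).deriv, tnNutRate]
    have := tnNutRate_denom_pos hm h
    have := hΩ0 (m + s)
    positivity
  refine ⟨Ω, radialMap toR70 (fun s => Ω (m + s)) (tnc m) (tnb m) (fun _ => 0),
    fun r hr => by rw [← tnNutRate_eq hm hr]; exact hΩ r (hm.trans hr), ?_, ?_⟩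
  · refine tn_radialMap hm (ε := 0) (π := ContinuousLinearMap.fst ℝ _ _)
      (fun x => by rw [← Prod.mk.eta (p := x), toR70_apply]; rfl) eta_toR70 (I := Ioi (-m))
      isOpen_Ioi (fun s hs => hs) (Ω := fun s => Ω (m + s)) (F' := fun _ => 0)
      (l := fun s => tnNutRate m (m + s))
      (hΩs.comp (by fun_prop) hI) contDiffOn_const (fun _ _ => hΩ0 _)
      (fun s hs => (hΩ _ (hI s hs)).comp_const_add m s) (fun s _ => hasDerivAt_const s (0 : ℝ))
      (fun s hs => ?_)
      (fun z _ => by have := normSq_nonneg z; exact lt_of_lt_of_le (by linarith) this)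
      ordConnected_Ici (fun z _ => normSq_nonneg z)
      (tn_monotone hm (fun s => hΩ0 _) hmono) (Φ := sqNorm4) ?_
    · have h1 := hI s hs
      have hs' : 0 < m + s := h1
      have ht := Real.sq_sqrt (hq _ h1).le
      have hX := tnNutRate_denom_pos hm h1
      have hl := div_mul_cancel₀
        (m * (2 * (m + s) ^ 3 + 9 * m * (m + s) ^ 2 + 24 * m ^ 2 * (m + s) + 29 * m ^ 3))
        (show (m + s + m) * (3 * m + (m + s)) * ((3 * m + (m + s))
          * (4 * m ^ 2 - m * (m + s) + (m + s) ^ 2)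
          + (m + s + m) ^ 2 * √((55 * m ^ 3 + 3 * m ^ 2 * (m + s) + 5 * m * (m + s) ^ 2
            + (m + s) ^ 3) / (3 * m + (m + s)))) ≠ 0 by positivity)
      rw [← tnNutRate] at hl
      generalize tnNutRate m (m + s) = l at *
      generalize √((55 * m ^ 3 + 3 * m ^ 2 * (m + s) + 5 * m * (m + s) ^ 2
            + (m + s) ^ 3) / (3 * m + (m + s))) = t at *
      rw [eq_div_iff (by positivity)] at ht
      -- The equation must also hold at s = 0, where the multiplier used away from the nut vanishes;
      -- the square of the rationalised denominator serves instead.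
      refine mul_left_cancel₀ (show (3 * m + (m + s)) * ((3 * m + (m + s))
          * (4 * m ^ 2 - m * (m + s) + (m + s) ^ 2) + (m + s + m) ^ 2 * t) ^ 2 ≠ 0 by
            positivity) ?_
      rw [mul_zero (4 : ℝ), zero_mul, zero_div]
      linear_combination ((s * (s ^ 2 + 4 * m * s + 16 * m ^ 2)) * (l * ((m + s + m) * (3 * m + (m + s)) * (((3 * m + (m + s)) * (4 * m ^ 2 - m * (m + s) + (m + s) ^ 2)) + (m + s + m) ^ 2 * t))
          + (m * (2 * (m + s) ^ 3 + 9 * m * (m + s) ^ 2 + 24 * m ^ 2 * (m + s) + 29 * m ^ 3)))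
        + 2 * ((3 * m + (m + s)) * (4 * m ^ 2 - m * (m + s) + (m + s) ^ 2)) * (3 * m + (m + s))
          * (((3 * m + (m + s)) * (4 * m ^ 2 - m * (m + s) + (m + s) ^ 2)) + (m + s + m) ^ 2 * t)) * hl
        - (m * (2 * (m + s) ^ 3 + 9 * m * (m + s) ^ 2 + 24 * m ^ 2 * (m + s) + 29 * m ^ 3))
          * (m + s + m) ^ 2 ^ 2 * ht
    · rintro z - x rfl
      exact ⟨continuous_sqNorm4.continuousAt, sqNorm4_tn hm (Ω := fun s => Ω (m + s)) z⟩
  · intro z hz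
    obtain ⟨e1, e2⟩ := tn_sqrt_core hm hz
    rw [radialMap, toR70_apply, radial7_eq_core7, ← e1, ← e2]
    simp only [tnR]
    congr 2 <;> ring

/-- Removing the nut leaves the open set non-empty, since points of ℂ² are not open. -/
lemma tn_three_le_isometricClass (hm : 0 < m) {U : Set (ℂ × ℂ)} (hU : IsOpen U)
    (hne : U.Nonempty) : 3 ≤ isometricClass (tnMetric m) U := by
  refine three_le_isometricClass finrank_complex_prod fun r s hrs f hf => ?_
  have hV : IsOpen (U \ {0}) := hU.sdiff isClosed_singleton
  have hVne : (U \ {0}).Nonempty := by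
    by_contra h
    have hsub : U ⊆ {0} := sdiff_eq_empty.1 (not_nonempty_iff_eq_empty.1 h)
    obtain ⟨z, hz⟩ := hne
    obtain rfl : z = 0 := hsub hz
    exact not_isOpen_singleton (0 : ℂ × ℂ) ((Subset.antisymm hsub (singleton_subset_iff.2 hz)) ▸ hU)
  refine tn_no_immersion hm hrs hV hVne (fun z hz => hz.2)
    ((contMDiffOn_iff_contDiffOn.1 hf.1).mono sdiff_subset) fun z hz u v => ?_
  have := hf.4 z hz.1 u v
  rw [mfderiv_eq_fderiv, one_pow, one_mul] at this
  exact this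

end TN

/-! ## The complex projective plane: explicit embeddings -/

section CPAlgebra

/-- The quadratic map `(w₀ w̄₂, w₁ w̄₂, hopf (w₀, w₁) / 2)` from `ℂ³` to `ℝ⁷`. -/
def cpQ (w : Fin 3 → ℂ) : Fin 7 → ℝ :=
  ![(w 0).re * (w 2).re + (w 0).im * (w 2).im, (w 0).im * (w 2).re - (w 0).re * (w 2).im,
    (w 1).re * (w 2).re + (w 1).im * (w 2).im, (w 1).im * (w 2).re - (w 1).re * (w 2).im,
    (w 0).re * (w 1).re + (w 0).im * (w 1).im, (w 0).re * (w 1).im - (w 0).im * (w 1).re,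
    ((w 0).re * (w 0).re + (w 0).im * (w 0).im - ((w 1).re * (w 1).re + (w 1).im * (w 1).im)) / 2]

/-- The derivative of `cpQ` at `w` in the direction `v`. -/
def cpQDeriv (w v : Fin 3 → ℂ) : Fin 7 → ℝ :=
  ![(v 0).re * (w 2).re + (w 0).re * (v 2).re + ((v 0).im * (w 2).im + (w 0).im * (v 2).im),
    (v 0).im * (w 2).re + (w 0).im * (v 2).re - ((v 0).re * (w 2).im + (w 0).re * (v 2).im),
    (v 1).re * (w 2).re + (w 1).re * (v 2).re + ((v 1).im * (w 2).im + (w 1).im * (v 2).im),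
    (v 1).im * (w 2).re + (w 1).im * (v 2).re - ((v 1).re * (w 2).im + (w 1).re * (v 2).im),
    (v 0).re * (w 1).re + (w 0).re * (v 1).re + ((v 0).im * (w 1).im + (w 0).im * (v 1).im),
    (v 0).re * (w 1).im + (w 0).re * (v 1).im - ((v 0).im * (w 1).re + (w 0).im * (v 1).re),
    (w 0).re * (v 0).re + (w 0).im * (v 0).im - ((w 1).re * (v 1).re + (w 1).im * (v 1).im)]

/-- `|w₀|² + |w₁|²`. -/
def cpP (w : Fin 3 → ℂ) : ℝ :=
  (w 0).re * (w 0).re + (w 0).im * (w 0).im + ((w 1).re * (w 1).re + (w 1).im * (w 1).im)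
/-- `|w₂|²`. -/
def cpR (w : Fin 3 → ℂ) : ℝ := (w 2).re * (w 2).re + (w 2).im * (w 2).im
/-- The derivative of `cpP`. -/
def cpPDeriv (w v : Fin 3 → ℂ) : ℝ :=
  2 * ((w 0).re * (v 0).re + (w 0).im * (v 0).im + ((w 1).re * (v 1).re + (w 1).im * (v 1).im))
/-- The derivative of `cpR`. -/
def cpRDeriv (w v : Fin 3 → ℂ) : ℝ := 2 * ((w 2).re * (v 2).re + (w 2).im * (v 2).im)

/-- The Hermitian product of `ℂ³`. -/
def herm3 (w v : Fin 3 → ℂ) : ℂ := ∑ k, star (w k) * v k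

lemma cpP_nonneg (w : Fin 3 → ℂ) : 0 ≤ cpP w :=
  add_nonneg (add_nonneg (mul_self_nonneg _) (mul_self_nonneg _))
    (add_nonneg (mul_self_nonneg _) (mul_self_nonneg _))

lemma cpR_nonneg (w : Fin 3 → ℂ) : 0 ≤ cpR w := add_nonneg (mul_self_nonneg _) (mul_self_nonneg _)

lemma herm3_self (w : Fin 3 → ℂ) : (herm3 w w).re = cpP w + cpR w := by
  simp [herm3, Fin.sum_univ_three, cpP, cpR]

lemma cpQ_inner_self (w : Fin 3 → ℂ) :
    ∑ i, cpQ w i * cpQ w i = cpP w * cpR w + cpP w ^ 2 / 4 := by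
  simp only [cpQ, cpP, cpR, Fin.sum_univ_seven, Matrix.cons_val]
  ring

lemma cpQ_inner_deriv (w v : Fin 3 → ℂ) : ∑ i, cpQ w i * cpQDeriv w v i
    = (cpRDeriv w v * cpP w + cpPDeriv w v * cpR w + cpP w * cpPDeriv w v / 2) / 2 := by
  simp only [cpQ, cpQDeriv, cpP, cpR, cpPDeriv, cpRDeriv, Fin.sum_univ_seven, Matrix.cons_val]
  ring

lemma cpQDeriv_inner (w v v' : Fin 3 → ℂ) : ∑ i, cpQDeriv w v i * cpQDeriv w v' i
    = (cpP w + cpR w) * (herm3 v v').re - (star (herm3 w v) * herm3 w v').re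
      + (cpPDeriv w v * cpPDeriv w v' + 2 * cpPDeriv w v * cpRDeriv w v'
        + 2 * cpPDeriv w v' * cpRDeriv w v) / 4 := by
  simp [cpQDeriv, cpP, cpR, cpPDeriv, cpRDeriv, herm3, Fin.sum_univ_seven, Fin.sum_univ_three]
  ring

/-- The homogeneous form of the conformal factor identity. -/
lemma cpQ_conformal (w v v' : Fin 3 → ℂ) {t e ε : ℝ} (h : 4 * ε * e ^ 2 = t * (4 - t)) :
    ∑ i, (cpQDeriv w v i * (cpP w + t * cpR w) - cpQ w i * (cpPDeriv w v + t * cpRDeriv w v))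
        * (cpQDeriv w v' i * (cpP w + t * cpR w) - cpQ w i * (cpPDeriv w v' + t * cpRDeriv w v'))
      + ε * ((e * cpRDeriv w v * (cpP w + t * cpR w)
          - e * cpR w * (cpPDeriv w v + t * cpRDeriv w v))
        * (e * cpRDeriv w v' * (cpP w + t * cpR w)
          - e * cpR w * (cpPDeriv w v' + t * cpRDeriv w v')))
      = (cpP w + t * cpR w) ^ 2 * ((cpP w + cpR w) * (herm3 v v').re
        - (star (herm3 w v) * herm3 w v').re) := by
  have h1 := cpQ_inner_self w
  have h2 := cpQ_inner_deriv w v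
  have h2' := cpQ_inner_deriv w v'
  have h3 := cpQDeriv_inner w v v'
  rw [Fin.sum_univ_seven] at *
  generalize cpP w = p at *
  generalize cpR w = q at *
  generalize cpPDeriv w v = a at *
  generalize cpPDeriv w v' = a' at *
  generalize cpRDeriv w v = b at *
  generalize cpRDeriv w v' = b' at *
  linear_combination (p + t * q) ^ 2 * h3 - (p + t * q) * (a' + t * b') * h2
    - (p + t * q) * (a + t * b) * h2' + (a + t * b) * (a' + t * b') * h1
    + (b * p - q * a) * (b' * p - q * a') / 4 * h

/-- The homogeneous map underlying the embeddings of the projective plane. -/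
def cpMap (t e : ℝ) (w : Fin 3 → ℂ) : (Fin 7 → ℝ) × ℝ :=
  (fun i => cpQ w i / (cpP w + t * cpR w), e * cpR w / (cpP w + t * cpR w))

/-- The conformal factor of `cpMap`. -/
def cpFactor (t : ℝ) (w : Fin 3 → ℂ) : ℝ := (cpP w + cpR w) / (cpP w + t * cpR w)

variable {w w' : Fin 3 → ℂ} {c : ℂ}

lemma cpQ_smul (h : ∀ k, w' k = c * w k) (i : Fin 7) : cpQ w' i = Complex.normSq c * cpQ w i := by
  fin_cases i <;> simp [cpQ, h, Complex.normSq_apply] <;> ring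

lemma cpP_smul (h : ∀ k, w' k = c * w k) : cpP w' = Complex.normSq c * cpP w := by
  simp [cpP, h, Complex.normSq_apply]; ring

lemma cpR_smul (h : ∀ k, w' k = c * w k) : cpR w' = Complex.normSq c * cpR w := by
  simp [cpR, h, Complex.normSq_apply]; ring

/-- Numerators and denominators are all Hermitian quadratic, so the map is unchanged by complex
rescaling and descends to CP². -/
lemma cpMap_smul (t e : ℝ) (hc : c ≠ 0) (h : ∀ k, w' k = c * w k) :
    cpMap t e w' = cpMap t e w := by
  have hc' : Complex.normSq c ≠ 0 := (Complex.normSq_pos.2 hc).ne'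
  simp only [cpMap, cpQ_smul h, cpP_smul h, cpR_smul h, mul_left_comm t, mul_left_comm e,
    ← mul_add, mul_div_mul_left _ _ hc']

lemma cpFactor_smul (t : ℝ) (hc : c ≠ 0) (h : ∀ k, w' k = c * w k) :
    cpFactor t w' = cpFactor t w := by
  have hc' : Complex.normSq c ≠ 0 := (Complex.normSq_pos.2 hc).ne'
  simp only [cpFactor, cpP_smul h, cpR_smul h, mul_left_comm t, ← mul_add,
    mul_div_mul_left _ _ hc']

end CPAlgebra

/-! ### The homogeneous identity in an affine chart -/

section CPDeriv

open CP2

/-- The derivative of `affineVec`. -/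
def affineTan (i : Fin 3) (u : ℂ × ℂ) : Fin 3 → ℂ := i.insertNth (0 : ℂ) ![u.1, u.2]

lemma HasDirDeriv.sub {f g D E : _} {z : ℂ × ℂ} (hf : HasDirDeriv f D z)
    (hg : HasDirDeriv g E z) : HasDirDeriv (fun w => f w - g w) (fun u => D u - E u) z := by
  obtain ⟨L, hL, h⟩ := hf
  obtain ⟨M, hM, h'⟩ := hg
  exact ⟨_, hL.sub hM, fun u => by simp [h, h']⟩

lemma HasDirDeriv.div {f g D E : _} {z : ℂ × ℂ} (hf : HasDirDeriv f D z)
    (hg : HasDirDeriv g E z) (h0 : g z ≠ 0) :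
    HasDirDeriv (fun w => f w / g w) (fun u => (D u * g z - f z * E u) / g z ^ 2) z := by
  obtain ⟨L, hL, h⟩ := hf
  obtain ⟨M, hM, h'⟩ := hg
  simp only [div_eq_mul_inv (f _)]
  refine ⟨_, hL.mul ((hasDerivAt_inv h0).comp_hasFDerivAt z hM), fun u => ?_⟩
  simp [h, h']
  field_simp
  ring

lemma hasFDerivAt_affineVec (i k : Fin 3) (z : ℂ × ℂ) :
    ∃ L : ℂ × ℂ →L[ℝ] ℂ, HasFDerivAt (fun z => affineVec i z k) L z ∧
      ∀ u, L u = affineTan i u k := by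
  rcases eq_or_ne k i with rfl | hk
  · refine ⟨0, ?_, fun u => by simp [affineTan]⟩
    simpa using hasFDerivAt_const (1 : ℂ) z
  · obtain ⟨l, rfl⟩ := Fin.exists_succAbove_eq hk
    fin_cases l
    · exact ⟨ContinuousLinearMap.fst ℝ ℂ ℂ, by simpa using hasFDerivAt_fst,
        fun u => by simp [affineTan]⟩
    · exact ⟨ContinuousLinearMap.snd ℝ ℂ ℂ, by simpa using hasFDerivAt_snd,
        fun u => by simp [affineTan]⟩

lemma hasDirDeriv_affine_re (i k : Fin 3) (z : ℂ × ℂ) :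
    HasDirDeriv (fun z => (affineVec i z k).re) (fun u => (affineTan i u k).re) z := by
  obtain ⟨L, hL, h⟩ := hasFDerivAt_affineVec i k z
  exact ⟨_, Complex.reCLM.hasFDerivAt.comp z hL, fun u => by simp [h]⟩

lemma hasDirDeriv_affine_im (i k : Fin 3) (z : ℂ × ℂ) :
    HasDirDeriv (fun z => (affineVec i z k).im) (fun u => (affineTan i u k).im) z := by
  obtain ⟨L, hL, h⟩ := hasFDerivAt_affineVec i k z
  exact ⟨_, Complex.imCLM.hasFDerivAt.comp z hL, fun u => by simp [h]⟩

variable (i : Fin 3) (z : ℂ × ℂ)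

lemma hasDirDeriv_cpQ (j : Fin 7) : HasDirDeriv (fun z => cpQ (affineVec i z) j)
    (fun u => cpQDeriv (affineVec i z) (affineTan i u) j) z := by
  have x := fun k => hasDirDeriv_affine_re i k z
  have y := fun k => hasDirDeriv_affine_im i k z
  fin_cases j
  · exact ((x 0).mul (x 2)).add ((y 0).mul (y 2))
  · exact ((y 0).mul (x 2)).sub ((x 0).mul (y 2))
  · exact ((x 1).mul (x 2)).add ((y 1).mul (y 2))
  · exact ((y 1).mul (x 2)).sub ((x 1).mul (y 2))
  · exact ((x 0).mul (x 1)).add ((y 0).mul (y 1))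
  · exact ((x 0).mul (y 1)).sub ((y 0).mul (x 1))
  · refine (((((x 0).mul (x 0)).add ((y 0).mul (y 0))).sub
      (((x 1).mul (x 1)).add ((y 1).mul (y 1)))).const_mul 2⁻¹).congr (fun w => ?_) fun u => ?_ <;>
      simp [cpQ, cpQDeriv] <;> ring

lemma hasDirDeriv_cpP : HasDirDeriv (fun z => cpP (affineVec i z))
    (fun u => cpPDeriv (affineVec i z) (affineTan i u)) z := by
  have x := fun k => hasDirDeriv_affine_re i k z
  have y := fun k => hasDirDeriv_affine_im i k z
  refine ((((x 0).mul (x 0)).add ((y 0).mul (y 0))).add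
      (((x 1).mul (x 1)).add ((y 1).mul (y 1)))).congr (fun w => rfl) fun u => ?_
  simp only [cpPDeriv]; ring

lemma hasDirDeriv_cpR : HasDirDeriv (fun z => cpR (affineVec i z))
    (fun u => cpRDeriv (affineVec i z) (affineTan i u)) z := by
  have x := fun k => hasDirDeriv_affine_re i k z
  have y := fun k => hasDirDeriv_affine_im i k z
  refine (((x 2).mul (x 2)).add ((y 2).mul (y 2))).congr (fun w => rfl) fun u => ?_
  simp only [cpRDeriv]; ring

lemma herm3_affineTan (u v : ℂ × ℂ) : herm3 (affineTan i u) (affineTan i v) = herm u v := by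
  simp [herm3, Fin.sum_univ_succAbove _ i, affineTan, herm]

lemma herm3_affineVec_affineTan (u : ℂ × ℂ) : herm3 (affineVec i z) (affineTan i u) = herm z u := by
  simp [herm3, Fin.sum_univ_succAbove _ i, affineTan, affineVec, herm]

lemma cp_sum_affineVec : cpP (affineVec i z) + cpR (affineVec i z) = 1 + normSq z := by
  rw [← herm3_self, herm3, Fin.sum_univ_succAbove _ i]
  simp [affineVec, normSq, Complex.normSq_apply]

variable {i z}

/-- The quotient rule reduces this to `cpQ_conformal`. Since that identity is homogeneous, all three
charts are treated alike although the map singles out the coordinate w₂. -/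
lemma hasFDerivAt_cpMap {t e : ℝ} (h0 : cpP (affineVec i z) + t * cpR (affineVec i z) ≠ 0)
    {ε : ℝ} (hte : 4 * ε * e ^ 2 = t * (4 - t)) :
    ∃ L : ℂ × ℂ →L[ℝ] (Fin 7 → ℝ) × ℝ, HasFDerivAt (fun z => cpMap t e (affineVec i z)) L z ∧
      ∀ u v, ∑ j, (L u).1 j * (L v).1 j + ε * ((L u).2 * (L v).2)
        = cpFactor t (affineVec i z) ^ 2 * fsAffine z u v := by
  have hN := (hasDirDeriv_cpP i z).add ((hasDirDeriv_cpR i z).const_mul t)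
  have h : ∀ j, _ := fun j => (hasDirDeriv_cpQ i z j).div hN h0
  choose L hL hLu using h
  obtain ⟨M, hM, hMu⟩ := ((hasDirDeriv_cpR i z).const_mul e).div hN h0
  refine ⟨(ContinuousLinearMap.pi L).prod M, (hasFDerivAt_pi.2 hL).prodMk hM, fun u v => ?_⟩
  have key := cpQ_conformal (affineVec i z) (affineTan i u) (affineTan i v) hte
  simp only [ContinuousLinearMap.prod_apply, ContinuousLinearMap.coe_pi', hLu, hMu]
  rw [herm3_affineTan, herm3_affineVec_affineTan, herm3_affineVec_affineTan,
    cp_sum_affineVec] at key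
  rw [cpFactor, cp_sum_affineVec, fsAffine,
    show herm u z = star (herm z u) by simp [herm]; ring]
  have hs := normSq_nonneg z
  have h1 : 1 + normSq z ≠ 0 := by positivity
  rw [Fin.sum_univ_seven] at *
  generalize cpP (affineVec i z) + t * cpR (affineVec i z) = N at *
  field_simp
  linear_combination key

lemma contDiffAt_cpMap {t : ℝ} (e : ℝ)
    (h0 : cpP (affineVec i z) + t * cpR (affineVec i z) ≠ 0) :
    ContDiffAt ℝ ∞ (fun z => cpMap t e (affineVec i z)) z := by
  have x : ∀ k, ContDiffAt ℝ ∞ (fun z => (affineVec i z k).re) z :=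
    fun k => (Complex.reCLM.contDiff.comp (contDiff_affineVec i k)).contDiffAt
  have y : ∀ k, ContDiffAt ℝ ∞ (fun z => (affineVec i z k).im) z :=
    fun k => (Complex.imCLM.contDiff.comp (contDiff_affineVec i k)).contDiffAt
  have hP : ContDiffAt ℝ ∞ (fun z => cpP (affineVec i z)) z :=
    (((x 0).mul (x 0)).add ((y 0).mul (y 0))).add (((x 1).mul (x 1)).add ((y 1).mul (y 1)))
  have hR : ContDiffAt ℝ ∞ (fun z => cpR (affineVec i z)) z :=
    ((x 2).mul (x 2)).add ((y 2).mul (y 2))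
  have hN := hP.add (contDiffAt_const (c := t).mul hR)
  refine (contDiffAt_pi.2 fun j => ContDiffAt.div ?_ hN h0).prodMk
    ((contDiffAt_const.mul hR).div hN h0)
  fin_cases j
  · exact ((x 0).mul (x 2)).add ((y 0).mul (y 2))
  · exact ((y 0).mul (x 2)).sub ((x 0).mul (y 2))
  · exact ((x 1).mul (x 2)).add ((y 1).mul (y 2))
  · exact ((y 1).mul (x 2)).sub ((x 1).mul (y 2))
  · exact ((x 0).mul (x 1)).add ((y 0).mul (y 1))
  · exact ((x 0).mul (y 1)).sub ((y 0).mul (x 1))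
  · exact ((((x 0).mul (x 0)).add ((y 0).mul (y 0))).sub
      (((x 1).mul (x 1)).add ((y 1).mul (y 1)))).div_const 2

end CPDeriv

open CP2

/-! ### Smoothness and differentials on CP² through affine charts -/

section CPManifold

/-- The index of the preferred affine chart. -/
def chartIndex (x : CP2) : Fin 3 := (exists_mem_affineSet x).choose

lemma mem_affineSet_chartIndex (x : CP2) : x ∈ affineSet (chartIndex x) :=
  (exists_mem_affineSet x).choose_spec

variable {r s : ℕ}

lemma contMDiffAt_of_affine {f : CP2 → PseudoEuclid r s} {x : CP2}
    (h : ContDiffAt ℝ ∞ (fun z => f (ofAffine (chartIndex x) z)) (toAffine (chartIndex x) x)) :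
    ContMDiffAt 𝓘(ℝ, ℂ × ℂ) 𝓘(ℝ, PseudoEuclid r s) ∞ f x := by
  have h1 : ContMDiffAt 𝓘(ℝ, ℂ × ℂ) 𝓘(ℝ, ℂ × ℂ) ∞ (toAffine (chartIndex x)) x :=
    contMDiffAt_of_mem_maximalAtlas (e := affineChart (chartIndex x))
      (IsManifold.subset_maximalAtlas (mem_range_self _)) (mem_affineSet_chartIndex x)
  refine (h.contMDiffAt.comp x h1).congr_of_eventuallyEq ?_
  filter_upwards [(isOpen_affineSet _).mem_nhds (mem_affineSet_chartIndex x)] with y hy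
  simp [ofAffine_toAffine _ hy]

/-- The tangent space at x is ℂ² through the preferred chart, so the manifold derivative is by
definition the ordinary derivative in that chart. -/
lemma eta_mfderiv_eq_affine {f : CP2 → PseudoEuclid r s} {x : CP2}
    (h : MDifferentiableAt 𝓘(ℝ, ℂ × ℂ) 𝓘(ℝ, PseudoEuclid r s) f x)
    {L : ℂ × ℂ →L[ℝ] PseudoEuclid r s}
    (hL : HasFDerivAt (fun z => f (ofAffine (chartIndex x) z)) L (toAffine (chartIndex x) x))
    (u v : TangentSpace 𝓘(ℝ, ℂ × ℂ) x) :
    eta (r := r) (s := s) (mfderiv 𝓘(ℝ, ℂ × ℂ) 𝓘(ℝ, PseudoEuclid r s) f x u)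
      (mfderiv 𝓘(ℝ, ℂ × ℂ) 𝓘(ℝ, PseudoEuclid r s) f x v) = eta (L u) (L v) := by
  have hm : HasMFDerivAt 𝓘(ℝ, ℂ × ℂ) 𝓘(ℝ, PseudoEuclid r s) f x L :=
    ⟨h.continuousAt, hL.hasFDerivWithinAt⟩
  have he := hm.mfderiv
  exact congrArg₂ (fun a b : PseudoEuclid r s => eta a b)
    (congrArg (fun M : ℂ × ℂ →L[ℝ] PseudoEuclid r s => M u) he)
    (congrArg (fun M : ℂ × ℂ →L[ℝ] PseudoEuclid r s => M v) he)

lemma contMDiff_ofAffine (i : Fin 3) : ContMDiff 𝓘(ℝ, ℂ × ℂ) 𝓘(ℝ, ℂ × ℂ) ∞ (ofAffine i) := by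
  have := contMDiffOn_symm_of_mem_maximalAtlas (I := 𝓘(ℝ, ℂ × ℂ)) (n := ∞)
    (e := affineChart i) (IsManifold.subset_maximalAtlas (mem_range_self _))
  rw [← contMDiffOn_univ]
  exact this

end CPManifold

/-! ### The maps on CP² and why they are embeddings -/

section CPEmbedding

/-- The map of the projective plane induced by `cpMap`. -/
def cpF (t e : ℝ) (x : CP2) : (Fin 7 → ℝ) × ℝ := cpMap t e x.rep
/-- The function on the projective plane induced by `cpFactor`. -/
def cpOmega (t : ℝ) (x : CP2) : ℝ := cpFactor t x.rep
/-- Where `cpMap` is defined. -/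
def cpDom (t : ℝ) : Set CP2 := {x | 0 < cpP x.rep + t * cpR x.rep}

lemma cpF_mk (t e : ℝ) (w : {w : Fin 3 → ℂ // w ≠ 0}) : cpF t e (mk w) = cpMap t e w.1 := by
  obtain ⟨c, hc, h⟩ := rep_mk w
  exact cpMap_smul t e hc h

lemma cpOmega_mk (t : ℝ) (w : {w : Fin 3 → ℂ // w ≠ 0}) : cpOmega t (mk w) = cpFactor t w.1 := by
  obtain ⟨c, hc, h⟩ := rep_mk w
  exact cpFactor_smul t hc h

lemma mem_cpDom_mk (t : ℝ) (w : {w : Fin 3 → ℂ // w ≠ 0}) :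
    mk w ∈ cpDom t ↔ 0 < cpP w.1 + t * cpR w.1 := by
  obtain ⟨c, hc, h⟩ := rep_mk w
  rw [cpDom, mem_ofPred_eq, cpP_smul h, cpR_smul h, mul_left_comm, ← mul_add]
  exact mul_pos_iff_of_pos_left (Complex.normSq_pos.2 hc)

lemma cp_sum_pos {w : Fin 3 → ℂ} (hw : w ≠ 0) : 0 < cpP w + cpR w := by
  obtain ⟨k, hk⟩ := Function.ne_iff.1 hw
  have h := Complex.normSq_pos.2 hk
  rw [← herm3_self, herm3]
  simp only [Complex.re_sum]
  have hsum : ∀ j, (star (w j) * w j).re = Complex.normSq (w j) := fun j => by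
    simp [Complex.normSq_apply]
  simp only [hsum]
  exact Finset.sum_pos' (fun j _ => Complex.normSq_nonneg _) ⟨k, Finset.mem_univ k, h⟩

lemma cpDom_eq_univ {t : ℝ} (ht : 0 < t) : cpDom t = univ := by
  refine eq_univ_of_forall fun x => ?_
  have h1 := cpP_nonneg x.rep
  have h2 := cpR_nonneg x.rep
  have h3 := cp_sum_pos x.rep_nonzero
  rw [cpDom, mem_ofPred_eq]
  rcases h1.eq_or_lt with h | h
  · have : 0 < cpR x.rep := by linarith
    rw [← h]; positivity
  · positivity

lemma continuous_cpQ : Continuous cpQ := by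
  refine continuous_pi fun i => ?_
  have x : ∀ k, Continuous fun w : Fin 3 → ℂ => (w k).re :=
    fun k => Complex.continuous_re.comp (continuous_apply k)
  have y : ∀ k, Continuous fun w : Fin 3 → ℂ => (w k).im :=
    fun k => Complex.continuous_im.comp (continuous_apply k)
  fin_cases i
  · exact ((x 0).mul (x 2)).add ((y 0).mul (y 2))
  · exact ((y 0).mul (x 2)).sub ((x 0).mul (y 2))
  · exact ((x 1).mul (x 2)).add ((y 1).mul (y 2))
  · exact ((y 1).mul (x 2)).sub ((x 1).mul (y 2))
  · exact ((x 0).mul (x 1)).add ((y 0).mul (y 1))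
  · exact ((x 0).mul (y 1)).sub ((y 0).mul (x 1))
  · exact ((((x 0).mul (x 0)).add ((y 0).mul (y 0))).sub
      (((x 1).mul (x 1)).add ((y 1).mul (y 1)))).div_const 2

lemma continuous_cpF_one (e : ℝ) : Continuous (cpF 1 e) := by
  rw [isQuotientMap_mk.continuous_iff]
  have h : cpF 1 e ∘ mk = fun w => cpMap 1 e w.1 := funext fun w => cpF_mk 1 e w
  rw [h]
  have hP : Continuous cpP := by unfold cpP; fun_prop
  have hR : Continuous cpR := by unfold cpR; fun_prop
  have hv : Continuous fun w : {w : Fin 3 → ℂ // w ≠ 0} => w.1 := continuous_subtype_val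
  have hN : ∀ w : {w : Fin 3 → ℂ // w ≠ 0}, cpP w.1 + 1 * cpR w.1 ≠ 0 := fun w => by
    rw [one_mul]; exact (cp_sum_pos w.2).ne'
  have hNc : Continuous fun w : {w : Fin 3 → ℂ // w ≠ 0} => cpP w.1 + 1 * cpR w.1 :=
    (hP.comp hv).add (continuous_const.mul (hR.comp hv))
  refine (continuous_pi fun i => ?_).prodMk ((continuous_const.mul (hR.comp hv)).div hNc hN)
  exact (((continuous_apply i).comp continuous_cpQ).comp hv).div hNc hN

/-- The unit sphere of ℂ³ maps onto CP². -/
instance : CompactSpace CP2 := by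
  have hc : IsCompact (Metric.sphere (0 : Fin 3 → ℂ) 1) := isCompact_sphere _ _
  have : CompactSpace (Metric.sphere (0 : Fin 3 → ℂ) 1) := isCompact_iff_compactSpace.1 hc
  let j : Metric.sphere (0 : Fin 3 → ℂ) 1 → {w : Fin 3 → ℂ // w ≠ 0} := fun w =>
    ⟨w.1, fun h => by have := w.2; rw [h] at this; simp at this⟩
  have hj : Continuous j := continuous_subtype_val.subtype_mk _
  have hr : range (mk ∘ j) = univ := by
    refine eq_univ_of_forall fun x => ?_
    have hx := norm_pos_iff.2 x.rep_nonzero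
    refine ⟨⟨((‖x.rep‖⁻¹ : ℝ) : ℂ) • x.rep, ?_⟩, ?_⟩
    · rw [mem_sphere_zero_iff_norm, norm_smul, Complex.norm_real, norm_inv, norm_norm]
      exact inv_mul_cancel₀ hx.ne'
    · conv_rhs => rw [← x.mk_rep]
      refine (Projectivization.mk_eq_mk_iff' ℂ _ _ _ _).2 ⟨((‖x.rep‖⁻¹ : ℝ) : ℂ), rfl⟩
  exact ⟨hr ▸ isCompact_range (isQuotientMap_mk.continuous.comp hj)⟩

/-- For t = 1 the eight coordinates determine every entry of the projection w w*/|w|²: its trace is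
1, so the last coordinate and the difference of the other two diagonal entries give the whole
diagonal. -/
lemma cp_rankOne {w w' : Fin 3 → ℂ} {e : ℝ} (he : e ≠ 0) (hs : 0 < cpP w + cpR w)
    (hs' : 0 < cpP w' + cpR w') (h : cpMap 1 e w = cpMap 1 e w') (j k : Fin 3) :
    ((cpP w' + cpR w' : ℝ) : ℂ) * (w j * star (w k))
      = ((cpP w + cpR w : ℝ) : ℂ) * (w' j * star (w' k)) := by
  simp only [cpMap, one_mul, Prod.mk.injEq] at h
  obtain ⟨hQ, hR⟩ := h
  rw [div_eq_div_iff hs.ne' hs'.ne'] at hR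
  have hQ' : ∀ i, cpQ w i * (cpP w' + cpR w') = cpQ w' i * (cpP w + cpR w) := fun i =>
    (div_eq_div_iff hs.ne' hs'.ne').1 (congrFun hQ i)
  have hR' : cpR w * (cpP w' + cpR w') = cpR w' * (cpP w + cpR w) :=
    mul_left_cancel₀ he (by linear_combination hR)
  have h0 := hQ' 0
  have h1 := hQ' 1
  have h2 := hQ' 2
  have h3 := hQ' 3
  have h4 := hQ' 4
  have h5 := hQ' 5
  have h6 := hQ' 6
  have hP : cpP w * (cpP w' + cpR w') = cpP w' * (cpP w + cpR w) := by linear_combination -hR'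
  have dP : cpP w = (w 0).re * (w 0).re + (w 0).im * (w 0).im
    + ((w 1).re * (w 1).re + (w 1).im * (w 1).im) := rfl
  have dP' : cpP w' = (w' 0).re * (w' 0).re + (w' 0).im * (w' 0).im
    + ((w' 1).re * (w' 1).re + (w' 1).im * (w' 1).im) := rfl
  have dR : cpR w = (w 2).re * (w 2).re + (w 2).im * (w 2).im := rfl
  have dR' : cpR w' = (w' 2).re * (w' 2).re + (w' 2).im * (w' 2).im := rfl
  generalize cpP w + cpR w = σ at *
  generalize cpP w' + cpR w' = σ' at *
  rw [dP, dP'] at hP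
  rw [dR, dR'] at hR'
  simp only [cpQ, Matrix.cons_val] at h0 h1 h2 h3 h4 h5 h6
  fin_cases j <;> fin_cases k <;> apply Complex.ext <;> simp <;> linarith

lemma cpF_one_injective {e : ℝ} (he : e ≠ 0) : Function.Injective (cpF 1 e) := by
  intro x y hxy
  have hw := x.rep_nonzero
  have hs := cp_sum_pos hw
  have hs' := cp_sum_pos y.rep_nonzero
  have key := cp_rankOne he hs hs' hxy
  obtain ⟨k, hk⟩ := Function.ne_iff.1 hw
  have hk' : y.rep k ≠ 0 := fun h => by
    have := key k k
    rw [h, zero_mul, mul_zero] at this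
    exact mul_ne_zero (Complex.ofReal_ne_zero.2 hs'.ne') (mul_ne_zero hk (star_ne_zero.2 hk)) this
  rw [← x.mk_rep, ← y.mk_rep]
  have c1 : ((cpP x.rep + cpR x.rep : ℝ) : ℂ) ≠ 0 := Complex.ofReal_ne_zero.2 hs.ne'
  have c2 : ((cpP y.rep + cpR y.rep : ℝ) : ℂ) ≠ 0 := Complex.ofReal_ne_zero.2 hs'.ne'
  have c3 : star (x.rep k) ≠ 0 := star_ne_zero.2 hk
  -- A column of w w* with non-zero diagonal entry spans the line of w; comparing the two k-th
  -- columns gives the proportionality factor.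
  refine (Projectivization.mk_eq_mk_iff' ℂ _ _ _ _).2
    ⟨(cpP x.rep + cpR x.rep : ℝ) * star (y.rep k)
      / ((cpP y.rep + cpR y.rep : ℝ) * star (x.rep k)), funext fun j => ?_⟩
  rw [Pi.smul_apply, smul_eq_mul, div_mul_eq_mul_div, div_eq_iff (mul_ne_zero c2 c3)]
  linear_combination -key j k

lemma isEmbedding_cpF_one {e : ℝ} (he : e ≠ 0) : IsEmbedding (cpF 1 e) :=
  ((continuous_cpF_one e).isClosedEmbedding (cpF_one_injective he)).isEmbedding

/-- Conformally isometric embeddings of subsets of the projective plane. -/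
lemma cp_isConformalEmbeddingOn {t e ε : ℝ} (hte : 4 * ε * e ^ 2 = t * (4 - t)) {r s : ℕ}
    {T : (Fin 7 → ℝ) × ℝ →L[ℝ] PseudoEuclid r s}
    (hT : ∀ x y, eta (T x) (T y) = ∑ i, x.1 i * y.1 i + ε * (x.2 * y.2))
    {Ψ : PseudoEuclid r s → (Fin 7 → ℝ) × ℝ} (hΨ : Continuous Ψ)
    (h : ∀ x ∈ cpDom t, Ψ (T (cpF t e x)) = cpF 1 1 x) :
    IsConformalEmbeddingOn fsMetric (cpOmega t) (cpDom t) (fun x => T (cpF t e x)) := by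
  have hx : ∀ x : CP2, x ∈ cpDom t → 0 < cpP (affineVec (chartIndex x)
      (toAffine (chartIndex x) x)) + t * cpR (affineVec (chartIndex x)
      (toAffine (chartIndex x) x)) := fun x hx => by
    rw [← ofAffine_toAffine _ (mem_affineSet_chartIndex x)] at hx
    exact (mem_cpDom_mk t _).1 hx
  have hfun : ∀ i, (fun z => T (cpF t e (ofAffine i z))) = fun z => T (cpMap t e (affineVec i z)) :=
    fun i => funext fun z => by rw [ofAffine, cpF_mk]
  have hsm : ∀ x ∈ cpDom t, ContMDiffAt 𝓘(ℝ, ℂ × ℂ) 𝓘(ℝ, PseudoEuclid r s) ∞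
      (fun x => T (cpF t e x)) x := fun x hxU => by
    refine contMDiffAt_of_affine ?_
    rw [hfun]
    exact T.contDiff.contDiffAt.comp _ (contDiffAt_cpMap e (hx x hxU).ne')
  refine ⟨fun x hxU => (hsm x hxU).contMDiffWithinAt, ?_, fun x hxU => ?_, fun x hxU u v => ?_⟩
  -- Only t = 1 needs a topological argument (compactness); the other maps are embeddings because Ψ
  -- carries them back to that one.
  · refine IsEmbedding.of_comp (continuousOn_iff_continuous_domRestrict.1
      fun x hxU => (hsm x hxU).continuousAt.continuousWithinAt) hΨ ?_
    convert (isEmbedding_cpF_one one_ne_zero).comp IsEmbedding.subtypeVal using 1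
    funext x
    exact h x x.2
  · exact div_pos (cp_sum_pos x.rep_nonzero) hxU
  · obtain ⟨L, hL, hLuv⟩ := hasFDerivAt_cpMap (hx x hxU).ne' hte
    rw [eta_mfderiv_eq_affine ((hsm x hxU).mdifferentiableAt (by simp)) (L := T.comp L)
      (by rw [hfun]; exact T.hasFDerivAt.comp _ hL) u v]
    have hO : cpOmega t x = cpFactor t (affineVec (chartIndex x) (toAffine (chartIndex x) x)) := by
      conv_lhs => rw [← ofAffine_toAffine _ (mem_affineSet_chartIndex x)]
      exact cpOmega_mk t _
    rw [hO]
    exact (hT _ _).trans (hLuv u v)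

end CPEmbedding

/-! ### The explicit embeddings of CP² and its embedding class -/

section CPExplicit

open CP2

lemma affineVec_two (z : ℂ × ℂ) : affineVec 2 z = ![z.1, z.2, 1] := by
  funext k
  fin_cases k
  · exact affineVec_zero 2 z
  · exact affineVec_one 2 z
  · exact affineVec_self 2 z

lemma cpMap_cpPoint (t e : ℝ) (z : ℂ × ℂ) : cpF t e (cpPoint z)
    = (core7 (1 / (normSq z + t)) (1 / (2 * (normSq z + t))) z, e / (normSq z + t)) := by
  rw [cpPoint, ofAffine, cpF_mk, cpMap]
  have hP : cpP (affineVec 2 z) = normSq z := by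
    simp [cpP, affineVec_two, normSq, Complex.normSq_apply]
  have hR : cpR (affineVec 2 z) = 1 := by simp [cpR]
  simp only [hP, hR, mul_one]
  refine Prod.ext (funext fun i => ?_) rfl
  rw [affineVec_two]
  fin_cases i <;> simp [cpQ, core7, hopf, Complex.normSq_apply] <;> ring

lemma cpOmega_cpPoint (t : ℝ) (z : ℂ × ℂ) :
    cpOmega t (cpPoint z) = (normSq z + 1) / (normSq z + t) := by
  rw [cpPoint, ofAffine, cpOmega_mk, cpFactor]
  simp [cpP, cpR, affineVec_two, normSq, Complex.normSq_apply]

lemma cpF_cpPoint_radial {t e : ℝ} {z : ℂ × ℂ} (hz : z ≠ 0) : cpF t e (cpPoint z)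
    = (radial7 (rad z / (rad z ^ 2 + t)) (rad z ^ 2 / (2 * (rad z ^ 2 + t))) z,
      e / (rad z ^ 2 + t)) := by
  have hs := normSq_pos hz
  have hr : rad z ≠ 0 := (Real.sqrt_pos.2 hs).ne'
  rw [cpMap_cpPoint, radial7_eq_core7, rad_sq, div_right_comm, div_self hr,
    div_right_comm (normSq z), div_self hs.ne']

/-- At t = 1 the conformal factor is 1, and 4e² = t(4 - t) gives e = √3/2. -/
lemma fs_isometric : IsIsometricEmbeddingOn fsMetric univ (fun x => toR80 (cpF 1 (√3 / 2) x)) := by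
  have h3 : √3 ≠ 0 := by positivity
  have h := cp_isConformalEmbeddingOn (t := 1) (e := √3 / 2) (ε := 1)
    (by rw [div_pow, Real.sq_sqrt (by norm_num)]; norm_num) eta_toR80
    (Ψ := fun y => (fromR80 y, 2 / √3 * y.1 (Fin.last 7))) (by fun_prop) (fun x _ => by
      refine Prod.ext (fromR80_toR80 _) ?_
      rw [show cpF 1 (√3 / 2) x = ((cpF 1 (√3 / 2) x).1, (cpF 1 (√3 / 2) x).2) from rfl,
        toR80_apply]
      simp only [Fin.snoc_last, cpF, cpMap]
      field_simp)
  rw [cpDom_eq_univ one_pos] at h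
  refine h.congr isOpen_univ (fun _ _ => rfl) fun x _ => ?_
  rw [cpOmega, cpFactor, one_mul, div_self (cp_sum_pos x.rep_nonzero).ne']

/-- The eighth coordinate is unnecessary exactly when t(4 - t) = 0. These are the stereographic
projections of the sphere containing the isometric image, t = 0 having its pole at the image of
[0:0:1]. -/
lemma fs_conformal {t : ℝ} (ht : t * (4 - t) = 0) :
    IsConformalEmbeddingOn fsMetric (cpOmega t) (cpDom t) (fun x => toR70 (cpF t 0 x)) := by
  have ht' : t = 0 ∨ t = 4 := by
    rcases mul_eq_zero.1 ht with h | h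
    · exact Or.inl h
    · right; linarith
  have ht2 : 1 - t / 2 ≠ 0 := by rcases ht' with rfl | rfl <;> norm_num
  have ht4 : t ≤ 4 := by rcases ht' with rfl | rfl <;> norm_num
  have hD : ∀ y : PseudoEuclid 7 0, max (1 + (1 - t) * ((∑ i, y.1 i * y.1 i - 1 / 4)
      / (1 - t / 2))) (1 / 4) ≠ 0 := fun y => (lt_max_of_lt_right (by norm_num)).ne'
  refine cp_isConformalEmbeddingOn (ε := 0) (by rw [ht]; ring) eta_toR70
    -- The inverse stereographic projection: |y|² - 1/4 equals (1 - t/2) R/N, with R = |w₂|² and N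
    -- the denominator, so R/N and |w|²/N = 1 + (1 - t)R/N are functions of y. On the image the
    -- latter is at least 1/4 because t ≤ 4; the maximum with 1/4 only keeps Ψ continuous elsewhere.
    (Ψ := fun y => (fun i => y.1 i
      / max (1 + (1 - t) * ((∑ i, y.1 i * y.1 i - 1 / 4) / (1 - t / 2))) (1 / 4),
      (∑ i, y.1 i * y.1 i - 1 / 4) / (1 - t / 2)
      / max (1 + (1 - t) * ((∑ i, y.1 i * y.1 i - 1 / 4) / (1 - t / 2))) (1 / 4))) ?_
      fun x hx => ?_
  · have h1 : Continuous fun y : PseudoEuclid 7 0 =>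
        (∑ i, y.1 i * y.1 i - 1 / 4) / (1 - t / 2) := by fun_prop
    have h2 : Continuous fun y : PseudoEuclid 7 0 => max (1 + (1 - t) *
        ((∑ i, y.1 i * y.1 i - 1 / 4) / (1 - t / 2))) (1 / 4) :=
      (continuous_const.add (continuous_const.mul h1)).max continuous_const
    exact (continuous_pi fun i => (by fun_prop : Continuous fun y : PseudoEuclid 7 0 =>
      y.1 i).div h2 hD).prodMk (h1.div h2 hD)
  · have hN : 0 < cpP x.rep + t * cpR x.rep := hx
    have hP := cpP_nonneg x.rep
    have hR := cpR_nonneg x.rep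
    have hs := cp_sum_pos x.rep_nonzero
    have e1 : ∑ i, (toR70 (cpF t 0 x)).1 i * (toR70 (cpF t 0 x)).1 i
        = (cpP x.rep * cpR x.rep + cpP x.rep ^ 2 / 4) / (cpP x.rep + t * cpR x.rep) ^ 2 := by
      rw [← cpQ_inner_self, Finset.sum_div]
      refine Finset.sum_congr rfl fun i _ => ?_
      show cpQ x.rep i / _ * (cpQ x.rep i / _) = _
      rw [div_mul_div_comm, pow_two]
    have e2 : ((∑ i, (toR70 (cpF t 0 x)).1 i * (toR70 (cpF t 0 x)).1 i) - 1 / 4) / (1 - t / 2)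
        = cpR x.rep / (cpP x.rep + t * cpR x.rep) := by
      rw [e1, div_eq_iff ht2]
      clear e1 hP hs
      generalize cpR x.rep = q at *
      obtain ⟨N, hNe⟩ : ∃ N, N = cpP x.rep + t * q := ⟨_, rfl⟩
      rw [← hNe] at hN ⊢
      rw [show cpP x.rep = N - t * q by linarith]
      have := hN.ne'
      field_simp
      linear_combination -2 * q ^ 2 * ht
    have e3 : max (1 + (1 - t) * (cpR x.rep / (cpP x.rep + t * cpR x.rep))) (1 / 4)
        = (cpP x.rep + cpR x.rep) / (cpP x.rep + t * cpR x.rep) := by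
      have : 1 + (1 - t) * (cpR x.rep / (cpP x.rep + t * cpR x.rep))
          = (cpP x.rep + cpR x.rep) / (cpP x.rep + t * cpR x.rep) := by field_simp; ring
      rw [this]
      refine max_eq_left ?_
      rw [div_le_div_iff₀ (by norm_num) hN]
      nlinarith [mul_le_mul_of_nonneg_right ht4 hR]
    simp only [e2, e3]
    refine Prod.ext (funext fun i => ?_) ?_
    · show cpQ x.rep i / (cpP x.rep + t * cpR x.rep) / _ = cpQ x.rep i / (cpP x.rep + 1 * cpR x.rep)
      rw [one_mul]
      field_simp
    · show cpR x.rep / (cpP x.rep + t * cpR x.rep) / ((cpP x.rep + cpR x.rep)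
        / (cpP x.rep + t * cpR x.rep)) = 1 * cpR x.rep / (cpP x.rep + 1 * cpR x.rep)
      rw [one_mul, div_div_div_cancel_right₀ hN.ne']

lemma compl_cpPoint_zero_subset : {cpPoint 0}ᶜ ⊆ cpDom 0 := by
  intro x hx
  by_contra h
  have hP : cpP x.rep = 0 := by
    have h' : ¬ 0 < cpP x.rep + 0 * cpR x.rep := h
    rw [zero_mul, add_zero] at h'
    exact le_antisymm (not_lt.1 h') (cpP_nonneg _)
  have e : cpP x.rep = Complex.normSq (x.rep 0) + Complex.normSq (x.rep 1) := by
    simp [cpP, Complex.normSq_apply]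
  have n0 := Complex.normSq_nonneg (x.rep 0)
  have n1 := Complex.normSq_nonneg (x.rep 1)
  have h0 : x.rep 0 = 0 := Complex.normSq_eq_zero.1 (by linarith)
  have h1 : x.rep 1 = 0 := Complex.normSq_eq_zero.1 (by linarith)
  have h2 : x ∈ affineSet 2 := fun h2 => x.rep_nonzero (funext fun i => by
    fin_cases i
    exacts [h0, h1, h2])
  apply hx
  have hz : toAffine 2 x = 0 := by
    refine Prod.ext ?_ ?_
    · show x.rep 0 / _ = 0
      rw [h0, zero_div]
    · show x.rep 1 / _ = 0
      rw [h1, zero_div]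
  rw [mem_singleton_iff, cpPoint, ← hz, ofAffine_toAffine 2 h2]

/-- The last affine chart without its origin is dense; this moves the local problem on CP² into the
region where the frame is defined. -/
lemma exists_cpPoint_mem {U : Set CP2} (hU : IsOpen U) (hne : U.Nonempty) :
    ∃ z : ℂ × ℂ, z ≠ 0 ∧ cpPoint z ∈ U := by
  obtain ⟨x, hx⟩ := hne
  obtain ⟨i, hi⟩ := exists_mem_affineSet x
  have hV : IsOpen (ofAffine i ⁻¹' U) := hU.preimage (contMDiff_ofAffine i).continuous
  -- In charts 0 and 1 the second coordinate is w₂ up to scale, and in chart 2 it keeps the point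
  -- off the origin, so one condition serves all three.
  have hd : Dense {z : ℂ × ℂ | z.2 ≠ 0} := (dense_compl_singleton (0 : ℂ)).preimage isOpenMap_snd
  obtain ⟨z, hz, hz2⟩ := hd.inter_open_nonempty _ hV
    ⟨toAffine i x, by rw [mem_preimage, ofAffine_toAffine i hi]; exact hx⟩
  have hz2' : z.2 ≠ 0 := hz2
  have h2 : affineVec i z 2 ≠ 0 := by
    fin_cases i
    · exact (affineVec_one 0 z).trans_ne hz2'
    · exact (affineVec_one 1 z).trans_ne hz2'
    · exact (affineVec_self 2 z).trans_ne one_ne_zero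
  refine ⟨toAffine 2 (ofAffine i z), fun h => ?_, ?_⟩
  · rw [ofAffine, toAffine_mk] at h
    have k0 : affineVec i z 0 = 0 := by
      have := congrArg Prod.fst h
      exact (div_eq_zero_iff.1 this).resolve_right h2
    have k1 : affineVec i z 1 = 0 := by
      have := congrArg Prod.snd h
      exact (div_eq_zero_iff.1 this).resolve_right h2
    fin_cases i
    · exact one_ne_zero ((affineVec_self 0 z).symm.trans k0)
    · exact one_ne_zero ((affineVec_self 1 z).symm.trans k1)
    · exact hz2' ((affineVec_one 2 z).symm.trans k1)
  · have hm : ofAffine i z ∈ affineSet 2 := (mk_mem_affineSet 2 ⟨_, affineVec_ne i z⟩).2 h2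
    rw [cpPoint, ofAffine_toAffine 2 hm]
    exact hz

lemma fderiv_comp_cpPoint {r s : ℕ} {f : CP2 → PseudoEuclid r s} {z : ℂ × ℂ}
    (hf : MDifferentiableAt 𝓘(ℝ, ℂ × ℂ) 𝓘(ℝ, PseudoEuclid r s) f (cpPoint z)) (u : ℂ × ℂ) :
    fderiv ℝ (fun z => f (cpPoint z)) z u
      = mfderiv 𝓘(ℝ, ℂ × ℂ) 𝓘(ℝ, PseudoEuclid r s) f (cpPoint z)
        (mfderiv 𝓘(ℝ, ℂ × ℂ) 𝓘(ℝ, ℂ × ℂ) cpPoint z u) := by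
  have hc : MDifferentiableAt 𝓘(ℝ, ℂ × ℂ) 𝓘(ℝ, ℂ × ℂ) cpPoint z :=
    (contMDiff_ofAffine 2 z).mdifferentiableAt (by simp)
  have := mfderiv_comp z hf hc
  rw [mfderiv_eq_fderiv] at this
  exact congrArg (fun L : ℂ × ℂ →L[ℝ] PseudoEuclid r s => L u) this

/-- Instead of computing the change of charts, the pull-back of the flat metric by the isometric
embedding is evaluated twice at the same point: intrinsically on CP², and in the last affine chart.
-/
lemma fs_pullback_cpPoint (z u v : ℂ × ℂ) :
    fsMetric (cpPoint z) (mfderiv 𝓘(ℝ, ℂ × ℂ) 𝓘(ℝ, ℂ × ℂ) cpPoint z u)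
      (mfderiv 𝓘(ℝ, ℂ × ℂ) 𝓘(ℝ, ℂ × ℂ) cpPoint z v) = fsAffine z u v := by
  have h := fs_isometric
  have hd : MDifferentiableAt 𝓘(ℝ, ℂ × ℂ) 𝓘(ℝ, PseudoEuclid 8 0)
      (fun x => toR80 (cpF 1 (√3 / 2) x)) (cpPoint z) :=
    (h.contMDiffOn.contMDiffAt Filter.univ_mem).mdifferentiableAt (by simp)
  have h1 := h.pullback (cpPoint z) (mem_univ _)
    (mfderiv 𝓘(ℝ, ℂ × ℂ) 𝓘(ℝ, ℂ × ℂ) cpPoint z u)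
    (mfderiv 𝓘(ℝ, ℂ × ℂ) 𝓘(ℝ, ℂ × ℂ) cpPoint z v)
  rw [← fderiv_comp_cpPoint hd, ← fderiv_comp_cpPoint hd, one_pow, one_mul] at h1
  rw [← h1]
  have hpos : 0 < cpP (affineVec 2 z) + 1 * cpR (affineVec 2 z) := by
    rw [one_mul]; exact cp_sum_pos (affineVec_ne 2 z)
  obtain ⟨L, hL, hLuv⟩ := hasFDerivAt_cpMap (e := √3 / 2) (ε := 1) hpos.ne'
    (by rw [div_pow, Real.sq_sqrt (by norm_num)]; norm_num)
  have hfun : (fun z => toR80 (cpF 1 (√3 / 2) (cpPoint z)))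
      = fun z => toR80 (cpMap 1 (√3 / 2) (affineVec 2 z)) :=
    funext fun z => by rw [cpPoint, ofAffine, cpF_mk]
  have hF : HasFDerivAt (fun z => toR80 (cpF 1 (√3 / 2) (cpPoint z))) (toR80.comp L) z := by
    rw [hfun]; exact toR80.hasFDerivAt.comp z hL
  rw [hF.fderiv]
  refine (eta_toR80 (L u) (L v)).trans ?_
  rw [hLuv, cpFactor, one_mul, div_self (cp_sum_pos (affineVec_ne 2 z)).ne', one_pow, one_mul]

lemma fs_three_le_isometricClass {U : Set CP2} (hU : IsOpen U) (hne : U.Nonempty) :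
    3 ≤ isometricClass fsMetric U := by
  refine three_le_isometricClass finrank_complex_prod fun r s hrs f hf => ?_
  obtain ⟨z₀, hz₀, hz₀U⟩ := exists_cpPoint_mem hU hne
  have hc : ContMDiff 𝓘(ℝ, ℂ × ℂ) 𝓘(ℝ, ℂ × ℂ) ∞ cpPoint := contMDiff_ofAffine 2
  have hV : IsOpen (cpPoint ⁻¹' U \ {0}) := (hU.preimage hc.continuous).sdiff isClosed_singleton
  refine fs_no_immersion hrs hV ⟨z₀, hz₀U, hz₀⟩ (fun z hz => hz.2) (f := fun z => f (cpPoint z))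
    (contMDiffOn_iff_contDiffOn.1 (hf.contMDiffOn.comp hc.contMDiffOn fun z hz => hz.1))
    fun z hz u v => ?_
  have hd : MDifferentiableAt 𝓘(ℝ, ℂ × ℂ) 𝓘(ℝ, PseudoEuclid r s) f (cpPoint z) :=
    (hf.contMDiffOn.contMDiffAt (hU.mem_nhds hz.1)).mdifferentiableAt (by simp)
  have h1 := hf.pullback (cpPoint z) hz.1
    (mfderiv 𝓘(ℝ, ℂ × ℂ) 𝓘(ℝ, ℂ × ℂ) cpPoint z u)
    (mfderiv 𝓘(ℝ, ℂ × ℂ) 𝓘(ℝ, ℂ × ℂ) cpPoint z v)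
  rw [← fderiv_comp_cpPoint hd, ← fderiv_comp_cpPoint hd, one_pow, one_mul,
    fs_pullback_cpPoint] at h1
  exact h1

end CPExplicit

end GravInst

end

/-! ### Assembly of the theorem -/

theorem mainTheorem6 :
    -- the Fubini--Study metric on the complex projective plane
    ((∃ f : CP2 → PseudoEuclid 8 0, IsIsometricEmbeddingOn fsMetric univ f ∧
        ∀ z : ℂ × ℂ, z ≠ 0 → f (cpPoint z) =
          (radial8 (rad z / (1 + rad z ^ 2)) (rad z ^ 2 / (2 * (1 + rad z ^ 2)))
            (√3 / (2 * (1 + rad z ^ 2))) z, ![])) ∧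
      (∃ (f : CP2 → PseudoEuclid 7 0) (Ω : CP2 → ℝ), IsConformalEmbeddingOn fsMetric Ω univ f ∧
        ∀ z : ℂ × ℂ, z ≠ 0 → Ω (cpPoint z) = (rad z ^ 2 + 1) / (rad z ^ 2 + 4) ∧
          f (cpPoint z) =
            (radial7 (rad z / (rad z ^ 2 + 4)) (rad z ^ 2 / (2 * (rad z ^ 2 + 4))) z, ![])) ∧
      (∃ (f : CP2 → PseudoEuclid 7 0) (Ω : CP2 → ℝ),
        IsConformalEmbeddingOn fsMetric Ω {cpPoint 0}ᶜ f ∧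
        ∀ z : ℂ × ℂ, z ≠ 0 → Ω (cpPoint z) = 1 + 1 / rad z ^ 2 ∧
          f (cpPoint z) = (radial7 (1 / rad z) (1 / 2) z, ![])) ∧
      (∀ U : Set CP2, IsOpen U → U.Nonempty →
        3 ≤ isometricClass fsMetric U ∧ isometricClass fsMetric U ≤ 4 ∧
          conformalClass fsMetric U ≤ 3)) ∧
    -- the Eguchi--Hanson metric
    (∀ a : ℝ, 0 < a →
      (∃ F : ℝ → ℝ,
        (∀ r, a < r → HasDerivAt F
          (√3 * a ^ 2 / (2 * r ^ 2) * √((3 * r ^ 4 + a ^ 4) / (r ^ 4 - a ^ 4))) r) ∧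
        IsIsometricEmbeddingOn (r := 7) (s := 1) (ehMetric a) {z : ℂ × ℂ | a < rad z}
          (fun z => (radial7 (√(rad z ^ 4 - a ^ 4) / rad z) (a ^ 2 / (2 * rad z)) z,
            ![F (rad z)]))) ∧
      (∀ ε : ℝ, ε = 1 ∨ ε = -1 → ∃ Ω : ℝ → ℝ,
        (∀ r, 0 < r → 7 * a ^ 4 < 4 * r ^ 4 → HasDerivAt Ω
          (Ω r * ((3 * a ^ 4 + 4 * r ^ 4
              + ε * (2 * r ^ 4 * √((7 * a ^ 4 - 4 * r ^ 4) / (a ^ 4 - r ^ 4))))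
            / (r * (3 * a ^ 4 - 4 * r ^ 4)))) r) ∧
        IsConformalEmbeddingOn (r := 7) (s := 0) (ehMetric a) (fun z => Ω (rad z))
          {z : ℂ × ℂ | 7 * a ^ 4 < 4 * rad z ^ 4}
          (fun z => (radial7 (2 * Ω (rad z) * √(ehC a (rad z)))
            (Ω (rad z) * √(ehB (rad z) - ehC a (rad z))) z, ![]))) ∧
      (∀ U : Set (ℂ × ℂ), IsOpen U → U.Nonempty → U ⊆ {z | a < rad z} →
        3 ≤ isometricClass (ehMetric a) U ∧ isometricClass (ehMetric a) U ≤ 4) ∧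
      (∀ U : Set (ℂ × ℂ), IsOpen U → U.Nonempty → U ⊆ {z | 7 * a ^ 4 < 4 * rad z ^ 4} →
        conformalClass (ehMetric a) U ≤ 3)) ∧
    -- the anti-self-dual Taub--NUT metric
    (∀ m : ℝ, 0 < m →
      (∃ (F : ℝ → ℝ) (f : ℂ × ℂ → PseudoEuclid 8 0),
        (∀ r, m < r → HasDerivAt F
          (√((2 * m * r ^ 3 + 9 * m ^ 2 * r ^ 2 + 24 * m ^ 3 * r + 29 * m ^ 4)
            / (4 * (r + m) ^ 3 * (r + 3 * m)))) r) ∧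
        IsIsometricEmbeddingOn (tnMetric m) univ f ∧
        ∀ z : ℂ × ℂ, z ≠ 0 → f z =
          (radial8 (2 * m * √((tnR m z - m) / (tnR m z + m)))
            ((tnR m z - m) / 2 * √((tnR m z + 3 * m) / (tnR m z + m))) (F (tnR m z)) z, ![])) ∧
      (∀ ε : ℝ, ε = 1 ∨ ε = -1 → ∃ (Ω : ℝ → ℝ) (f : ℂ × ℂ → PseudoEuclid 7 0),
        (∀ r, m < r → HasDerivAt Ω
          (Ω r * (((3 * m + r) * (4 * m ^ 2 - m * r + r ^ 2)
              + ε * ((r + m) ^ 2 * √((55 * m ^ 3 + 3 * m ^ 2 * r + 5 * m * r ^ 2 + r ^ 3)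
                / (3 * m + r))))
            / ((m ^ 2 - r ^ 2) * (13 * m ^ 2 + 2 * m * r + r ^ 2)))) r) ∧
        IsConformalEmbeddingOn (tnMetric m) (fun z => Ω (tnR m z))
          {z : ℂ × ℂ | z ≠ 0 ∨ ε = -1} f ∧
        ∀ z : ℂ × ℂ, z ≠ 0 → f z =
          (radial7 (2 * Ω (tnR m z) * √(tnC m (tnR m z)))
            (Ω (tnR m z) * √(tnB m (tnR m z) - tnC m (tnR m z))) z, ![])) ∧
      (∀ U : Set (ℂ × ℂ), IsOpen U → U.Nonempty →
        3 ≤ isometricClass (tnMetric m) U ∧ isometricClass (tnMetric m) U ≤ 4 ∧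
          conformalClass (tnMetric m) U ≤ 3)) := by
  have h4 : IsConformalEmbeddingOn fsMetric (cpOmega 4) univ (fun x => toR70 (cpF 4 0 x)) :=
    cpDom_eq_univ (t := 4) (by norm_num) ▸ fs_conformal (by norm_num)
  refine ⟨⟨⟨_, fs_isometric, fun z hz => ?_⟩, ⟨_, _, h4, fun z hz => ⟨?_, ?_⟩⟩,
    ⟨_, _, (fs_conformal (t := 0) (by norm_num)).mono compl_cpPoint_zero_subset,
      fun z hz => ⟨?_, ?_⟩⟩, fun U hU hne => ⟨fs_three_le_isometricClass hU hne, ?_, ?_⟩⟩,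
    fun a ha => ⟨eh_isometric ha, eh_conformal ha, fun U hU hne hUa =>
      ⟨eh_three_le_isometricClass ha hU hne hUa, ?_⟩, fun U _ _ hUa => ?_⟩,
    fun m hm => ⟨tn_isometric hm, ?_, fun U hU hne =>
      ⟨tn_three_le_isometricClass hm hU hne, ?_, ?_⟩⟩⟩
  · rw [cpF_cpPoint_radial hz, toR80_apply, div_div, add_comm (rad z ^ 2) 1]
    rfl
  · rw [cpOmega_cpPoint, rad_sq]
  · rw [cpF_cpPoint_radial hz, toR70_apply]
  · have hs := normSq_pos hz
    rw [cpOmega_cpPoint, rad_sq]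
    field_simp
    ring
  · have hs := normSq_pos hz
    have hr : rad z ≠ 0 := (Real.sqrt_pos.2 hs).ne'
    rw [cpF_cpPoint_radial hz, toR70_apply, add_zero]
    congr 2 <;> field_simp
  · exact isometricClass_le (r := 8) (s := 0) (n := 4) (by rw [finrank_complex_prod])
      (IsConformalEmbeddingOn.mono fs_isometric (subset_univ U))
  · exact conformalClass_le (n := 3) (by rw [finrank_complex_prod]) (h4.mono (subset_univ U))
  · obtain ⟨F, -, h⟩ := eh_isometric ha
    exact isometricClass_le (n := 4) (by rw [finrank_complex_prod])
      (IsConformalEmbeddingOn.mono h hUa)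
  · obtain ⟨Ω, -, h⟩ := eh_conformal ha 1 (Or.inl rfl)
    exact conformalClass_le (n := 3) (by rw [finrank_complex_prod]) (h.mono hUa)
  -- The domain is everything when ε = -1 and excludes the nut when ε = 1.
  · rintro ε (rfl | rfl)
    · obtain ⟨Ω, f, h1, h2, h3⟩ := tn_conformal_of_ne hm
      exact ⟨Ω, f, h1, h2.mono fun z hz => hz.resolve_right (by norm_num), h3⟩
    · obtain ⟨Ω, f, h1, h2, h3⟩ := tn_conformal_nut hm
      exact ⟨Ω, f, h1, h2.mono (subset_univ _), h3⟩
  · obtain ⟨F, f, -, h, -⟩ := tn_isometric hm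
    exact isometricClass_le (n := 4) (by rw [finrank_complex_prod])
      (IsConformalEmbeddingOn.mono h (subset_univ U))
  · obtain ⟨Ω, f, -, h, -⟩ := tn_conformal_nut hm
    exact conformalClass_le (n := 3) (by rw [finrank_complex_prod]) (h.mono (subset_univ U))
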